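/- Let $D\subset\mathbb{C}$ be a bounded domain (non-empty, open, connected). Let $\mathcal{H}^1=H^1_0(D)$ be the Hilbert space completion of the smooth real functions with compact support in $D$ for the inner product $\langle f,g\rangle_\nabla=\frac1{2\pi}\int\nabla f\cdot\nabla g$, let $(e_n)$ be an orthonormal basis of $\mathcal{H}^1$, let $(a_n)$ be independent standard normal variables on a probability space, and let $h=\sum_n a_ne_n$ be the Gaussian free field in $D$ with Dirichlet boundary conditions. For $f=\sum_n\alpha_ne_n\in\mathcal{H}^1$ put $\langle h,f\rangle_\nabla=\sum_n a_n\alpha_n$ (an almost surely convergent series). For $z\in D$ and $\varepsilon>0$ let $G^z_\varepsilon\in\mathcal{H}^1$ be the weak solution of $-\frac1{2\pi}\Delta G^z_\varepsilon=\nu_{z,\varepsilon}$ in $D$, where $\nu_{z,\varepsilon}$ is the uniform probability measure on the circle of radius $\varepsilon$ around $z$; that is, $\langle G^z_\varepsilon,f\rangle_\nabla=\int f\,d\nu_{z,\varepsilon}$ for every smooth $f$ with compact support in $D$, extended by $0$ outside $D$. Let $h_\varepsilon(z)=\langle h,G^z_\varepsilon\rangle_\nabla$ be the circle average of $h$, and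 for $\gamma\ge0$ let $\mu_\varepsilon$ be the measure $$\mu_\varepsilon(dz)=\varepsilon^{\gamma^2/2}\,e^{\gamma h_\varepsilon(z)}\,dz\quad\text{on }D,\qquad \mu_\varepsilon(\phi)=\int_D\phi\,d\mu_\varepsilon .$$ Suppose that $\gamma\in[0,\sqrt2)$. Then: 1. For each $\varepsilon>0$ the measure $\mu_\varepsilon$ is almost surely finite, and for every continuous $\phi:\bar D\to\mathbb{R}$ the random variables $\mu_\varepsilon(\phi)$, $\varepsilon>0$, lie in $L^2$ and are Cauchy in $L^2$ as $\varepsilon\to0$: for every $\delta>0$ there is $\varepsilon_0>0$ such that $\|\mu_\varepsilon(\phi)-\mu_\eta(\phi)\|_{L^2}\le\delta$ for all $\varepsilon,\eta\in(0,\varepsilon_0)$. 2. There are a deterministic sequence $\varepsilon_k\searrow0$ and a random finite measure $\mu_\gamma$ on $\bar D$ (the Liouville measure), measurable with respect to the $\sigma$-algebra generated by the random distribution $h$ (that is, by the variables $\langle h,\rho\rangle=\sum_n a_n\int e_n\rho$, where $\rho$ ranges over the smooth functions with compact support in $D$), such that almost surely $\mu_{\varepsilon_k}\to\mu_\gamma$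 weakly as measures on $\bar D$, that is, $\mu_{\varepsilon_k}(\phi)\to\int\phi\,d\mu_\gamma$ for all continuous $\phi:\bar D\to\mathbb{R}$ simultaneously. The measure $\mu_\gamma$ is nondegenerate: almost surely $\mu_\gamma(D)>0$. -/

import Mathlib

open MeasureTheory ProbabilityTheory Filter Topology
open scoped ENNReal

noncomputable section

namespace Liouville

/-- The real vector space of smooth functions `f : ℂ → ℝ` with compact support contained in `D`. -/
def testFunctions (D : Set ℂ) : Submodule ℝ (ℂ → ℝ) where
  carrier := {f | ContDiff ℝ (⊤ : ℕ∞) f ∧ HasCompactSupport f ∧ tsupport f ⊆ D}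
  add_mem' := by
    rintro f g ⟨hf, hf', hf''⟩ ⟨hg, hg', hg''⟩
    exact ⟨hf.add hg, hf'.add hg', (tsupport_add f g).trans (Set.union_subset hf'' hg'')⟩
  zero_mem' := by
    refine ⟨contDiff_const, HasCompactSupport.zero, ?_⟩
    simp [tsupport]
  smul_mem' := by
    rintro c f ⟨hf, hf', hf''⟩
    refine ⟨hf.const_smul c, hf'.smul_left (f := fun _ => c), ?_⟩
    exact (closure_mono (Function.support_const_smul_subset c f)).trans hf''

/-- The same vector space as a type of its own, so that it can carry the Dirichlet inner product
(and not the topology of pointwise convergence). -/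
def TestSpace (D : Set ℂ) : Type := testFunctions D

instance (D : Set ℂ) : AddCommGroup (TestSpace D) :=
  inferInstanceAs (AddCommGroup (testFunctions D))

instance (D : Set ℂ) : Module ℝ (TestSpace D) :=
  inferInstanceAs (Module ℝ (testFunctions D))

/-- The function on the plane underlying a test function. -/
def TestSpace.fn {D : Set ℂ} (f : TestSpace D) : ℂ → ℝ := f.1

/-- The Dirichlet pairing `(2π)⁻¹ ∫ ∇f · ∇g`. -/
def dirichletForm (f g : ℂ → ℝ) : ℝ :=
  (2 * Real.pi)⁻¹ * ∫ z, inner ℝ (gradient f z) (gradient g z)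

lemma integrable_inner_gradient {D : Set ℂ} (f g : TestSpace D) :
    Integrable (fun z => inner ℝ (gradient f.fn z) (gradient g.fn z)) := by
  have hc : ∀ u : TestSpace D, Continuous (gradient u.fn) := fun u =>
    (LinearIsometryEquiv.continuous _).comp (u.2.1.continuous_fderiv (by simp))
  have hs : HasCompactSupport (gradient f.fn) :=
    (f.2.2.1.fderiv (𝕜 := ℝ)).comp_left (map_zero _)
  refine ((hc f).inner (hc g)).integrable_of_hasCompactSupport ?_
  refine hs.mono fun z hz hz' => hz ?_
  simp only [hz', inner_zero_left]

lemma gradient_add {D : Set ℂ} (f g : TestSpace D) (z : ℂ) :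
    gradient (f + g).fn z = gradient f.fn z + gradient g.fn z := by
  have hd : ∀ u : TestSpace D, DifferentiableAt ℝ u.fn z := fun u =>
    (u.2.1.differentiable (by simp)) z
  have h : fderiv ℝ (f + g).fn z = fderiv ℝ f.fn z + fderiv ℝ g.fn z :=
    fderiv_add (hd f) (hd g)
  simp only [gradient, h, map_add]

lemma gradient_smul {D : Set ℂ} (c : ℝ) (f : TestSpace D) (z : ℂ) :
    gradient (c • f).fn z = c • gradient f.fn z := by
  have h : fderiv ℝ (c • f).fn z = c • fderiv ℝ f.fn z :=
    fderiv_const_smul ((f.2.1.differentiable (by simp)) z) c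
  simp only [gradient, h, map_smulₛₗ]
  rfl

/-- The Dirichlet inner product `⟨f, g⟩_∇ = (2π)⁻¹ ∫ ∇f · ∇g` on test functions. -/
@[reducible]
def dirichletCore (D : Set ℂ) : PreInnerProductSpace.Core ℝ (TestSpace D) where
  inner f g := dirichletForm f.fn g.fn
  conj_inner_symm f g := by
    simp only [dirichletForm, conj_trivial]
    congr 1
    exact integral_congr_ae (Eventually.of_forall fun z => real_inner_comm _ _)
  re_inner_nonneg f := by
    simp only [dirichletForm, RCLike.re_to_real]
    exact mul_nonneg (by positivity) (integral_nonneg fun z => real_inner_self_nonneg)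
  add_left f g k := by
    simp only [dirichletForm, gradient_add, inner_add_left]
    rw [integral_add (integrable_inner_gradient f k) (integrable_inner_gradient g k), mul_add]
  smul_left f g c := by
    simp only [dirichletForm, gradient_smul, real_inner_smul_left, integral_const_mul]
    simp only [conj_trivial]
    ring

instance (D : Set ℂ) : SeminormedAddCommGroup (TestSpace D) :=
  InnerProductSpace.Core.toSeminormedAddCommGroup (c := dirichletCore D)

instance (D : Set ℂ) : InnerProductSpace ℝ (TestSpace D) :=
  InnerProductSpace.ofCore (dirichletCore D)

/-- The Sobolev space `H¹₀(D)`: the Hilbert space completion of the smooth functions with compact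
support in `D` for the Dirichlet inner product. -/
abbrev H10 (D : Set ℂ) : Type := UniformSpace.Completion (TestSpace D)

/-- The inclusion of the test functions into `H¹₀(D)`. -/
def TestSpace.toH10 {D : Set ℂ} (f : TestSpace D) : H10 D := UniformSpace.Completion.coe' f

open Classical in
/-- The element `u` of `H¹₀(D)` with `⟨u, f⟩_∇ = L f` for all test functions `f`, that is, the
weak solution of `-(2π)⁻¹ Δu = L` in `D` with zero boundary values. It is unique, and it exists
when `L` is linear and bounded for the Dirichlet norm; the value is `0` when there is none. -/
def potential (D : Set ℂ) (L : TestSpace D → ℝ) : H10 D :=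
  if h : ∃ u : H10 D, ∀ f : TestSpace D, inner ℝ u f.toH10 = L f then h.choose else 0

/-- The regularised Green's function `G^z_ε ∈ H¹₀(D)`: the weak solution of
`-(2π)⁻¹ Δ G^z_ε = ν_{z,ε}` in `D`, where `ν_{z,ε}` is the uniform probability measure on the circle
of radius `ε` around `z` (test functions are extended by zero outside `D`). -/
def greenReg (D : Set ℂ) (z : ℂ) (ε : ℝ) : H10 D :=
  potential D (fun f => Real.circleAverage f.fn z ε)

/-- A Gaussian free field with Dirichlet boundary conditions in `D`, that is, the random series
`h = ∑ aₙ eₙ` with `(eₙ)` an orthonormal basis of `H¹₀(D)` and `(aₙ)` independent standard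
normal variables. -/
structure GFF (D : Set ℂ) {Ω : Type*} [MeasurableSpace Ω] (P : Measure Ω) where
  /-- the orthonormal basis `(eₙ)` -/
  basis : HilbertBasis ℕ ℝ (H10 D)
  /-- the coefficients `(aₙ)` -/
  coeff : ℕ → Ω → ℝ
  measurable_coeff : ∀ n, Measurable (coeff n)
  indep_coeff : iIndepFun coeff P
  map_coeff : ∀ n, P.map (coeff n) = gaussianReal 0 1

namespace GFF

variable {D : Set ℂ} {Ω : Type*} [MeasurableSpace Ω] {P : Measure Ω}

/-- `⟨h, f⟩_∇ = ∑ aₙ αₙ` for `f = ∑ αₙ eₙ` in `H¹₀(D)`: the limit of the partial sums, which exists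
almost surely for every fixed `f`. -/
def pairing (h : GFF D P) (f : H10 D) (ω : Ω) : ℝ :=
  limUnder atTop fun N : ℕ => ∑ n ∈ Finset.range N, h.coeff n ω * h.basis.repr f n

/-- The random distribution `h` tested against `ρ`:
`⟨h, ρ⟩ = ∑ aₙ ∫ eₙ ρ`, that is, `⟨h, ρ⟩ = ⟨h, -2πΔ⁻¹ρ⟩_∇`. -/
def test (h : GFF D P) (ρ : TestSpace D) (ω : Ω) : ℝ :=
  h.pairing (potential D fun f => ∫ z, f.fn z * ρ.fn z) ω

/-- The σ-algebra generated by the random distribution `h`. -/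
@[reducible]
def sigma (h : GFF D P) : MeasurableSpace Ω :=
  ⨆ ρ : TestSpace D, MeasurableSpace.comap (h.test ρ) inferInstance

/-- The circle average `h_ε(z) = ⟨h, G^z_ε⟩_∇`. -/
def circleAvg (h : GFF D P) (ε : ℝ) (z : ℂ) (ω : Ω) : ℝ :=
  h.pairing (greenReg D z ε) ω

/-- The random measure `μ_ε(dz) = ε^{γ²/2} e^{γ h_ε(z)} dz` on `D`. -/
def approxMeasure (h : GFF D P) (γ ε : ℝ) (ω : Ω) : Measure ℂ :=
  (volume.restrict D).withDensity fun z =>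
    ENNReal.ofReal (ε ^ (γ ^ 2 / 2) * Real.exp (γ * h.circleAvg ε z ω))

end GFF

end Liouville

end

/-! The Green's function is handled through explicit vector fields. Multiplying gradients by
(2π)^{-1/2} makes H¹₀(D) a closed subspace of the square integrable fields on the plane. In polar
coordinates, the field of the logarithmic potential on an annulus ε < |x - z| ≤ R pairs with the
gradient of a test function to give its circle average, as soon as the function vanishes on the
outer circle. So G^z_ε is the orthogonal projection of this field onto gradients (`greenReg_eq`),
and no boundary regularity is needed. Projection gives Var h_ε(z) ≤ log(R/ε). An annulus inside a
disc contained in D carries a field that already is a gradient, so there Var h_ε(z) + log ε does not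
depend on ε, and neither do covariances for disjoint circles (`norm_sq_greenReg_eq`,
`inner_greenReg_eq`).

Second moments of the masses are double integrals of an explicit exponential kernel. For two points
well inside D at distance at least 2η, the kernels for the radius pairs (ε, ε), (ε, η), (η, η) with
ε ≤ η coincide; hence E(μ_ε(φ) - μ_η(φ))² only sees pairs closer than 2η. These contribute at most a
constant times the integral of |v|^{-γ²} over |v| < 2η, which is finite and tends to 0 because γ² <
2.

Near the boundary the circles leave D. There the annulus kernel A is compared with the Green kernel
G: A - G is the Gram kernel of the components orthogonal to gradients. Since e^t ≥ 1 + t, positive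
definiteness gives, for every path, μ_ε(S)² ≤ ∬ exp(γ²(A - G)) dμ_ε dμ_ε over S × S. Taking
expectations cancels G and leaves an integral of |x - y|^{-γ²}, so E μ_ε(S)² is at most a constant
times the area of S ∩ D, uniformly in ε. Boundary layers are therefore negligible, and μ_ε(φ) is
Cauchy in L² (`exists_eLpNorm_mass_sub_le`).

Along a fast sequence of radii the integrals of a countable dense family converge almost surely, and
Riesz's theorem supplies the limit measure. It is a function of the coefficients, which are almost
surely limits of variables ⟨h, ρ⟩.

For nondegeneracy, shifting h by a test function changes the densities by factors bounded uniformly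
in ε, so the event that the masses of a bump tend to 0 is shift invariant and has probability 0 or 1
(`measure_eq_zero_or_one_of_shift_invariant`). Probability 1 is excluded because the expected masses
stay bounded below while the masses are Cauchy in L². -/

noncomputable section

namespace Liouville

/-! ### Explicit radial fields on annuli and their inner products -/

/-- The radial field `-(2π)^{-1/2} (x - z) / |x - z|²` on the annulus `r < |x - z| ≤ s`. -/
def radialField (z : ℂ) (r s : ℝ) (x : ℂ) : ℂ :=
  if r < ‖x - z‖ ∧ ‖x - z‖ ≤ s then -((√(2 * Real.pi))⁻¹ * (‖x - z‖ ^ 2)⁻¹) • (x - z) else 0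

lemma measurable_radialField (z : ℂ) (r s : ℝ) : Measurable (radialField z r s) := by
  unfold radialField
  refine Measurable.ite ?_ (by fun_prop) measurable_const
  have h : Measurable fun x : ℂ => ‖x - z‖ := by fun_prop
  exact (measurableSet_lt measurable_const h).inter (measurableSet_le h measurable_const)

lemma sqrt_two_pi_pos : 0 < √(2 * Real.pi) := Real.sqrt_pos.2 (by positivity)

lemma norm_radialField {z : ℂ} {r s : ℝ} (hr : 0 ≤ r) (x : ℂ) :
    ‖radialField z r s x‖ = (Set.Ioc r s).indicator (fun t => (√(2 * Real.pi))⁻¹ * t⁻¹) ‖x - z‖ := by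
  have := sqrt_two_pi_pos
  by_cases h : r < ‖x - z‖ ∧ ‖x - z‖ ≤ s
  · have hx : 0 < ‖x - z‖ := hr.trans_lt h.1
    rw [radialField, if_pos h, Set.indicator_of_mem (by exact h), norm_smul, norm_neg,
      Real.norm_of_nonneg (by positivity)]
    field_simp
  · rw [radialField, if_neg h, Set.indicator_of_notMem (by exact h), norm_zero]

lemma integral_norm_sub_eq (g : ℝ → ℝ) (z : ℂ) :
    ∫ x : ℂ, g ‖x - z‖ = 2 * Real.pi * ∫ t in Set.Ioi (0 : ℝ), t * g t := by
  rw [integral_sub_right_eq_self (fun x : ℂ => g ‖x‖) z, integral_fun_norm_addHaar]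
  simp [Measure.real, Complex.volume_ball, mul_assoc]

lemma integrable_norm_sub_iff (g : ℝ → ℝ) (z : ℂ) :
    Integrable (fun x : ℂ => g ‖x - z‖) ↔ IntegrableOn (fun t => t * g t) (Set.Ioi (0 : ℝ)) := by
  have h := integrable_fun_norm_addHaar (volume : Measure ℂ) (f := g)
  simp only [Complex.finrank_real_complex] at h
  have h' : IntegrableOn (fun t => t * g t) (Set.Ioi (0 : ℝ)) ↔
      Integrable fun x : ℂ => g ‖x‖ := by simpa using h.symm
  rw [h']
  exact ⟨fun h => by simpa using h.comp_add_right z, fun h => h.comp_sub_right z⟩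

lemma Ioi_inter_Ioc_eq {r s : ℝ} (hr : 0 ≤ r) : Set.Ioi (0 : ℝ) ∩ Set.Ioc r s = Set.Ioc r s :=
  Set.inter_eq_self_of_subset_right fun _ ht => hr.trans_lt ht.1

lemma integrable_norm_radialField {r s : ℝ} (hr : 0 ≤ r) (z : ℂ) :
    Integrable (fun x => ‖radialField z r s x‖) := by
  simp_rw [norm_radialField hr]
  rw [integrable_norm_sub_iff]
  have : (fun t : ℝ => t * (Set.Ioc r s).indicator (fun t => (√(2 * Real.pi))⁻¹ * t⁻¹) t) =
      (Set.Ioc r s).indicator fun _ => (√(2 * Real.pi))⁻¹ := by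
    ext t
    by_cases ht : t ∈ Set.Ioc r s
    · have : t ≠ 0 := (hr.trans_lt ht.1).ne'
      simp only [ht, Set.indicator_of_mem]; field_simp
    · simp [ht]
  rw [this, integrableOn_indicator_iff measurableSet_Ioc, Set.inter_comm, Ioi_inter_Ioc_eq hr]
  exact integrableOn_const (by simp)

/-- The polar Jacobian cancels the factor 1/t, so the L¹ norm is of the order of the outer radius,
with no logarithm. Paired with the sup bound on another field, this controls the mixed terms in
`inner_annulusField_le_log`. -/
lemma integral_norm_radialField_le {r s : ℝ} (hr : 0 ≤ r) (hs : 0 ≤ s) (z : ℂ) :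
    ∫ x, ‖radialField z r s x‖ ≤ √(2 * Real.pi) * s := by
  have h0 := sqrt_two_pi_pos
  simp_rw [norm_radialField hr]
  rw [integral_norm_sub_eq]
  have : (fun t : ℝ => t * (Set.Ioc r s).indicator (fun t => (√(2 * Real.pi))⁻¹ * t⁻¹) t) =
      (Set.Ioc r s).indicator fun _ => (√(2 * Real.pi))⁻¹ := by
    ext t
    by_cases ht : t ∈ Set.Ioc r s
    · have : t ≠ 0 := (hr.trans_lt ht.1).ne'
      simp only [ht, Set.indicator_of_mem]; field_simp
    · simp [ht]
  rw [this, setIntegral_indicator measurableSet_Ioc, Ioi_inter_Ioc_eq hr, setIntegral_const,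
    Real.volume_real_Ioc, smul_eq_mul]
  have h2 : 2 * Real.pi = √(2 * Real.pi) * √(2 * Real.pi) := (Real.mul_self_sqrt (by positivity)).symm
  have h3 : max (s - r) 0 ≤ s := max_le (by linarith) hs
  calc 2 * Real.pi * (max (s - r) 0 * (√(2 * Real.pi))⁻¹)
      = √(2 * Real.pi) * max (s - r) 0 := by
        nth_rw 1 [h2]; field_simp
    _ ≤ _ := by gcongr

lemma sq_norm_radialField {r s : ℝ} (hr : 0 < r) (z : ℂ) :
    Integrable (fun x => ‖radialField z r s x‖ ^ 2) ∧
    (r ≤ s → ∫ x, ‖radialField z r s x‖ ^ 2 = Real.log (s / r)) := by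
  have h0 := sqrt_two_pi_pos
  have h2 : 2 * Real.pi = √(2 * Real.pi) * √(2 * Real.pi) := (Real.mul_self_sqrt (by positivity)).symm
  simp_rw [norm_radialField hr.le]
  rw [integral_norm_sub_eq (fun t => (Set.Ioc r s).indicator (fun t => (√(2 * Real.pi))⁻¹ * t⁻¹) t ^ 2),
    integrable_norm_sub_iff (fun t => (Set.Ioc r s).indicator (fun t => (√(2 * Real.pi))⁻¹ * t⁻¹) t ^ 2)]
  have : (fun t : ℝ => t * (Set.Ioc r s).indicator (fun t => (√(2 * Real.pi))⁻¹ * t⁻¹) t ^ 2) =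
      (Set.Ioc r s).indicator fun t => (2 * Real.pi)⁻¹ * t⁻¹ := by
    ext t
    by_cases ht : t ∈ Set.Ioc r s
    · have : t ≠ 0 := (hr.trans ht.1).ne'
      simp only [ht, Set.indicator_of_mem]
      rw [mul_pow, inv_pow, Real.sq_sqrt (by positivity)]; field_simp
    · simp [ht]
  rw [this, integrableOn_indicator_iff measurableSet_Ioc, Set.inter_comm, Ioi_inter_Ioc_eq hr.le,
    setIntegral_indicator measurableSet_Ioc, Ioi_inter_Ioc_eq hr.le]
  constructor
  · refine ContinuousOn.integrableOn_Icc (a := r) (b := s) ?_ |>.mono_set Set.Ioc_subset_Icc_self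
    exact continuousOn_const.mul (continuousOn_inv₀.mono fun t ht => (hr.trans_le ht.1).ne')
  · intro hrs
    rw [← intervalIntegral.integral_of_le hrs, intervalIntegral.integral_const_mul,
      integral_inv_of_pos hr (hr.trans_le hrs)]
    field_simp

lemma memLp_radialField {r : ℝ} (hr : 0 < r) (s : ℝ) (z : ℂ) :
    MemLp (radialField z r s) 2 volume :=
  (memLp_two_iff_integrable_sq_norm (measurable_radialField z r s).aestronglyMeasurable).2
    (sq_norm_radialField hr z).1

abbrev FieldSpace : Type := Lp ℂ 2 (volume : Measure ℂ)

/-- The radial field on an annulus as a square integrable vector field. -/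
def annulusField (z : ℂ) (r s : ℝ) : FieldSpace :=
  if h : 0 < r then (memLp_radialField h s z).toLp else 0

lemma coeFn_annulusField {r : ℝ} (hr : 0 < r) (s : ℝ) (z : ℂ) :
    annulusField z r s =ᵐ[volume] radialField z r s := by
  rw [annulusField, dif_pos hr]; exact MemLp.coeFn_toLp _

lemma inner_annulusField_left {r : ℝ} (hr : 0 < r) (s : ℝ) (z : ℂ) (u : FieldSpace) :
    inner ℝ (annulusField z r s) u = ∫ x, inner ℝ (radialField z r s x) (u x) := by
  rw [L2.inner_def]
  exact integral_congr_ae ((coeFn_annulusField hr s z).mono fun x hx => by simp only [hx])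

lemma inner_annulusField {r r' : ℝ} (hr : 0 < r) (hr' : 0 < r') (s s' : ℝ) (z w : ℂ) :
    inner ℝ (annulusField z r s) (annulusField w r' s') =
      ∫ x, inner ℝ (radialField z r s x) (radialField w r' s' x) := by
  rw [inner_annulusField_left hr]
  exact integral_congr_ae ((coeFn_annulusField hr' s' w).mono fun x hx => by simp only [hx])

lemma norm_sq_annulusField {r s : ℝ} (hr : 0 < r) (hrs : r ≤ s) (z : ℂ) :
    ‖annulusField z r s‖ ^ 2 = Real.log (s / r) := by
  rw [← real_inner_self_eq_norm_sq, inner_annulusField hr hr, ← (sq_norm_radialField hr z).2 hrs]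
  simp_rw [real_inner_self_eq_norm_sq]

lemma annulusField_add {r s t : ℝ} (hr : 0 < r) (hrs : r ≤ s) (hst : s ≤ t) (z : ℂ) :
    annulusField z r s + annulusField z s t = annulusField z r t := by
  apply Lp.ext
  filter_upwards [Lp.coeFn_add (annulusField z r s) (annulusField z s t),
    coeFn_annulusField hr s z, coeFn_annulusField (hr.trans_le hrs) t z,
    coeFn_annulusField hr t z] with x h1 h2 h3 h4
  rw [h1, h4, Pi.add_apply, h2, h3]
  simp only [radialField]
  by_cases ha : ‖x - z‖ ≤ s
  · have h5 : ¬ s < ‖x - z‖ := not_lt.2 ha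
    have h6 := ha.trans hst
    simp [ha, h5, h6]
  · have h5 : s < ‖x - z‖ := not_le.1 ha
    have h6 : r < ‖x - z‖ := hrs.trans_lt h5
    simp [ha, h5, h6]

lemma inner_annulusField_eq_zero {r s r' s' : ℝ} (hr : 0 < r) (hr' : 0 < r') {z w : ℂ}
    (h : ∀ x, ‖x - z‖ ≤ s → ‖x - w‖ ≤ s' → r < ‖x - z‖ → r' < ‖x - w‖ → False) :
    inner ℝ (annulusField z r s) (annulusField w r' s') = 0 := by
  rw [inner_annulusField hr hr']
  refine integral_eq_zero_of_ae (Eventually.of_forall fun x => ?_)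
  by_cases h1 : r < ‖x - z‖ ∧ ‖x - z‖ ≤ s
  · by_cases h2 : r' < ‖x - w‖ ∧ ‖x - w‖ ≤ s'
    · exact (h x h1.2 h2.2 h1.1 h2.1).elim
    · simp [radialField, h2]
  · simp [radialField, h1]

/-- The outer radius of the first annulus is the inner radius `s` of the second: the second field is
at most (√(2π) s)⁻¹ in norm, and the first has L¹ norm at most √(2π) s. -/
lemma abs_inner_annulusField_le_one {r s t : ℝ} (hr : 0 < r) (hs : 0 < s) (z w : ℂ) :
    |inner ℝ (annulusField z r s) (annulusField w s t)| ≤ 1 := by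
  have h0 := sqrt_two_pi_pos
  rw [inner_annulusField hr hs]
  calc |∫ x, inner ℝ (radialField z r s x) (radialField w s t x)|
      ≤ ∫ x, (√(2 * Real.pi) * s)⁻¹ * ‖radialField z r s x‖ := by
        refine norm_integral_le_of_norm_le ((integrable_norm_radialField hr.le z).const_mul _)
          (Eventually.of_forall fun x => (norm_inner_le_norm (𝕜 := ℝ) _ _).trans ?_)
        rw [mul_comm]
        gcongr
        rw [norm_radialField hs.le]
        by_cases ht : ‖x - w‖ ∈ Set.Ioc s t
        · rw [Set.indicator_of_mem ht, ← mul_inv]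
          have := ht.1
          gcongr
        · rw [Set.indicator_of_notMem ht]; positivity
    _ ≤ (√(2 * Real.pi) * s)⁻¹ * (√(2 * Real.pi) * s) := by
        rw [integral_const_mul]
        gcongr
        exact integral_norm_radialField_le hr.le hs.le z
    _ = 1 := inv_mul_cancel₀ (by positivity)

/-- Both annuli are cut at radius |z - w| / 3. The two inner pieces have disjoint supports, the two
mixed terms cost at most 1 each, and Cauchy–Schwarz bounds the outer pieces by the logarithm. If ε
exceeds the cutting radius, Cauchy–Schwarz alone suffices. -/
lemma inner_annulusField_le_log {ε R : ℝ} (hε : 0 < ε) (hεR : ε ≤ R) {z w : ℂ} (hzw : z ≠ w)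
    (hR : ‖z - w‖ ≤ 3 * R) :
    inner ℝ (annulusField z ε R) (annulusField w ε R) ≤ Real.log (3 * R / ‖z - w‖) + 2 := by
  have hd : 0 < ‖z - w‖ := norm_pos_iff.2 (sub_ne_zero.2 hzw)
  have key : ∀ r, 0 < r → r ≤ R →
      inner ℝ (annulusField z r R) (annulusField w r R) ≤ Real.log (R / r) := by
    intro r hr hrR
    have h1 := norm_sq_annulusField hr hrR z
    have h2 := norm_sq_annulusField hr hrR w
    have h3 := real_inner_le_norm (annulusField z r R) (annulusField w r R)
    nlinarith [sq_nonneg (‖annulusField z r R‖ - ‖annulusField w r R‖)]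
  rcases le_total (‖z - w‖ / 3) ε with h | h
  · refine (key ε hε hεR).trans ?_
    have : Real.log (R / ε) ≤ Real.log (3 * R / ‖z - w‖) := by
      apply Real.log_le_log (by have := hε.trans_le hεR; positivity)
      rw [div_le_div_iff₀ hε hd]
      nlinarith
    linarith
  · have hr : 0 < ‖z - w‖ / 3 := by positivity
    have hrR : ‖z - w‖ / 3 ≤ R := by linarith
    rw [← annulusField_add hε h hrR z, ← annulusField_add hε h hrR w, inner_add_left,
      inner_add_right, inner_add_right]
    have h1 : inner ℝ (annulusField z ε (‖z - w‖ / 3)) (annulusField w ε (‖z - w‖ / 3)) = 0 := by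
      refine inner_annulusField_eq_zero hε hε fun x h1 h2 _ _ => ?_
      have h3 : ‖z - w‖ ≤ ‖x - w‖ + ‖x - z‖ := by
        simpa using norm_sub_le (x - w) (x - z)
      linarith
    have h2 := abs_inner_annulusField_le_one (t := R) hε hr z w
    have h3 := abs_inner_annulusField_le_one (t := R) hε hr w z
    rw [real_inner_comm] at h3
    have h4 := key _ hr hrR
    have h5 : R / (‖z - w‖ / 3) = 3 * R / ‖z - w‖ := by field_simp
    rw [h5] at h4
    have := (abs_le.1 h2).2
    have := (abs_le.1 h3).2
    linarith

end Liouville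
end

/-! ### Circle averages by integration in polar coordinates, and smooth approximations of annulus
potentials -/

noncomputable section

namespace Liouville

lemma inner_gradient_right {f : ℂ → ℝ} (x v : ℂ) : inner ℝ v (gradient f x) = fderiv ℝ f x v := by
  rw [real_inner_comm, gradient, InnerProductSpace.toDual_symm_apply]

lemma hasDerivAt_comp_ray {f : ℂ → ℝ} (hf : Differentiable ℝ f) (z u : ℂ) (r : ℝ) :
    HasDerivAt (fun t : ℝ => f (z + t * u)) (fderiv ℝ f (z + r * u) u) r := by
  have h1 : HasDerivAt (fun t : ℝ => z + t * u) u r := by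
    simpa using ((Complex.ofRealCLM.hasDerivAt (x := r)).mul_const u).const_add z
  exact (hf (z + r * u)).hasFDerivAt.comp_hasDerivAt r h1

lemma inner_radialField_gradient_polar {f : ℂ → ℝ} {z : ℂ} {ε R r θ : ℝ}
    (hr : 0 < r) :
    r * inner ℝ (radialField z ε R (z + r * Complex.exp (θ * Complex.I)))
      ((√(2 * Real.pi))⁻¹ • gradient f (z + r * Complex.exp (θ * Complex.I))) =
    (Set.Ioc ε R).indicator (fun r => -(2 * Real.pi)⁻¹ *
      fderiv ℝ f (z + r * Complex.exp (θ * Complex.I)) (Complex.exp (θ * Complex.I))) r := by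
  set u := Complex.exp (θ * Complex.I) with hu
  have hn : ‖z + r * u - z‖ = r := by
    rw [add_sub_cancel_left, norm_mul, hu, Complex.norm_exp_ofReal_mul_I, mul_one,
      Complex.norm_real, Real.norm_of_nonneg hr.le]
  rw [real_inner_smul_right, inner_gradient_right, radialField, hn]
  by_cases h : ε < r ∧ r ≤ R
  · rw [if_pos h, Set.indicator_of_mem (by exact h), map_smul, add_sub_cancel_left]
    have : (r : ℂ) * u = r • u := by simp
    have h2 : 2 * Real.pi = √(2 * Real.pi) ^ 2 := (Real.sq_sqrt (by positivity)).symm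
    have h0 := sqrt_two_pi_pos
    conv_rhs => rw [h2]
    rw [this, map_smul, smul_eq_mul, smul_eq_mul]
    field_simp
  · rw [if_neg h, Set.indicator_of_notMem (by exact h)]; simp

/-- The Jacobian r cancels the 1/r of the field, so the integrand is -(2π)⁻¹ times the radial
derivative of `f`. Integrating along each ray leaves the value on the inner circle, because `f`
vanishes on the outer one. -/
lemma integral_inner_radialField_gradient {f : ℂ → ℝ} (hf : ContDiff ℝ 1 f) {z : ℂ} {ε R : ℝ}
    (hε : 0 < ε) (hεR : ε ≤ R) (hR : ∀ x, ‖x - z‖ = R → f x = 0) :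
    ∫ x, inner ℝ (radialField z ε R x) ((√(2 * Real.pi))⁻¹ • gradient f x) =
      Real.circleAverage f z ε := by
  rw [← integral_add_left_eq_self _ z, ← Complex.integral_comp_polarCoord_symm]
  have hcont : Continuous fun p : ℝ × ℝ => -(2 * Real.pi)⁻¹ *
      fderiv ℝ f (z + p.1 * Complex.exp (p.2 * Complex.I)) (Complex.exp (p.2 * Complex.I)) := by
    have := hf.continuous_fderiv (by simp)
    fun_prop
  have h1 : ∀ p ∈ polarCoord.target,
      p.1 • inner ℝ (radialField z ε R (z + Complex.polarCoord.symm p))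
        ((√(2 * Real.pi))⁻¹ • gradient f (z + Complex.polarCoord.symm p)) =
      (Set.Ioc ε R ×ˢ Set.univ).indicator (fun p : ℝ × ℝ => -(2 * Real.pi)⁻¹ *
      fderiv ℝ f (z + p.1 * Complex.exp (p.2 * Complex.I)) (Complex.exp (p.2 * Complex.I))) p := by
    rintro ⟨r, θ⟩ hp
    have hr : 0 < r := (polarCoord_target ▸ hp).1
    have := inner_radialField_gradient_polar (f := f) (z := z) (ε := ε) (R := R) (θ := θ) hr
    rw [Complex.polarCoord_symm_apply]
    simp only [Complex.ofReal_cos, Complex.ofReal_sin]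
    rw [← Complex.exp_mul_I, smul_eq_mul, this]
    by_cases h : r ∈ Set.Ioc ε R <;> simp [Set.indicator, h]
  rw [setIntegral_congr_fun polarCoord.open_target.measurableSet h1,
    setIntegral_indicator (measurableSet_Ioc.prod MeasurableSet.univ), polarCoord_target,
    Set.prod_inter_prod, Set.inter_univ, Ioi_inter_Ioc_eq hε.le, Measure.volume_eq_prod,
    ← setIntegral_prod_swap, setIntegral_prod]
  -- The polar chart uses angles in (-π, π), so the average over [0, 2π] is moved by half a turn.
  · rw [Real.circleAverage_eq_integral_add (-Real.pi),
      intervalIntegral.integral_comp_add_right (fun θ => f (circleMap z ε θ)), zero_add,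
      show 2 * Real.pi + -Real.pi = Real.pi by ring,
      intervalIntegral.integral_of_le (by linarith [Real.pi_pos]), integral_Ioc_eq_integral_Ioo,
      smul_eq_mul, ← integral_const_mul]
    refine setIntegral_congr_fun measurableSet_Ioo fun θ _ => ?_
    set u := Complex.exp (θ * Complex.I) with hu
    have h2 : ∫ r in ε..R, fderiv ℝ f (z + r * u) u = f (z + R * u) - f (z + ε * u) := by
      refine intervalIntegral.integral_eq_sub_of_hasDerivAt
        (fun r _ => hasDerivAt_comp_ray (hf.differentiable (by simp)) z u r) ?_
      have := hf.continuous_fderiv (by simp)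
      exact Continuous.intervalIntegrable (by fun_prop) _ _
    have h3 : f (z + R * u) = 0 := by
      apply hR
      rw [add_sub_cancel_left, norm_mul, hu, Complex.norm_exp_ofReal_mul_I, mul_one,
        Complex.norm_real, Real.norm_of_nonneg (hε.le.trans hεR)]
    simp only [Prod.swap_prod_mk]
    rw [integral_const_mul, ← intervalIntegral.integral_of_le hεR, h2, h3, circleMap]
    ring
  · refine (hcont.comp continuous_swap).continuousOn.integrableOn_compact
      (isCompact_Icc.prod isCompact_Icc) |>.mono_set
      (Set.prod_mono Set.Ioo_subset_Icc_self Set.Ioc_subset_Icc_self)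

/-- A smooth cutoff function supported in the interval `(a, b)`. -/
def cutoff (a b : ℝ) (k : ℕ) (t : ℝ) : ℝ :=
  Real.smoothTransition (k * (t - a) - 1) * Real.smoothTransition (k * (b - t) - 1)

lemma contDiff_cutoff (a b : ℝ) (k : ℕ) : ContDiff ℝ (⊤ : ℕ∞) (cutoff a b k) := by
  refine ContDiff.mul ?_ ?_ <;> exact Real.smoothTransition.contDiff.comp (by fun_prop)

lemma cutoff_nonneg (a b : ℝ) (k : ℕ) (t : ℝ) : 0 ≤ cutoff a b k t :=
  mul_nonneg (Real.smoothTransition.nonneg _) (Real.smoothTransition.nonneg _)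

lemma cutoff_le_one (a b : ℝ) (k : ℕ) (t : ℝ) : cutoff a b k t ≤ 1 :=
  mul_le_one₀ (Real.smoothTransition.le_one _) (Real.smoothTransition.nonneg _)
    (Real.smoothTransition.le_one _)

lemma cutoff_eq_zero_of_le {a b t : ℝ} (k : ℕ) (h : k * (t - a) ≤ 1) : cutoff a b k t = 0 := by
  rw [cutoff, Real.smoothTransition.zero_of_nonpos (by linarith), zero_mul]

lemma cutoff_eq_zero_of_ge {a b t : ℝ} (k : ℕ) (h : b ≤ t) : cutoff a b k t = 0 := by
  have : (k : ℝ) * (b - t) ≤ 0 := mul_nonpos_of_nonneg_of_nonpos (by positivity) (by linarith)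
  rw [cutoff, Real.smoothTransition.zero_of_nonpos (x := k * (b - t) - 1) (by linarith), mul_zero]

lemma tendsto_cutoff {a b t : ℝ} (ha : a < t) (hb : t < b) :
    Tendsto (fun k => cutoff a b k t) atTop (𝓝 1) := by
  refine tendsto_const_nhds.congr' ?_
  have h1 : Tendsto (fun k : ℕ => (k : ℝ) * (t - a)) atTop atTop :=
    tendsto_natCast_atTop_atTop.atTop_mul_const (by linarith)
  have h2 : Tendsto (fun k : ℕ => (k : ℝ) * (b - t)) atTop atTop :=
    tendsto_natCast_atTop_atTop.atTop_mul_const (by linarith)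
  filter_upwards [h1.eventually_ge_atTop 2, h2.eventually_ge_atTop 2] with k h3 h4
  rw [cutoff, Real.smoothTransition.one_of_one_le (by linarith),
    Real.smoothTransition.one_of_one_le (by linarith), mul_one]

/-- The cutoff vanishes on a neighbourhood of 0 because `a` is positive, so the pole of the quotient
does no harm. -/
lemma contDiff_cutoff_div {a : ℝ} (ha : 0 < a) (b : ℝ) (k : ℕ) :
    ContDiff ℝ (⊤ : ℕ∞) fun t => cutoff a b k t / (2 * t) := by
  rw [contDiff_iff_contDiffAt]
  intro t
  rcases eq_or_ne t 0 with rfl | ht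
  · refine (contDiffAt_const (c := (0 : ℝ))).congr_of_eventuallyEq ?_
    filter_upwards [Iio_mem_nhds ha] with s hs
    rw [cutoff_eq_zero_of_le, zero_div]
    have : (k : ℝ) * (s - a) ≤ 0 :=
      mul_nonpos_of_nonneg_of_nonpos (by positivity) (by linarith [Set.mem_Iio.1 hs])
    linarith
  · exact (contDiff_cutoff a b k).contDiffAt.div (by fun_prop) (by simpa using ht)

/-- Smooth radial approximations of the potential of an annulus. -/
def radialBump (z : ℂ) (r s : ℝ) (k : ℕ) (x : ℂ) : ℝ :=
  ∫ t in (‖x - z‖ ^ 2)..(s ^ 2), cutoff (r ^ 2) (s ^ 2) k t / (2 * t)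

lemma hasDerivAt_integral_cutoff {r : ℝ} (hr : 0 < r) (s : ℝ) (k : ℕ) (u : ℝ) :
    HasDerivAt (fun u => ∫ t in u..(s ^ 2), cutoff (r ^ 2) (s ^ 2) k t / (2 * t))
      (-(cutoff (r ^ 2) (s ^ 2) k u / (2 * u))) u := by
  have hc := (contDiff_cutoff_div (pow_pos hr 2) (s ^ 2) k).continuous
  exact intervalIntegral.integral_hasDerivAt_left (hc.intervalIntegrable _ _)
    (hc.stronglyMeasurableAtFilter _ _) hc.continuousAt

/-- Working with the squared distance keeps the bump smooth at the centre; under t = ρ² the weight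
dt / (2t) is dρ / ρ, the derivative of the logarithm. -/
lemma contDiff_radialBump {r : ℝ} (hr : 0 < r) (z : ℂ) (s : ℝ) (k : ℕ) :
    ContDiff ℝ (⊤ : ℕ∞) (radialBump z r s k) := by
  have h : ContDiff ℝ (⊤ : ℕ∞)
      (fun u => ∫ t in u..(s ^ 2), cutoff (r ^ 2) (s ^ 2) k t / (2 * t)) := by
    rw [contDiff_infty_iff_deriv]
    refine ⟨fun u => (hasDerivAt_integral_cutoff hr s k u).differentiableAt, ?_⟩
    rw [show deriv _ = _ from funext fun u => (hasDerivAt_integral_cutoff hr s k u).deriv]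
    exact (contDiff_cutoff_div (pow_pos hr 2) (s ^ 2) k).neg
  exact h.comp ((contDiff_id.sub contDiff_const).norm_sq ℝ)

lemma radialBump_eq_zero {z : ℂ} {r s : ℝ} (hs : 0 ≤ s) (k : ℕ) {x : ℂ} (hx : s ≤ ‖x - z‖) :
    radialBump z r s k x = 0 := by
  have hsq : s ^ 2 ≤ ‖x - z‖ ^ 2 := by gcongr
  rw [radialBump, intervalIntegral.integral_zero_ae]
  refine Eventually.of_forall fun t ht => ?_
  rw [Set.uIoc_of_ge hsq] at ht
  rw [cutoff_eq_zero_of_ge k ht.1.le, zero_div]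

lemma gradient_radialBump {r s : ℝ} (hr : 0 < r) (hrs : r < s) (z : ℂ) (k : ℕ) (x : ℂ) :
    (√(2 * Real.pi))⁻¹ • gradient (radialBump z r s k) x =
      cutoff (r ^ 2) (s ^ 2) k (‖x - z‖ ^ 2) • radialField z r s x := by
  have h1 : HasGradientAt (radialBump z r s k)
      (-(cutoff (r ^ 2) (s ^ 2) k (‖x - z‖ ^ 2) / (2 * ‖x - z‖ ^ 2)) • (2 : ℝ) • (x - z)) x := by
    rw [hasGradientAt_iff_hasFDerivAt]
    have h2 : HasFDerivAt (fun x : ℂ => ‖x - z‖ ^ 2) (2 • (innerSL ℝ (x - z))) x := by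
      simpa using ((hasFDerivAt_id (𝕜 := ℝ) x).sub_const z).norm_sq
    refine ((hasDerivAt_integral_cutoff hr s k _).comp_hasFDerivAt x h2).congr_fderiv ?_
    ext v
    simp only [map_smul, InnerProductSpace.toDual_apply_apply, smul_apply,
      innerSL_apply_apply, nsmul_eq_mul, smul_eq_mul, Nat.cast_ofNat]
  rw [h1.gradient, radialField]
  by_cases h : r < ‖x - z‖ ∧ ‖x - z‖ ≤ s
  · have hx : 0 < ‖x - z‖ := hr.trans h.1
    rw [if_pos h, smul_smul, smul_smul, smul_smul]
    congr 1
    field_simp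
  · rw [if_neg h]
    have : cutoff (r ^ 2) (s ^ 2) k (‖x - z‖ ^ 2) = 0 := by
      by_cases h' : r < ‖x - z‖
      · apply cutoff_eq_zero_of_ge
        have : s ≤ ‖x - z‖ := by by_contra! hc; exact h ⟨h', hc.le⟩
        have := hr.trans hrs
        gcongr
      · apply cutoff_eq_zero_of_le
        have h3 : ‖x - z‖ ^ 2 ≤ r ^ 2 := by have := not_lt.1 h'; gcongr
        have : (k : ℝ) * (‖x - z‖ ^ 2 - r ^ 2) ≤ 0 :=
          mul_nonpos_of_nonneg_of_nonpos (by positivity) (by linarith)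
        linarith
    simp [this]

/-- The gradients are the radial field times cutoffs with values in [0, 1] that tend to 1, so
dominated convergence applies with the square integrable field as majorant. -/
lemma tendsto_gradient_radialBump {r s : ℝ} (hr : 0 < r) (hrs : r < s) (z : ℂ) :
    Tendsto (fun k => ∫ x, ‖(√(2 * Real.pi))⁻¹ • gradient (radialBump z r s k) x -
      radialField z r s x‖ ^ 2) atTop (𝓝 0) := by
  simp_rw [gradient_radialBump hr hrs]
  rw [← integral_zero ℂ ℝ (μ := volume)]
  have hm := measurable_radialField z r s
  have hc : ∀ k, Measurable fun x : ℂ => cutoff (r ^ 2) (s ^ 2) k (‖x - z‖ ^ 2) := fun k =>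
    (contDiff_cutoff _ _ k).continuous.measurable.comp (by fun_prop)
  refine tendsto_integral_of_dominated_convergence (fun x => ‖radialField z r s x‖ ^ 2)
    (fun k => ((((hc k).smul hm).sub hm).norm.pow_const 2).aestronglyMeasurable)
    (sq_norm_radialField hr z).1 (fun k => Eventually.of_forall fun x => ?_) ?_
  · rw [Real.norm_of_nonneg (by positivity)]
    gcongr
    rw [show ∀ c : ℝ, ∀ v : ℂ, c • v - v = (c - 1) • v from fun c v => by rw [sub_smul, one_smul],
      norm_smul, Real.norm_eq_abs]
    refine mul_le_of_le_one_left (norm_nonneg _) (abs_le.2 ?_)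
    have := cutoff_nonneg (r ^ 2) (s ^ 2) k (‖x - z‖ ^ 2)
    have := cutoff_le_one (r ^ 2) (s ^ 2) k (‖x - z‖ ^ 2)
    constructor <;> linarith
  -- On the outer circle all cutoffs vanish while the field does not; that circle is a null set.
  · have hne : ∀ᵐ x : ℂ, x ∉ Metric.sphere z s :=
      measure_eq_zero_iff_ae_notMem.1 (Measure.addHaar_sphere volume z s)
    filter_upwards [hne] with x hx
    rw [mem_sphere_iff_norm] at hx
    by_cases h : r < ‖x - z‖ ∧ ‖x - z‖ ≤ s
    · have h1 : Tendsto (fun k => cutoff (r ^ 2) (s ^ 2) k (‖x - z‖ ^ 2)) atTop (𝓝 1) :=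
        tendsto_cutoff (by have := h.1; gcongr)
          (by have := lt_of_le_of_ne h.2 hx; gcongr)
      have h2 := ((h1.smul_const (radialField z r s x)).sub_const (radialField z r s x)).norm.pow 2
      simpa using h2
    · simp [radialField, h]

end Liouville
end

/-! ### The space H¹₀(D) inside square integrable fields, and the regularised Green's function -/

noncomputable section

namespace Liouville

variable {D : Set ℂ}

lemma TestSpace.contDiff (f : TestSpace D) : ContDiff ℝ (⊤ : ℕ∞) f.fn := f.2.1

lemma TestSpace.fn_eq_zero (f : TestSpace D) {x : ℂ} (hx : x ∉ D) : f.fn x = 0 :=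
  image_eq_zero_of_notMem_tsupport fun h => hx (f.2.2.2 h)

lemma TestSpace.continuous_gradient (f : TestSpace D) : Continuous (gradient f.fn) :=
  (LinearIsometryEquiv.continuous _).comp (f.contDiff.continuous_fderiv (by simp))

lemma TestSpace.memLp_gradient (f : TestSpace D) :
    MemLp (fun x => (√(2 * Real.pi))⁻¹ • gradient f.fn x) 2 volume := by
  refine MemLp.const_smul (f := gradient f.fn) ?_ (√(2 * Real.pi))⁻¹
  rw [memLp_two_iff_integrable_sq_norm f.continuous_gradient.aestronglyMeasurable]
  simp_rw [← real_inner_self_eq_norm_sq]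
  exact integrable_inner_gradient f f

/-- The normalised gradient of a test function as a square integrable vector field. -/
def gradLinear (D : Set ℂ) : TestSpace D →ₗ[ℝ] FieldSpace where
  toFun f := f.memLp_gradient.toLp
  map_add' f g := by
    rw [← MemLp.toLp_add]
    exact MemLp.toLp_congr _ _ (Eventually.of_forall fun x => by
      simp [gradient_add])
  map_smul' c f := by
    rw [RingHom.id_apply, ← MemLp.toLp_const_smul]
    exact MemLp.toLp_congr _ _ (Eventually.of_forall fun x => by
      simp only [gradient_smul, Pi.smul_apply]; rw [smul_comm])

lemma coeFn_gradLinear (f : TestSpace D) :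
    gradLinear D f =ᵐ[volume] fun x => (√(2 * Real.pi))⁻¹ • gradient f.fn x :=
  f.memLp_gradient.coeFn_toLp

lemma TestSpace.inner_eq (f g : TestSpace D) : inner ℝ f g = dirichletForm f.fn g.fn := rfl

lemma inner_gradLinear (f g : TestSpace D) :
    inner ℝ (gradLinear D f) (gradLinear D g) = inner ℝ f g := by
  rw [L2.inner_def, TestSpace.inner_eq, dirichletForm, ← integral_const_mul]
  refine integral_congr_ae ?_
  filter_upwards [coeFn_gradLinear f, coeFn_gradLinear g] with x hf hg
  rw [hf, hg, real_inner_smul_left, real_inner_smul_right, ← mul_assoc, ← mul_inv,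
    Real.mul_self_sqrt (by positivity)]

def gradIsometry (D : Set ℂ) : TestSpace D →ₗᵢ[ℝ] FieldSpace where
  toLinearMap := gradLinear D
  norm_map' f := by
    rw [← sq_eq_sq₀ (norm_nonneg _) (norm_nonneg _), ← real_inner_self_eq_norm_sq,
      ← real_inner_self_eq_norm_sq, inner_gradLinear]

/-- The isometric embedding of `H¹₀(D)` into square integrable vector fields. -/
def gradL (D : Set ℂ) : H10 D →L[ℝ] FieldSpace :=
  (gradIsometry D).toContinuousLinearMap.extend (UniformSpace.Completion.toComplL (𝕜 := ℝ))

lemma gradL_toH10 (f : TestSpace D) : gradL D f.toH10 = gradLinear D f :=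
  ContinuousLinearMap.extend_eq _ (UniformSpace.Completion.denseRange_coe)
    (UniformSpace.Completion.isUniformInducing_coe _) f

lemma denseRange_toH10 : DenseRange (TestSpace.toH10 (D := D)) :=
  UniformSpace.Completion.denseRange_coe

lemma inner_toH10 (f g : TestSpace D) : inner ℝ f.toH10 g.toH10 = inner ℝ f g :=
  UniformSpace.Completion.inner_coe f g

lemma inner_gradL (u v : H10 D) : inner ℝ (gradL D u) (gradL D v) = inner ℝ u v := by
  refine denseRange_toH10.induction_on₂ (p := fun u v : H10 D =>
    inner ℝ (gradL D u) (gradL D v) = inner ℝ u v) ?_ (fun f g => ?_) u v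
  · exact isClosed_eq (by fun_prop) (by fun_prop)
  · rw [gradL_toH10, gradL_toH10, inner_gradLinear, inner_toH10]

lemma H10.ext_inner_test {u v : H10 D}
    (h : ∀ f : TestSpace D, inner ℝ u f.toH10 = inner ℝ v f.toH10) : u = v := by
  refine ext_inner_right ℝ fun w => ?_
  refine denseRange_toH10.induction_on (p := fun w : H10 D => inner ℝ u w = inner ℝ v w) w ?_ h
  exact isClosed_eq (by fun_prop) (by fun_prop)

/-- Test functions are dense, so a weak solution is unique and the chosen one must be `u`. -/
lemma potential_eq {L : TestSpace D → ℝ} {u : H10 D}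
    (h : ∀ f : TestSpace D, inner ℝ u f.toH10 = L f) : potential D L = u := by
  have hex : ∃ u : H10 D, ∀ f : TestSpace D, inner ℝ u f.toH10 = L f := ⟨u, h⟩
  rw [potential, dif_pos hex]
  exact H10.ext_inner_test fun f => by rw [hex.choose_spec f, h f]

/-- The orthogonal projection onto gradients, followed by the inverse of the gradient. -/
def gradAdj (D : Set ℂ) : FieldSpace →L[ℝ] H10 D := ContinuousLinearMap.adjoint (gradL D)

lemma inner_gradAdj_left (V : FieldSpace) (u : H10 D) :
    inner ℝ (gradAdj D V) u = inner ℝ V (gradL D u) :=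
  ContinuousLinearMap.adjoint_inner_left _ _ _

/-- The adjoint of an isometry is a left inverse; consequently `gradL` after `gradAdj` is the
orthogonal projection onto gradients. -/
lemma gradAdj_gradL (u : H10 D) : gradAdj D (gradL D u) = u :=
  ext_inner_right ℝ fun w => by rw [inner_gradAdj_left, inner_gradL]

lemma exists_radius (hD : Bornology.IsBounded D) (z : ℂ) (ε : ℝ) :
    ∃ R, ε ≤ R ∧ ∀ x ∈ D, ‖x - z‖ < R := by
  obtain ⟨C, hC⟩ := hD.exists_norm_le
  refine ⟨max ε (C + ‖z‖ + 1), le_max_left _ _, fun x hx => lt_max_of_lt_right ?_⟩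
  linarith [norm_sub_le x z, hC x hx]

/-- When D lies inside the disc of radius R around z, every test function vanishes on the outer
circle. The annulus field then represents the circle average against gradients of test functions,
and its projection is the weak solution. The result does not depend on R. -/
lemma greenReg_eq {z : ℂ} {ε R : ℝ} (hε : 0 < ε) (hεR : ε ≤ R)
    (hR : ∀ x ∈ D, ‖x - z‖ < R) : greenReg D z ε = gradAdj D (annulusField z ε R) := by
  refine potential_eq fun f => ?_
  rw [inner_gradAdj_left, gradL_toH10, inner_annulusField_left hε,
    ← integral_inner_radialField_gradient (f.contDiff.of_le (by exact_mod_cast le_top)) hε hεR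
      (z := z)]
  · exact integral_congr_ae ((coeFn_gradLinear f).mono fun x hx => by simp only [hx])
  · intro x hx
    exact f.fn_eq_zero fun h => (hR x h).ne hx

lemma inner_greenReg_toH10 (hD : Bornology.IsBounded D) (z : ℂ) {ε : ℝ} (hε : 0 < ε)
    (f : TestSpace D) : inner ℝ (greenReg D z ε) f.toH10 = Real.circleAverage f.fn z ε := by
  obtain ⟨R, hεR, hR⟩ := exists_radius hD z ε
  rw [greenReg_eq hε hεR hR, inner_gradAdj_left, gradL_toH10, inner_annulusField_left hε,
    ← integral_inner_radialField_gradient (f.contDiff.of_le (by exact_mod_cast le_top)) hε hεR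
      (z := z)]
  · exact integral_congr_ae ((coeFn_gradLinear f).mono fun x hx => by simp only [hx])
  · intro x hx
    exact f.fn_eq_zero fun h => (hR x h).ne hx

lemma norm_gradAdj_le (V : FieldSpace) : ‖gradAdj D V‖ ≤ ‖V‖ := by
  have h1 : ‖gradAdj D V‖ ^ 2 ≤ ‖V‖ * ‖gradAdj D V‖ := by
    rw [← real_inner_self_eq_norm_sq, inner_gradAdj_left]
    refine (real_inner_le_norm _ _).trans_eq ?_
    congr 1
    rw [← sq_eq_sq₀ (norm_nonneg _) (norm_nonneg _), ← real_inner_self_eq_norm_sq, inner_gradL,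
      real_inner_self_eq_norm_sq]
  by_contra! h
  nlinarith [norm_nonneg V, norm_nonneg (gradAdj D V)]

lemma norm_sq_greenReg_le {z : ℂ} {ε R : ℝ} (hε : 0 < ε) (hεR : ε ≤ R)
    (hR : ∀ x ∈ D, ‖x - z‖ < R) : ‖greenReg D z ε‖ ^ 2 ≤ Real.log (R / ε) := by
  rw [← norm_sq_annulusField hε hεR z, greenReg_eq hε hεR hR]
  gcongr
  exact norm_gradAdj_le _

/-- The test function given by a smooth function with compact support in `D`. -/
def TestSpace.mk (f : ℂ → ℝ) (h1 : ContDiff ℝ (⊤ : ℕ∞) f) (h2 : HasCompactSupport f)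
    (h3 : tsupport f ⊆ D) : TestSpace D := ⟨f, h1, h2, h3⟩

/-- The potential of an annulus in `D` is a limit of test functions supported in the disc. -/
lemma exists_tendsto_annulus {z : ℂ} {r s : ℝ} (hr : 0 < r) (hrs : r < s)
    (hD : Metric.closedBall z s ⊆ D) :
    ∃ ψ : ℕ → TestSpace D, (∀ k x, s ≤ ‖x - z‖ → (ψ k).fn x = 0) ∧
      Tendsto (fun k => gradL D (ψ k).toH10) atTop (𝓝 (annulusField z r s)) := by
  have hs : 0 < s := hr.trans hrs
  have hsupp : ∀ k, tsupport (radialBump z r s k) ⊆ Metric.closedBall z s := fun k =>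
    closure_minimal (fun x hx => by
      by_contra hc
      rw [mem_closedBall_iff_norm, not_le] at hc
      exact hx (radialBump_eq_zero hs.le k hc.le)) Metric.isClosed_closedBall
  have hcomp : ∀ k, HasCompactSupport (radialBump z r s k) := fun k =>
    (isCompact_closedBall z s).of_isClosed_subset (isClosed_tsupport _) (hsupp k)
  set ψ : ℕ → TestSpace D := fun k => TestSpace.mk (radialBump z r s k)
    (contDiff_radialBump hr z s k) (hcomp k) ((hsupp k).trans hD) with hψ
  refine ⟨ψ, fun k x hx => radialBump_eq_zero hs.le k hx, ?_⟩
  rw [tendsto_iff_norm_sub_tendsto_zero]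
  have h := (tendsto_gradient_radialBump hr hrs z).sqrt
  rw [Real.sqrt_zero] at h
  refine h.congr fun k => ?_
  rw [← Real.sqrt_sq (norm_nonneg (gradL D (ψ k).toH10 - _)), ← real_inner_self_eq_norm_sq,
    L2.inner_def, gradL_toH10]
  congr 1
  refine integral_congr_ae ?_
  filter_upwards [Lp.coeFn_sub (gradLinear D (ψ k)) (annulusField z r s),
    coeFn_gradLinear (ψ k), coeFn_annulusField hr s z] with x h1 h2 h3
  rw [h1, Pi.sub_apply, h2, h3, real_inner_self_eq_norm_sq]
  rfl

/-- An annulus within a disc contained in D carries an L² limit of gradients of test functions, so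
the projection fixes its field. -/
lemma gradL_gradAdj_annulusField {z : ℂ} {r s : ℝ} (hr : 0 < r) (hrs : r < s)
    (hD : Metric.closedBall z s ⊆ D) :
    gradL D (gradAdj D (annulusField z r s)) = annulusField z r s := by
  obtain ⟨ψ, -, hψ⟩ := exists_tendsto_annulus hr hrs hD
  refine tendsto_nhds_unique (((gradL D).continuous.comp (gradAdj D).continuous).tendsto _ |>.comp hψ) ?_
  refine hψ.congr fun k => ?_
  simp only [Function.comp_apply, gradAdj_gradL]

/-- The potential of an annulus in `D`. -/
lemma greenReg_eq_add (hDb : Bornology.IsBounded D) {z : ℂ} {r s : ℝ} (hr : 0 < r) (hrs : r < s) :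
    greenReg D z r = greenReg D z s + gradAdj D (annulusField z r s) := by
  obtain ⟨R, hsR, hR⟩ := exists_radius hDb z s
  rw [greenReg_eq hr (hrs.le.trans hsR) hR, greenReg_eq (hr.trans hrs) hsR hR,
    ← annulusField_add hr hrs.le hsR, map_add, add_comm]

/-- The increment from radius `s` to radius `r` comes from a field that already is a gradient, so
projecting keeps its norm log(s/r). It also stays orthogonal to G^z_s, which comes from an annulus
outside the circle of radius `s`. Hence Var h_r(z) + log r is constant in r. -/
lemma norm_sq_greenReg_eq (hDb : Bornology.IsBounded D) {z : ℂ} {r s : ℝ} (hr : 0 < r)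
    (hrs : r < s) (hD : Metric.closedBall z s ⊆ D) :
    ‖greenReg D z r‖ ^ 2 = ‖greenReg D z s‖ ^ 2 + Real.log (s / r) := by
  obtain ⟨R, hsR, hR⟩ := exists_radius hDb z s
  have hs := hr.trans hrs
  have h1 : inner ℝ (greenReg D z s) (gradAdj D (annulusField z r s)) = 0 := by
    rw [greenReg_eq hs hsR hR, inner_gradAdj_left, gradL_gradAdj_annulusField hr hrs hD]
    exact inner_annulusField_eq_zero hs hr fun x _ h2 h3 _ => h3.not_ge h2
  have h2 : ‖gradAdj D (annulusField z r s)‖ ^ 2 = Real.log (s / r) := by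
    rw [← norm_sq_annulusField hr hrs.le z, ← real_inner_self_eq_norm_sq, inner_gradAdj_left,
      gradL_gradAdj_annulusField hr hrs hD, real_inner_self_eq_norm_sq]
  rw [greenReg_eq_add hDb hr hrs, norm_add_sq_real, h1, h2]
  ring

lemma circleAverage_eq_zero {f : ℂ → ℝ} {w : ℂ} {η : ℝ} (hη : 0 < η)
    (h : ∀ x, ‖x - w‖ = η → f x = 0) : Real.circleAverage f w η = 0 := by
  rw [Real.circleAverage_congr_sphere (f₂ := fun _ => (0 : ℝ)), Real.circleAverage_const]
  intro x hx
  rw [abs_of_pos hη, mem_sphere_iff_norm] at hx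
  exact h x hx

/-- The covariance of two circle averages does not depend on the radii of disjoint circles. -/
lemma inner_greenReg_eq (hDb : Bornology.IsBounded D) {z w : ℂ} {r s η : ℝ} (hr : 0 < r)
    (hrs : r < s) (hη : 0 < η) (hD : Metric.closedBall z s ⊆ D)
    (hzw : ∀ x, ‖x - w‖ = η → s ≤ ‖x - z‖) :
    inner ℝ (greenReg D z r) (greenReg D w η) = inner ℝ (greenReg D z s) (greenReg D w η) := by
  obtain ⟨ψ, hψ0, hψ⟩ := exists_tendsto_annulus hr hrs hD
  have h1 : inner ℝ (gradAdj D (annulusField z r s)) (greenReg D w η) = 0 := by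
    have h2 : Tendsto (fun k => inner ℝ (gradAdj D (gradL D (ψ k).toH10)) (greenReg D w η)) atTop
        (𝓝 (inner ℝ (gradAdj D (annulusField z r s)) (greenReg D w η))) :=
      (((gradAdj D).continuous.tendsto _).comp hψ).inner tendsto_const_nhds
    refine tendsto_nhds_unique h2 (tendsto_const_nhds.congr fun k => ?_)
    -- Each approximant vanishes outside the disc around `z`, hence on the circle around `w`, so its
    -- circle average there is 0.
    rw [gradAdj_gradL, real_inner_comm, inner_greenReg_toH10 hDb w hη, circleAverage_eq_zero hη]
    exact fun x hx => hψ0 k x (hzw x hx)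
  rw [greenReg_eq_add hDb hr hrs, inner_add_left, h1, add_zero]

end Liouville
end

/-! ### Weak measurability, a positive definite comparison, and the kernel |x|^{-a} -/

noncomputable section

namespace Liouville

variable {D : Set ℂ}

/-- For a test function in place of `u` this is a circle average, continuous in the centre; density
makes the general case a pointwise limit. -/
lemma measurable_inner_greenReg (hD : Bornology.IsBounded D) {ε : ℝ} (hε : 0 < ε) (u : H10 D) :
    Measurable fun z => inner ℝ (greenReg D z ε) u := by
  obtain ⟨f, hf⟩ : ∃ f : ℕ → TestSpace D, Tendsto (fun k => (f k).toH10) atTop (𝓝 u) := by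
    have hu : u ∈ closure (Set.range (TestSpace.toH10 (D := D))) := denseRange_toH10 u
    obtain ⟨x, hx, hxu⟩ := mem_closure_iff_seq_limit.1 hu
    choose f hf using hx
    exact ⟨f, by simpa only [hf] using hxu⟩
  refine measurable_of_tendsto_metrizable (f := fun k z => Real.circleAverage (f k).fn z ε)
    (fun k => ?_) ?_
  · have := (f k).contDiff.continuous
    refine Continuous.measurable ?_
    have h1 : Continuous fun z : ℂ =>
        ∫ θ in (0 : ℝ)..2 * Real.pi, (f k).fn (z + ε * Complex.exp (θ * Complex.I)) :=
      intervalIntegral.continuous_parametric_intervalIntegral_of_continuous' (by fun_prop) _ _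
    exact h1.const_smul (2 * Real.pi)⁻¹
  · rw [tendsto_pi_nhds]
    intro z
    simp_rw [← inner_greenReg_toH10 hD z hε]
    exact tendsto_const_nhds.inner hf

lemma measurable_inner_annulusField {r : ℝ} (hr : 0 < r) (s : ℝ) (u : FieldSpace) :
    Measurable fun z => inner ℝ (annulusField z r s) u := by
  simp_rw [inner_annulusField_left hr]
  refine StronglyMeasurable.measurable (StronglyMeasurable.integral_prod_right'
    (f := fun p : ℂ × ℂ => inner ℝ (radialField p.1 r s p.2) (u p.2)) ?_)
  refine Measurable.stronglyMeasurable (Measurable.inner ?_ ?_)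
  · unfold radialField
    have h : Measurable fun p : ℂ × ℂ => ‖p.2 - p.1‖ := by fun_prop
    exact Measurable.ite ((measurableSet_lt measurable_const h).inter
      (measurableSet_le h measurable_const)) (by fun_prop) measurable_const
  · exact (Lp.stronglyMeasurable u).measurable.comp measurable_snd

/-- The weak integral of a bounded weakly measurable function. -/
lemma exists_weak_integral {α H : Type*} [MeasurableSpace α] {μ : Measure α}
    [NormedAddCommGroup H] [InnerProductSpace ℝ H] [CompleteSpace H] {b : α → ℝ}
    (hb : Integrable b μ) {q : α → H} {C : ℝ} (hq : ∀ a, ‖q a‖ ≤ C)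
    (hqm : ∀ v, Measurable fun a => inner ℝ (q a) v) :
    (∀ v, Integrable (fun a => b a * inner ℝ (q a) v) μ) ∧
      ∃ m : H, ∀ v, inner ℝ m v = ∫ a, b a * inner ℝ (q a) v ∂μ := by
  have hint : ∀ v, Integrable (fun a => b a * inner ℝ (q a) v) μ := fun v =>
    hb.mul_bdd (c := C * ‖v‖) (hqm v).aestronglyMeasurable (Eventually.of_forall fun a =>
      (norm_inner_le_norm (𝕜 := ℝ) _ _).trans (by have := hq a; gcongr))
  refine ⟨hint, ?_⟩
  let ℓ : H →ₗ[ℝ] ℝ :=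
    { toFun := fun v => ∫ a, b a * inner ℝ (q a) v ∂μ
      map_add' := fun v w => by
        rw [← integral_add (hint v) (hint w)]
        simp_rw [inner_add_right, mul_add]
      map_smul' := fun c v => by
        rw [RingHom.id_apply, smul_eq_mul, ← integral_const_mul]
        simp_rw [real_inner_smul_right]
        exact integral_congr_ae (Eventually.of_forall fun a => by ring) }
  let L : H →L[ℝ] ℝ := ℓ.mkContinuous ((∫ a, ‖b a‖ ∂μ) * C) fun v => by
    change ‖∫ a, b a * inner ℝ (q a) v ∂μ‖ ≤ _
    rw [mul_assoc, ← integral_mul_const]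
    refine norm_integral_le_of_norm_le (hb.norm.mul_const _) (Eventually.of_forall fun a => ?_)
    rw [norm_mul]
    gcongr
    exact (norm_inner_le_norm (𝕜 := ℝ) _ _).trans (by have := hq a; gcongr)
  refine ⟨(InnerProductSpace.toDual ℝ H).symm L, fun v => ?_⟩
  rw [InnerProductSpace.toDual_symm_apply]
  rfl

lemma ofReal_integral_le_lintegral_ofReal {α : Type*} [MeasurableSpace α] {μ : Measure α}
    {f : α → ℝ} (hf : Integrable f μ) :
    ENNReal.ofReal (∫ a, f a ∂μ) ≤ ∫⁻ a, ENNReal.ofReal (f a) ∂μ := by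
  refine (ENNReal.ofReal_le_ofReal (integral_mono hf hf.pos_part fun a => le_max_left _ _)).trans ?_
  rw [ofReal_integral_eq_lintegral_ofReal hf.pos_part
    (Eventually.of_forall fun a => le_max_right _ _)]
  exact lintegral_mono fun a => by simp

/-- Positive definiteness of `exp ⟨q, q⟩ - 1` tested against nonnegative functions. -/
lemma sq_lintegral_le_lintegral_exp_inner {α H : Type*} [MeasurableSpace α] {μ : Measure α}
    [NormedAddCommGroup H] [InnerProductSpace ℝ H] [CompleteSpace H] {b : α → ℝ}
    (hb : Integrable b μ) (hb0 : ∀ a, 0 ≤ b a) {q : α → H} {C : ℝ} (hq : ∀ a, ‖q a‖ ≤ C)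
    (hqm : ∀ v, Measurable fun a => inner ℝ (q a) v) :
    (∫⁻ a, ENNReal.ofReal (b a) ∂μ) ^ 2 ≤
      ∫⁻ y, ∫⁻ x, ENNReal.ofReal (b x * b y * Real.exp (inner ℝ (q x) (q y))) ∂μ ∂μ := by
  obtain ⟨hint, m, hm⟩ := exists_weak_integral hb hq hqm
  set B := ∫ a, b a ∂μ with hB
  -- Only 1 + t is kept from e^t. The constant term yields the square of the total integral `B`, and
  -- the linear term yields ‖m‖² ≥ 0 for the weak integral `m` of `b q`.
  have h1 : ∀ y, ENNReal.ofReal (b y * (B + inner ℝ m (q y))) ≤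
      ∫⁻ x, ENNReal.ofReal (b x * b y * Real.exp (inner ℝ (q x) (q y))) ∂μ := by
    intro y
    have h2 : Integrable (fun x => b y * (b x + b x * inner ℝ (q x) (q y))) μ :=
      (hb.add (hint (q y))).const_mul _
    have h3 : b y * (B + inner ℝ m (q y)) =
        ∫ x, b y * (b x + b x * inner ℝ (q x) (q y)) ∂μ := by
      rw [integral_const_mul, integral_add hb (hint _), hm]
    rw [h3]
    refine (ofReal_integral_le_lintegral_ofReal h2).trans (lintegral_mono fun x => ?_)
    refine ENNReal.ofReal_le_ofReal ?_
    have h4 := Real.add_one_le_exp (inner ℝ (q x) (q y))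
    have h5 := mul_nonneg (hb0 x) (hb0 y)
    nlinarith
  refine le_trans ?_ (lintegral_mono h1)
  have h2 : Integrable (fun y => b y * (B + inner ℝ m (q y))) μ := by
    simp_rw [mul_add]
    refine (hb.mul_const B).add ?_
    simpa only [real_inner_comm] using hint m
  refine le_trans ?_ (ofReal_integral_le_lintegral_ofReal h2)
  rw [← ofReal_integral_eq_lintegral_ofReal hb (Eventually.of_forall hb0),
    ← ENNReal.ofReal_pow (integral_nonneg hb0)]
  refine ENNReal.ofReal_le_ofReal ?_
  simp_rw [mul_add]
  have h3 : ∫ y, b y * inner ℝ m (q y) ∂μ = inner ℝ m m := by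
    rw [hm]; simp_rw [real_inner_comm]
  rw [integral_add (hb.mul_const B) (by simpa only [real_inner_comm] using hint m), h3,
    integral_mul_const]
  have := real_inner_self_nonneg (F := H) (x := m)
  nlinarith

/-- The part of the annulus field orthogonal to the gradients of functions in `H¹₀(D)`. -/
def fieldDefect (D : Set ℂ) (ε R : ℝ) (z : ℂ) : FieldSpace :=
  annulusField z ε R - gradL D (gradAdj D (annulusField z ε R))

/-- The annulus kernel minus the Green kernel is thus a Gram kernel. This replaces a pointwise
comparison of Green's functions near the boundary. -/
lemma inner_fieldDefect (ε R : ℝ) (z w : ℂ) :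
    inner ℝ (fieldDefect D ε R z) (fieldDefect D ε R w) =
      inner ℝ (annulusField z ε R) (annulusField w ε R) -
        inner ℝ (gradAdj D (annulusField z ε R)) (gradAdj D (annulusField w ε R)) := by
  rw [fieldDefect, fieldDefect, inner_sub_left, inner_sub_right, inner_sub_right, inner_gradL,
    ← inner_gradAdj_left, real_inner_comm (annulusField w ε R) (gradL D _), ← inner_gradAdj_left,
    real_inner_comm (gradAdj D (annulusField z ε R)) (gradAdj D (annulusField w ε R))]
  ring

lemma norm_fieldDefect_le {ε R : ℝ} (hε : 0 < ε) (hεR : ε ≤ R) (z : ℂ) :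
    ‖fieldDefect D ε R z‖ ≤ √(Real.log (R / ε)) := by
  apply Real.le_sqrt_of_sq_le
  rw [← norm_sq_annulusField hε hεR z, ← real_inner_self_eq_norm_sq, inner_fieldDefect,
    real_inner_self_eq_norm_sq, real_inner_self_eq_norm_sq]
  linarith [sq_nonneg ‖gradAdj D (annulusField z ε R)‖]

lemma measurable_inner_fieldDefect {ε : ℝ} (hε : 0 < ε) (R : ℝ) (v : FieldSpace) :
    Measurable fun z => inner ℝ (fieldDefect D ε R z) v := by
  simp_rw [fieldDefect, inner_sub_left]
  refine (measurable_inner_annulusField hε R v).sub ?_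
  have h : ∀ z, inner ℝ (gradL D (gradAdj D (annulusField z ε R))) v =
      inner ℝ (annulusField z ε R) (gradL D (gradAdj D v)) := fun z => by
    rw [real_inner_comm, ← inner_gradAdj_left, real_inner_comm, inner_gradAdj_left]
  simp_rw [h]
  exact measurable_inner_annulusField hε R _

/-- Integral of the kernel `|x - z|^{-a}` over a disc. -/
def diskKernelIntegral (a ρ : ℝ) : ℝ≥0∞ :=
  ∫⁻ x in Metric.ball (0 : ℂ) ρ, ‖x‖ₑ ^ (-a)

lemma setLIntegral_ball_kernel (a ρ : ℝ) (z : ℂ) :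
    ∫⁻ x in Metric.ball z ρ, ‖x - z‖ₑ ^ (-a) = diskKernelIntegral a ρ := by
  rw [diskKernelIntegral, ← lintegral_indicator Metric.isOpen_ball.measurableSet,
    ← lintegral_indicator Metric.isOpen_ball.measurableSet,
    ← lintegral_sub_right_eq_self ((Metric.ball (0 : ℂ) ρ).indicator fun x => ‖x‖ₑ ^ (-a)) z]
  refine lintegral_congr fun x => ?_
  simp [Set.indicator, dist_eq_norm]

/-- In polar coordinates the integrand is t^{1-a}, integrable at 0 for a < 2. With a = γ² this is
where γ < √2 enters. -/
lemma diskKernelIntegral_lt_top {a : ℝ} (ha : a < 2) (ρ : ℝ) : diskKernelIntegral a ρ < ⊤ := by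
  have h1 : Integrable (fun x : ℂ => (Set.Iio ρ).indicator (fun t => t ^ (-a)) ‖x - 0‖) := by
    rw [integrable_norm_sub_iff]
    have : (fun t : ℝ => t * (Set.Iio ρ).indicator (fun t => t ^ (-a)) t) =
      (Set.Iio ρ).indicator fun t => t * t ^ (-a) := by
      ext t; by_cases ht : t ∈ Set.Iio ρ <;> simp [ht]
    rw [this, integrableOn_indicator_iff measurableSet_Iio, Set.inter_comm, Set.Ioi_inter_Iio]
    rcases le_or_gt ρ 0 with h | h
    · simp [Set.Ioo_eq_empty_of_le h]
    · have := intervalIntegral.intervalIntegrable_rpow' (a := 0) (b := ρ) (r := 1 - a) (by linarith)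
      rw [intervalIntegrable_iff_integrableOn_Ioo_of_le h.le] at this
      refine this.congr_fun (fun t ht => ?_) measurableSet_Ioo
      simp only
      rw [sub_eq_add_neg, Real.rpow_add ht.1, Real.rpow_one]
  have h2 := h1.hasFiniteIntegral
  rw [hasFiniteIntegral_iff_enorm] at h2
  refine lt_of_eq_of_lt ?_ h2
  rw [diskKernelIntegral, ← lintegral_indicator Metric.isOpen_ball.measurableSet]
  refine lintegral_congr_ae ?_
  filter_upwards [measure_eq_zero_iff_ae_notMem.1 (measure_singleton (0 : ℂ) (μ := volume))]
    with x hx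
  have hx0 : 0 < ‖x‖ := norm_pos_iff.2 hx
  by_cases hxρ : ‖x‖ < ρ
  · rw [Set.indicator_of_mem (by simpa using hxρ), sub_zero, Set.indicator_of_mem (by exact hxρ),
      Real.enorm_of_nonneg (by positivity), ← ENNReal.ofReal_rpow_of_pos hx0, ofReal_norm]
  · rw [Set.indicator_of_notMem (by simpa using hxρ), sub_zero,
      Set.indicator_of_notMem (by exact hxρ), enorm_zero]

lemma tendsto_diskKernelIntegral {a : ℝ} (ha : a < 2) :
    Tendsto (diskKernelIntegral a) (𝓝[>] 0) (𝓝 0) := by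
  have h1 := (diskKernelIntegral_lt_top ha 1).ne
  have h2 : Tendsto (fun ρ : ℝ => (volume.restrict (Metric.ball (0 : ℂ) 1)) (Metric.ball (0 : ℂ) ρ))
      (𝓝[>] 0) (𝓝 0) := by
    refine tendsto_of_tendsto_of_tendsto_of_le_of_le tendsto_const_nhds ?_ (fun _ => bot_le)
      (fun ρ => Measure.restrict_apply_le _ _)
    simp_rw [Complex.volume_ball]
    have : Tendsto (fun ρ : ℝ => ENNReal.ofReal ρ ^ 2 * NNReal.pi) (𝓝 0)
        (𝓝 (ENNReal.ofReal 0 ^ 2 * NNReal.pi)) :=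
      ENNReal.Tendsto.mul_const (((ENNReal.continuous_pow 2).comp ENNReal.continuous_ofReal).tendsto 0) (by simp)
    simpa using this.mono_left nhdsWithin_le_nhds
  refine (tendsto_setLIntegral_zero h1 h2).congr' ?_
  filter_upwards [Ioo_mem_nhdsGT (one_pos : (0 : ℝ) < 1)] with ρ hρ
  rw [diskKernelIntegral, Measure.restrict_restrict Metric.isOpen_ball.measurableSet,
    Set.inter_eq_self_of_subset_left (Metric.ball_subset_ball hρ.2.le)]

end Liouville
end

/-! ### Gaussian calculus for the pairings ⟨h, f⟩_∇ -/

noncomputable section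

namespace Liouville

lemma eLpNorm_two_sq {Ω : Type*} [MeasurableSpace Ω] {P : Measure Ω} (f : Ω → ℝ) :
    eLpNorm f 2 P ^ 2 = ∫⁻ ω, ‖f ω‖ₑ ^ 2 ∂P := by
  have := eLpNorm_nnreal_pow_eq_lintegral (μ := P) (f := f) (p := 2) (by norm_num)
  simpa using this

namespace GFF

variable {D : Set ℂ} {Ω : Type*} [MeasurableSpace Ω] {P : Measure Ω}

lemma map_partialSum (h : GFF D P) (α : ℕ → ℝ) (N : ℕ) :
    P.map (fun ω => ∑ n ∈ Finset.range N, h.coeff n ω * α n) =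
      gaussianReal 0 (∑ n ∈ Finset.range N, ‖α n‖₊ ^ 2) := by
  have hP : IsProbabilityMeasure P := h.indep_coeff.isProbabilityMeasure
  have hlaw : ∀ n, P.map (fun ω => h.coeff n ω * α n) = gaussianReal 0 (‖α n‖₊ ^ 2) := fun n => by
    have := (gaussianReal_mul_const (P := P) ⟨(h.measurable_coeff n).aemeasurable, h.map_coeff n⟩
      (α n)).map_eq
    rw [this, mul_zero]
    congr 1
    ext
    simp
  have hind : iIndepFun (fun n ω => h.coeff n ω * α n) P :=
    h.indep_coeff.comp (fun n x => x * α n) fun n => measurable_id.mul_const _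
  have hm : ∀ n, Measurable fun ω => h.coeff n ω * α n := fun n =>
    (h.measurable_coeff n).mul_const _
  induction N with
  | zero => simp [gaussianReal_zero_var]
  | succ N ih =>
    have := gaussianReal_add_gaussianReal_of_indepFun
      (hind.indepFun_finsetSum_of_notMem hm (s := Finset.range N) (i := N) (by simp))
      (by simpa only [Finset.sum_fn] using ih) (hlaw N)
    simp_rw [Finset.sum_range_succ]
    rw [zero_add] at this
    rw [← this]
    congr 1
    ext ω
    simp

lemma hasSum_sq_repr (h : GFF D P) (f : H10 D) :
    HasSum (fun n => ‖h.basis.repr f n‖₊ ^ 2) (‖f‖₊ ^ 2) := by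
  rw [← NNReal.hasSum_coe]
  have := h.basis.hasSum_inner_mul_inner f f
  rw [real_inner_self_eq_norm_sq] at this
  push_cast
  refine this.congr_fun ?_
  intro n
  rw [h.basis.repr_apply_apply, real_inner_comm, Real.norm_eq_abs, sq_abs, sq]

/-- The partial sums form a martingale bounded in L² by the norm of `f`, so the martingale
convergence theorem applies. -/
lemma ae_tendsto_pairing (h : GFF D P) (f : H10 D) :
    ∀ᵐ ω ∂P, Tendsto (fun N : ℕ => ∑ n ∈ Finset.range N, h.coeff n ω * h.basis.repr f n) atTop
      (𝓝 (h.pairing f ω)) := by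
  have hP : IsProbabilityMeasure P := h.indep_coeff.isProbabilityMeasure
  set α : ℕ → ℝ := fun n => h.basis.repr f n with hα
  have hsm : ∀ n, StronglyMeasurable (h.coeff n) := fun n => (h.measurable_coeff n).stronglyMeasurable
  set ℱ := Filtration.natural h.coeff hsm with hℱ
  -- Taking N + 1 terms makes `M N` depend exactly on the coefficients 0, ..., N known at time N;
  -- the shift of index is undone at the end.
  set M : ℕ → Ω → ℝ := fun N ω => ∑ n ∈ Finset.range (N + 1), h.coeff n ω * α n with hM
  have hmem : ∀ N, MemLp (M N) 2 P := fun N => by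
    have h1 := memLp_id_gaussianReal' (μ := 0) (v := ∑ n ∈ Finset.range (N + 1), ‖α n‖₊ ^ 2) 2
      (by simp)
    rw [← h.map_partialSum α (N + 1)] at h1
    exact h1.comp_of_map (Finset.measurable_fun_sum _ fun n _ =>
      (h.measurable_coeff n).mul_const _).aemeasurable
  have hcoeff : ∀ n, Integrable (h.coeff n) P := fun n => by
    have h1 := memLp_id_gaussianReal' (μ := 0) (v := 1) 1 (by simp)
    rw [← h.map_coeff n] at h1
    exact memLp_one_iff_integrable.1 (h1.comp_of_map (h.measurable_coeff n).aemeasurable)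
  have hmean : ∀ n, ∫ ω, h.coeff n ω ∂P = 0 := fun n => by
    have : ∫ x, x ∂(P.map (h.coeff n)) = 0 := by rw [h.map_coeff, integral_id_gaussianReal]
    rwa [integral_map (h.measurable_coeff n).aemeasurable (by fun_prop)] at this
  have hadp : StronglyAdapted ℱ M := fun N => by
    refine Finset.stronglyMeasurable_fun_sum _ fun n hn => StronglyMeasurable.mul_const ?_ _
    exact (Filtration.stronglyAdapted_natural hsm n).mono
      (ℱ.mono (by have := Finset.mem_range.1 hn; omega))
  have hmart : Martingale M ℱ P := by
    refine martingale_nat hadp (fun N => (hmem N).integrable (by norm_num)) fun N => ?_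
    have h1 : M (N + 1) = M N + α (N + 1) • h.coeff (N + 1) := by
      ext ω
      simp only [hM, Pi.add_apply, Pi.smul_apply, smul_eq_mul]
      rw [Finset.sum_range_succ _ (N + 1), mul_comm (α (N + 1))]
    rw [h1]
    have h2 := condExp_add ((hmem N).integrable (by norm_num))
      ((hcoeff (N + 1)).smul (α (N + 1))) (ℱ N)
    have h3 := condExp_smul (μ := P) (α (N + 1)) (h.coeff (N + 1)) (ℱ N)
    have h4 := h.indep_coeff.condExp_natural_ae_eq_of_lt hsm (Nat.lt_succ_self N)
    have h5 := condExp_of_stronglyMeasurable (ℱ.le N) (hadp N) ((hmem N).integrable (by norm_num))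
    filter_upwards [h2, h3, h4] with ω e2 e3 e4
    rw [e2, Pi.add_apply, h5, e3, Pi.smul_apply, e4, hmean]
    simp
  have hbdd : ∀ N, eLpNorm (M N) 1 P ≤ (‖f‖₊ : ℝ≥0∞) := fun N => by
    refine (eLpNorm_le_eLpNorm_of_exponent_le (by norm_num : (1 : ℝ≥0∞) ≤ 2)
      (hmem N).1).trans ?_
    have h1 : ∫ ω, M N ω ^ 2 ∂P = ∑ n ∈ Finset.range (N + 1), ‖α n‖ ^ 2 := by
      have h2 : ∫ x, x ^ 2 ∂(P.map (M N)) = ∑ n ∈ Finset.range (N + 1), ‖α n‖ ^ 2 := by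
        rw [h.map_partialSum α (N + 1)]
        have h3 := variance_fun_id_gaussianReal (μ := 0)
          (v := ∑ n ∈ Finset.range (N + 1), ‖α n‖₊ ^ 2)
        rw [variance_of_integral_eq_zero (by fun_prop) (by simp)] at h3
        simpa using h3
      rwa [integral_map (hmem N).1.aemeasurable (by fun_prop)] at h2
    have h2 : eLpNorm (M N) 2 P ^ 2 ≤ (‖f‖₊ : ℝ≥0∞) ^ 2 := by
      have h3 : ∀ ω, ‖M N ω‖ₑ ^ 2 = ENNReal.ofReal (M N ω ^ 2) := fun ω => by
        rw [← sq_abs, ENNReal.ofReal_pow (abs_nonneg _), ← Real.norm_eq_abs, ofReal_norm]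
      simp_rw [eLpNorm_two_sq, h3]
      rw [← ofReal_integral_eq_lintegral_ofReal (hmem N).integrable_sq
        (Eventually.of_forall fun ω => sq_nonneg _), h1]
      have h4 := sum_le_hasSum (Finset.range (N + 1)) (fun n _ => bot_le) (h.hasSum_sq_repr f)
      have h5 : ∑ n ∈ Finset.range (N + 1), ‖α n‖ ^ 2 ≤ ‖f‖ ^ 2 := by
        have h6 := NNReal.coe_le_coe.2 h4
        push_cast at h6
        exact h6
      refine (ENNReal.ofReal_le_ofReal h5).trans_eq ?_
      rw [ENNReal.ofReal_pow (norm_nonneg _), ofReal_norm, enorm_eq_nnnorm]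
    exact (ENNReal.pow_le_pow_left_iff (by norm_num)).1 h2
  filter_upwards [hmart.submartingale.exists_ae_tendsto_of_bdd hbdd] with ω ⟨c, hc⟩
  have : Tendsto (fun N : ℕ => ∑ n ∈ Finset.range N, h.coeff n ω * h.basis.repr f n) atTop (𝓝 c) :=
    (tendsto_add_atTop_iff_nat 1).1 hc
  exact tendsto_nhds_limUnder ⟨c, this⟩

lemma measurable_pairing (h : GFF D P) (f : H10 D) : Measurable (h.pairing f) :=
  (StronglyMeasurable.limUnder fun _ => (Finset.measurable_fun_sum _ fun n _ =>
    (h.measurable_coeff n).mul_const _).stronglyMeasurable).measurable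

/-- The characteristic functions of the partial sums converge in two ways: by dominated convergence
along the almost sure limit, and through their Gaussian formula by Parseval. -/
lemma map_pairing (h : GFF D P) (f : H10 D) :
    P.map (h.pairing f) = gaussianReal 0 (‖f‖₊ ^ 2) := by
  have hP : IsProbabilityMeasure P := h.indep_coeff.isProbabilityMeasure
  have hPm := Measure.isProbabilityMeasure_map (h.measurable_pairing f).aemeasurable (μ := P)
  refine Measure.ext_of_charFun (funext fun t => ?_)
  have hS : ∀ N, Measurable fun ω => ∑ n ∈ Finset.range N, h.coeff n ω * h.basis.repr f n :=
    fun N => Finset.measurable_fun_sum _ fun n _ => (h.measurable_coeff n).mul_const _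
  have h1 : Tendsto (fun N => charFun (P.map
      fun ω => ∑ n ∈ Finset.range N, h.coeff n ω * h.basis.repr f n) t) atTop
      (𝓝 (charFun (P.map (h.pairing f)) t)) := by
    rw [charFun_apply_real, integral_map (h.measurable_pairing f).aemeasurable (by fun_prop)]
    refine Tendsto.congr (f₁ := fun N => ∫ ω, Complex.exp (t *
      ((∑ n ∈ Finset.range N, h.coeff n ω * h.basis.repr f n : ℝ) : ℂ) * Complex.I) ∂P)
      (fun N => by rw [charFun_apply_real, integral_map (hS N).aemeasurable (by fun_prop)]) ?_
    refine tendsto_integral_of_dominated_convergence (fun _ => 1)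
      (fun N => ?_) (integrable_const _) (fun _ => Eventually.of_forall fun ω => ?_) ?_
    · have := hS N
      exact Measurable.aestronglyMeasurable (by fun_prop)
    · rw [← Complex.ofReal_mul, Complex.norm_exp_ofReal_mul_I]
    · filter_upwards [h.ae_tendsto_pairing f] with ω hω
      have : Continuous fun x : ℝ => Complex.exp (t * x * Complex.I) := by fun_prop
      exact (this.tendsto _).comp hω
  refine tendsto_nhds_unique h1 (Tendsto.congr (f₁ := fun N => Complex.exp (t * (0 : ℝ) * Complex.I -
    ((∑ n ∈ Finset.range N, ‖h.basis.repr f n‖₊ ^ 2 : NNReal) : ℂ) * t ^ 2 / 2))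
    (fun N => by rw [h.map_partialSum (fun n => h.basis.repr f n) N, charFun_gaussianReal]) ?_)
  rw [charFun_gaussianReal]
  have h2 := (h.hasSum_sq_repr f).tendsto_sum_nat
  have h3 : Continuous fun v : NNReal => Complex.exp (t * (0 : ℝ) * Complex.I - (v : ℂ) * t ^ 2 / 2) := by
    have : Continuous fun v : NNReal => (v : ℂ) :=
      Complex.continuous_ofReal.comp NNReal.continuous_coe
    fun_prop
  exact (h3.tendsto _).comp h2

lemma ae_pairing_add (h : GFF D P) (f g : H10 D) :
    ∀ᵐ ω ∂P, h.pairing (f + g) ω = h.pairing f ω + h.pairing g ω := by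
  filter_upwards [h.ae_tendsto_pairing f, h.ae_tendsto_pairing g, h.ae_tendsto_pairing (f + g)]
    with ω h1 h2 h3
  refine tendsto_nhds_unique h3 ((h1.add h2).congr fun N => ?_)
  rw [← Finset.sum_add_distrib]
  refine Finset.sum_congr rfl fun n _ => ?_
  rw [map_add, lp.coeFn_add, Pi.add_apply, mul_add]

lemma ae_pairing_smul (h : GFF D P) (c : ℝ) (f : H10 D) :
    ∀ᵐ ω ∂P, h.pairing (c • f) ω = c * h.pairing f ω := by
  filter_upwards [h.ae_tendsto_pairing f, h.ae_tendsto_pairing (c • f)] with ω h1 h3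
  refine tendsto_nhds_unique h3 ((h1.const_mul c).congr fun N => ?_)
  rw [Finset.mul_sum]
  refine Finset.sum_congr rfl fun n _ => ?_
  rw [map_smul, lp.coeFn_smul, Pi.smul_apply, smul_eq_mul]
  ring

lemma ae_pairing_sum (h : GFF D P) {ι : Type*} (s : Finset ι) (c : ι → ℝ) (f : ι → H10 D) :
    ∀ᵐ ω ∂P, h.pairing (∑ i ∈ s, c i • f i) ω = ∑ i ∈ s, c i * h.pairing (f i) ω := by
  classical
  induction s using Finset.induction_on with
  | empty =>
    refine Eventually.of_forall fun ω => ?_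
    simp only [Finset.sum_empty, pairing]
    refine Tendsto.limUnder_eq ?_
    simp
  | insert i s hi ih =>
    filter_upwards [ih, h.ae_pairing_smul (c i) (f i),
      h.ae_pairing_add (c i • f i) (∑ i ∈ s, c i • f i)] with ω h1 h2 h3
    rw [Finset.sum_insert hi, Finset.sum_insert hi, h3, h2, h1]

/-- A linear functional of finitely many pairings is almost surely a single pairing, with the
corresponding linear combination, and so is Gaussian. -/
lemma isGaussianProcess_pairing (h : GFF D P) : IsGaussianProcess h.pairing P := by
  have hP : IsProbabilityMeasure P := h.indep_coeff.isProbabilityMeasure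
  refine ⟨fun I => ⟨isGaussian_of_map_eq_gaussianReal fun L => ?_⟩⟩
  classical
  set F : H10 D := ∑ i : I, L (Pi.single i 1) • (i : H10 D) with hF
  refine ⟨0, ‖F‖₊ ^ 2, ?_⟩
  rw [← h.map_pairing F]
  have hm : Measurable fun ω => I.restrict fun f => h.pairing f ω := by
    rw [measurable_pi_iff]; exact fun i => h.measurable_pairing i
  rw [Measure.map_map (by fun_prop) hm]
  refine Measure.map_congr ?_
  filter_upwards [h.ae_pairing_sum Finset.univ (fun i : I => L (Pi.single i 1)) fun i => i]
    with ω hω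
  rw [hF, hω, Function.comp_apply, ← L.sum_comp_single]
  refine Finset.sum_congr rfl fun i _ => ?_
  have : (Pi.single i (h.pairing i ω) : I → ℝ) = h.pairing i ω • Pi.single i 1 := by
    rw [← Pi.single_smul, smul_eq_mul, mul_one]
  rw [ContinuousLinearMap.comp_apply, ContinuousLinearMap.single_apply,
    show I.restrict (fun f => h.pairing f ω) i = h.pairing i ω from rfl, this, map_smul,
    smul_eq_mul, mul_comm]

lemma integral_exp_pairing (h : GFF D P) (f : H10 D) :
    Integrable (fun ω => Real.exp (h.pairing f ω)) P ∧
      ∫ ω, Real.exp (h.pairing f ω) ∂P = Real.exp (‖f‖ ^ 2 / 2) := by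
  have h1 := integrable_exp_mul_gaussianReal (μ := 0) (v := ‖f‖₊ ^ 2) 1
  rw [← h.map_pairing f] at h1
  have h2 := mgf_gaussianReal (h.map_pairing f) 1
  simp only [mgf, one_mul] at h1 h2
  refine ⟨h1.comp_measurable (h.measurable_pairing f), ?_⟩
  rw [h2]
  simp

end GFF
end Liouville
end

/-! ### Joint measurability and second moments of the approximating densities -/

noncomputable section

namespace Liouville

variable {D : Set ℂ}

lemma exists_uniform_radius (hD : Bornology.IsBounded D) (ε : ℝ) :
    ∃ R, ε ≤ R ∧ 1 ≤ R ∧ ∀ z ∈ D, ∀ x ∈ D, ‖x - z‖ < R := by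
  obtain ⟨C, hC⟩ := hD.exists_norm_le
  refine ⟨max ε (max 1 (C + C + 1)), le_max_left _ _,
    (le_max_left _ _).trans (le_max_right _ _), fun z hz x hx =>
    lt_max_of_lt_right (lt_max_of_lt_right ?_)⟩
  linarith [norm_sub_le x z, hC x hx, hC z hz]

/-- The series `∑ aₙ ⟨eₙ, G^z_ε⟩` as a function of the coefficients and of the point. -/
def seriesField (b : HilbertBasis ℕ ℝ (H10 D)) (ε : ℝ) (a : ℕ → ℝ) (z : ℂ) : ℝ :=
  limUnder atTop fun N : ℕ => ∑ n ∈ Finset.range N, a n * b.repr (greenReg D z ε) n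

lemma measurable_repr_greenReg (hD : Bornology.IsBounded D) (b : HilbertBasis ℕ ℝ (H10 D)) {ε : ℝ}
    (hε : 0 < ε) (n : ℕ) : Measurable fun z => b.repr (greenReg D z ε) n := by
  simp_rw [b.repr_apply_apply, real_inner_comm]
  exact measurable_inner_greenReg hD hε _

lemma measurable_seriesField (hD : Bornology.IsBounded D) (b : HilbertBasis ℕ ℝ (H10 D)) {ε : ℝ}
    (hε : 0 < ε) : Measurable fun p : (ℕ → ℝ) × ℂ => seriesField b ε p.1 p.2 :=
  (StronglyMeasurable.limUnder fun _ => (Finset.measurable_fun_sum _ fun n _ =>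
    ((measurable_pi_apply n).comp measurable_fst).mul
      ((measurable_repr_greenReg hD b hε n).comp measurable_snd)).stronglyMeasurable).measurable

/-- Parseval writes the covariance as a series of products of functions of one variable, so joint
measurability follows from separate measurability. -/
lemma measurable_inner_greenReg_greenReg (hD : Bornology.IsBounded D)
    (b : HilbertBasis ℕ ℝ (H10 D)) {ε η : ℝ} (hε : 0 < ε) (hη : 0 < η) :
    Measurable fun p : ℂ × ℂ => inner ℝ (greenReg D p.1 ε) (greenReg D p.2 η) := by
  refine measurable_of_tendsto_metrizable (f := fun N p => ∑ n ∈ Finset.range N,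
    inner ℝ (greenReg D p.1 ε) (b n) * inner ℝ (b n) (greenReg D p.2 η)) (fun N => ?_) ?_
  · refine Finset.measurable_fun_sum _ fun n _ => ?_
    simp_rw [real_inner_comm (greenReg D _ η)]
    exact ((measurable_inner_greenReg hD hε _).comp measurable_fst).mul
      ((measurable_inner_greenReg hD hη _).comp measurable_snd)
  · rw [tendsto_pi_nhds]
    exact fun p => (b.hasSum_inner_mul_inner _ _).tendsto_sum_nat

/-- The density `ε^{γ²/2} e^{γ x}`. -/
def expWeight (γ ε x : ℝ) : ℝ := ε ^ (γ ^ 2 / 2) * Real.exp (γ * x)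

lemma expWeight_nonneg {ε : ℝ} (hε : 0 < ε) (γ x : ℝ) : 0 ≤ expWeight γ ε x := by
  unfold expWeight; positivity

lemma measurable_expWeight (γ ε : ℝ) : Measurable (expWeight γ ε) := by
  unfold expWeight; fun_prop

/-- `(‖G^z_ε‖² + log ε) / 2 + (‖G^w_η‖² + log η) / 2 + ⟨G^z_ε, G^w_η⟩`. -/
def kernelExponent (D : Set ℂ) (ε η : ℝ) (z w : ℂ) : ℝ :=
  (‖greenReg D z ε‖ ^ 2 + Real.log ε) / 2 + (‖greenReg D w η‖ ^ 2 + Real.log η) / 2 +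
    inner ℝ (greenReg D z ε) (greenReg D w η)

/-- The correlation kernel `E[ε^{γ²/2} e^{γ h_ε(z)} η^{γ²/2} e^{γ h_η(w)}]`. -/
def momentKernel (D : Set ℂ) (γ ε η : ℝ) (z w : ℂ) : ℝ≥0∞ :=
  ENNReal.ofReal (Real.exp (γ ^ 2 * kernelExponent D ε η z w))

lemma measurable_momentKernel (hD : Bornology.IsBounded D) (b : HilbertBasis ℕ ℝ (H10 D))
    {γ ε η : ℝ} (hε : 0 < ε) (hη : 0 < η) :
    Measurable fun p : ℂ × ℂ => momentKernel D γ ε η p.1 p.2 := by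
  have h1 := measurable_inner_greenReg_greenReg hD b hε hη
  have h2 : ∀ {ε : ℝ}, 0 < ε → Measurable fun z : ℂ => ‖greenReg D z ε‖ ^ 2 := fun {ε} hε => by
    simp_rw [← real_inner_self_eq_norm_sq]
    have := (measurable_inner_greenReg_greenReg hD b hε hε).comp
      (measurable_id.prodMk measurable_id)
    simpa only [Function.comp_def, id] using this
  have h3 := (h2 hε).comp (f := fun p : ℂ × ℂ => p.1) (by fun_prop)
  have h4 := (h2 hη).comp (f := fun p : ℂ × ℂ => p.2) (by fun_prop)
  unfold momentKernel kernelExponent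
  simp only [Function.comp_def] at h3 h4
  fun_prop

namespace GFF

variable {Ω : Type*} [MeasurableSpace Ω] {P : Measure Ω}

/-- Randomness enters only through the coefficient sequence. Joint measurability, measurability with
respect to `h`, and Cameron–Martin shifts are all treated on sequence space. -/
lemma circleAvg_eq_seriesField (h : GFF D P) (ε : ℝ) (z : ℂ) (ω : Ω) :
    h.circleAvg ε z ω = seriesField h.basis ε (fun n => h.coeff n ω) z := rfl

lemma measurable_circleAvg (h : GFF D P) (hD : Bornology.IsBounded D) {ε : ℝ} (hε : 0 < ε) :
    Measurable fun p : Ω × ℂ => h.circleAvg ε p.2 p.1 := by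
  have h1 : Measurable fun p : Ω × ℂ => ((fun n => h.coeff n p.1 : ℕ → ℝ), p.2) :=
    (measurable_pi_lambda _ fun n => (h.measurable_coeff n).comp measurable_fst).prodMk
      measurable_snd
  have h2 := (measurable_seriesField hD h.basis hε).comp h1
  simpa only [Function.comp_def, ← circleAvg_eq_seriesField] using h2

/-- The density of the approximating measure. -/
def density (h : GFF D P) (γ ε : ℝ) (ω : Ω) (z : ℂ) : ℝ≥0∞ :=
  ENNReal.ofReal (expWeight γ ε (h.circleAvg ε z ω))

lemma density_def (h : GFF D P) (γ ε : ℝ) (ω : Ω) (z : ℂ) :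
    h.density γ ε ω z = ENNReal.ofReal (expWeight γ ε (h.circleAvg ε z ω)) := rfl

lemma measurable_density (h : GFF D P) (hD : Bornology.IsBounded D) (γ : ℝ) {ε : ℝ} (hε : 0 < ε) :
    Measurable fun p : Ω × ℂ => h.density γ ε p.1 p.2 := by
  have := ((measurable_expWeight γ ε).comp (h.measurable_circleAvg hD hε)).ennreal_ofReal
  simpa only [Function.comp_def, ← density_def] using this

lemma measurable_density_right (h : GFF D P) (hD : Bornology.IsBounded D) (γ : ℝ) {ε : ℝ}
    (hε : 0 < ε) (ω : Ω) : Measurable (h.density γ ε ω) := by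
  have := (h.measurable_density hD γ hε).comp (measurable_prodMk_left (x := ω))
  simpa only [Function.comp_def] using this

lemma approxMeasure_eq (h : GFF D P) (γ ε : ℝ) (ω : Ω) :
    h.approxMeasure γ ε ω = (volume.restrict D).withDensity (h.density γ ε ω) := rfl

/-- The product is the exponential of the centred Gaussian ⟨h, γG^z_ε + γG^w_η⟩_∇; half its
variance, together with the powers of ε and η, is γ² times `kernelExponent`. -/
lemma lintegral_density_mul_density (h : GFF D P) (γ : ℝ) {ε η : ℝ} (hε : 0 < ε) (hη : 0 < η)
    (z w : ℂ) :
    ∫⁻ ω, h.density γ ε ω z * h.density γ η ω w ∂P = momentKernel D γ ε η z w := by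
  set u := γ • greenReg D z ε + γ • greenReg D w η with hu
  have h1 : ∀ᵐ ω ∂P, h.density γ ε ω z * h.density γ η ω w =
      ENNReal.ofReal (ε ^ (γ ^ 2 / 2) * η ^ (γ ^ 2 / 2) * Real.exp (h.pairing u ω)) := by
    filter_upwards [h.ae_pairing_add (γ • greenReg D z ε) (γ • greenReg D w η),
      h.ae_pairing_smul γ (greenReg D z ε), h.ae_pairing_smul γ (greenReg D w η)] with ω e1 e2 e3
    rw [density_def, density_def, ← ENNReal.ofReal_mul (expWeight_nonneg hε _ _), hu, e1, e2, e3,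
      Real.exp_add, expWeight, expWeight, circleAvg, circleAvg]
    congr 1
    ring
  rw [lintegral_congr_ae h1]
  obtain ⟨h2, h3⟩ := h.integral_exp_pairing u
  rw [← ofReal_integral_eq_lintegral_ofReal (h2.const_mul _)
    (Eventually.of_forall fun ω => by positivity), integral_const_mul, h3, momentKernel]
  congr 1
  rw [Real.rpow_def_of_pos hε, Real.rpow_def_of_pos hη, ← Real.exp_add, ← Real.exp_add,
    kernelExponent, hu, ← smul_add, norm_smul, mul_pow, Real.norm_eq_abs, sq_abs, norm_add_sq_real]
  congr 1
  ring

/-- The integral of a nonnegative function for the approximating measure. -/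
def mass (h : GFF D P) (γ ε : ℝ) (φ : ℂ → ℝ≥0∞) (ω : Ω) : ℝ≥0∞ :=
  ∫⁻ z in D, φ z * h.density γ ε ω z

lemma measurable_mass (h : GFF D P) (hD : Bornology.IsBounded D) (γ : ℝ) {ε : ℝ} (hε : 0 < ε)
    {φ : ℂ → ℝ≥0∞} (hφ : Measurable φ) : Measurable (h.mass γ ε φ) :=
  Measurable.lintegral_prod_right' (f := fun p : Ω × ℂ => φ p.2 * h.density γ ε p.1 p.2)
    ((hφ.comp measurable_snd).mul (h.measurable_density hD γ hε))

lemma lintegral_mass_mul_mass (h : GFF D P) (hD : Bornology.IsBounded D) (γ : ℝ) {ε η : ℝ}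
    (hε : 0 < ε) (hη : 0 < η) {φ ψ : ℂ → ℝ≥0∞} (hφ : Measurable φ) (hψ : Measurable ψ) :
    ∫⁻ ω, h.mass γ ε φ ω * h.mass γ η ψ ω ∂P =
      ∫⁻ p, φ p.1 * ψ p.2 * momentKernel D γ ε η p.1 p.2
        ∂((volume.restrict D).prod (volume.restrict D)) := by
  have hP : IsProbabilityMeasure P := h.indep_coeff.isProbabilityMeasure
  have h1 : ∀ ω, h.mass γ ε φ ω * h.mass γ η ψ ω = ∫⁻ p, φ p.1 * ψ p.2 *
      (h.density γ ε ω p.1 * h.density γ η ω p.2)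
        ∂((volume.restrict D).prod (volume.restrict D)) := by
    intro ω
    have h2 := lintegral_prod_mul (μ := volume.restrict D) (ν := volume.restrict D)
      (hφ.mul (h.measurable_density_right hD γ hε ω)).aemeasurable
      (hψ.mul (h.measurable_density_right hD γ hη ω)).aemeasurable
    simp only [Pi.mul_apply] at h2
    rw [mass, mass, ← h2]
    exact lintegral_congr fun p => by ring
  simp_rw [h1]
  have m1 := (h.measurable_density hD γ hε).comp
    (f := fun x : Ω × ℂ × ℂ => (x.1, x.2.1)) (by fun_prop)
  have m2 := (h.measurable_density hD γ hη).comp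
    (f := fun x : Ω × ℂ × ℂ => (x.1, x.2.2)) (by fun_prop)
  have m3 : Measurable fun x : Ω × ℂ × ℂ => φ x.2.1 * ψ x.2.2 := by fun_prop
  have m4 := m3.mul (m1.mul m2)
  simp only [Function.comp_def] at m4
  rw [lintegral_lintegral_swap (by exact m4.aemeasurable)]
  refine lintegral_congr fun p => ?_
  have m5 := ((h.measurable_density hD γ hε).comp (measurable_prodMk_right (y := p.1))).mul
    ((h.measurable_density hD γ hη).comp (measurable_prodMk_right (y := p.2)))
  simp only [Function.comp_def] at m5
  rw [lintegral_const_mul _ (by exact m5), h.lintegral_density_mul_density γ hε hη]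

end GFF

/-! ### Bounds for the correlation kernel -/

lemma norm_sq_greenReg_add_log_le {z : ℂ} {ε R : ℝ} (hε : 0 < ε) (hεR : ε ≤ R)
    (hR : ∀ x ∈ D, ‖x - z‖ < R) : ‖greenReg D z ε‖ ^ 2 + Real.log ε ≤ Real.log R := by
  have := norm_sq_greenReg_le hε hεR hR
  rw [Real.log_div (hε.trans_le hεR).ne' hε.ne'] at this
  linarith

lemma inner_greenReg_le_log {z w : ℂ} {ε R : ℝ} (hε : 0 < ε) (hεR : ε ≤ R)
    (hz : ∀ x ∈ D, ‖x - z‖ < R) (hw : ∀ x ∈ D, ‖x - w‖ < R) :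
    inner ℝ (greenReg D z ε) (greenReg D w ε) ≤ Real.log (R / ε) := by
  have h1 := norm_sq_greenReg_le hε hεR hz
  have h2 := norm_sq_greenReg_le hε hεR hw
  have h3 := real_inner_le_norm (greenReg D z ε) (greenReg D w ε)
  nlinarith [sq_nonneg (‖greenReg D z ε‖ - ‖greenReg D w ε‖)]

lemma kernelExponent_comm (ε η : ℝ) (z w : ℂ) :
    kernelExponent D ε η z w = kernelExponent D η ε w z := by
  rw [kernelExponent, kernelExponent, real_inner_comm]; ring

/-- Passing from `r` to `s` lowers the variance by log(s/r) and raises the normalising logarithm by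
the same amount. The covariance is unchanged, because the circle around `w` stays outside the disc
of radius `s` around `z`. -/
lemma kernelExponent_eq_left (hDb : Bornology.IsBounded D) {z w : ℂ} {r s η : ℝ} (hr : 0 < r)
    (hrs : r ≤ s) (hη : 0 < η) (hηs : η ≤ s) (hD : Metric.closedBall z s ⊆ D)
    (hzw : 2 * s ≤ ‖z - w‖) :
    kernelExponent D r η z w = kernelExponent D s η z w := by
  rcases hrs.eq_or_lt with rfl | hrs
  · rfl
  have h1 : ∀ x, ‖x - w‖ = η → s ≤ ‖x - z‖ := fun x hx => by
    have h3 : ‖z - w‖ ≤ ‖x - w‖ + ‖x - z‖ := by simpa using norm_sub_le (x - w) (x - z)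
    linarith
  rw [kernelExponent, kernelExponent, inner_greenReg_eq hDb hr hrs hη hD h1,
    norm_sq_greenReg_eq hDb hr hrs hD, Real.log_div (hr.trans hrs).ne' hr.ne']
  ring

lemma kernelExponent_eq (hDb : Bornology.IsBounded D) {z w : ℂ} {r r' s : ℝ} (hr : 0 < r)
    (hrs : r ≤ s) (hr' : 0 < r') (hrs' : r' ≤ s) (hz : Metric.closedBall z s ⊆ D)
    (hw : Metric.closedBall w s ⊆ D) (hzw : 2 * s ≤ ‖z - w‖) :
    kernelExponent D r r' z w = kernelExponent D s s z w := by
  rw [kernelExponent_eq_left hDb hr hrs hr' hrs' hz hzw, kernelExponent_comm,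
    kernelExponent_eq_left hDb hr' hrs' (hr.trans_le hrs) le_rfl hw (by rwa [norm_sub_rev]),
    kernelExponent_comm]

/-- Cauchy–Schwarz gives the bound log R + log(R/s) at any radius s ≤ δ. It is applied at s = ε when
|z - w| ≤ 2ε; otherwise the kernel equals the one at radius |z - w| / 2 or, for distant points, at
radius δ. -/
lemma kernelExponent_le_log (hDb : Bornology.IsBounded D) {z w : ℂ} {ε δ R : ℝ} (hε : 0 < ε)
    (hεδ : ε ≤ δ) (hR : ∀ z ∈ D, ∀ x ∈ D, ‖x - z‖ < R) (hz : Metric.closedBall z δ ⊆ D)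
    (hw : Metric.closedBall w δ ⊆ D) (hzw : z ≠ w) :
    kernelExponent D ε ε z w ≤ Real.log R + Real.log (R / δ) + Real.log (2 * R / ‖z - w‖) := by
  have hδ : 0 < δ := hε.trans_le hεδ
  have hd : 0 < ‖z - w‖ := norm_pos_iff.2 (sub_ne_zero.2 hzw)
  have hzD : z ∈ D := hz (Metric.mem_closedBall_self hδ.le)
  have hwD : w ∈ D := hw (Metric.mem_closedBall_self hδ.le)
  have hδR : δ < R := by
    have h1 : z + δ ∈ D := hz (by simp [abs_of_pos hδ])
    simpa [abs_of_pos hδ] using hR z hzD _ h1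
  have hR0 : 0 < R := hδ.trans hδR
  have hlogδ : 0 ≤ Real.log (R / δ) := Real.log_nonneg ((one_le_div hδ).2 hδR.le)
  have hzwR : ‖z - w‖ < R := hR w hwD z hzD
  have key : ∀ s, 0 < s → s ≤ δ →
      kernelExponent D s s z w ≤ Real.log R + Real.log (R / s) := by
    intro s hs hsδ
    have h1 := norm_sq_greenReg_add_log_le hs (hsδ.trans hδR.le) (hR z hzD)
    have h2 := norm_sq_greenReg_add_log_le hs (hsδ.trans hδR.le) (hR w hwD)
    have h3 := inner_greenReg_le_log hs (hsδ.trans hδR.le) (hR z hzD) (hR w hwD)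
    rw [kernelExponent]; linarith
  have hlog : ∀ s, ‖z - w‖ / 2 ≤ s → Real.log (R / s) ≤ Real.log (2 * R / ‖z - w‖) := by
    intro s hs
    have hs0 : 0 < s := (half_pos hd).trans_le hs
    apply Real.log_le_log (by positivity)
    rw [div_le_div_iff₀ hs0 hd]
    nlinarith
  rcases le_total (‖z - w‖ / 2) ε with h | h
  · linarith [key ε hε hεδ, hlog ε h]
  · rcases le_total (‖z - w‖ / 2) δ with h' | h'
    · rw [kernelExponent_eq hDb hε h hε h ((Metric.closedBall_subset_closedBall h').trans hz)
        ((Metric.closedBall_subset_closedBall h').trans hw) (by linarith)]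
      linarith [key _ (half_pos hd) h', hlog _ le_rfl]
    · rw [kernelExponent_eq hDb hε hεδ hε hεδ hz hw (by linarith)]
      have : 0 ≤ Real.log (2 * R / ‖z - w‖) :=
        Real.log_nonneg ((one_le_div hd).2 (by linarith))
      linarith [key _ hδ le_rfl]

/-- `exp (a (C + log (b / t))) = e^{a C} b^a t^{-a}` as an extended nonnegative real. -/
lemma ofReal_exp_le_enorm_rpow {a C b : ℝ} (hb : 0 < b) {x e : ℝ} {v : ℂ} (ha : 0 ≤ a)
    (h : v ≠ 0 → e ≤ C + Real.log (b / ‖v‖)) (hx : x ≤ a * e) :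
    ENNReal.ofReal (Real.exp x) ≤
      ENNReal.ofReal (Real.exp (a * (C + Real.log b))) * ‖v‖ₑ ^ (-a) := by
  -- At v = 0 the right side is infinite when a > 0; when a = 0 the exponent `x` is at most 0.
  rcases eq_or_ne v 0 with rfl | hv
  · rcases ha.eq_or_lt with rfl | ha
    · simpa using hx
    · rw [enorm_zero, ENNReal.zero_rpow_of_neg (by linarith), ENNReal.mul_top]
      · exact le_top
      · simp [Real.exp_pos]
  have hv0 : 0 < ‖v‖ := norm_pos_iff.2 hv
  have h := h hv
  rw [← ofReal_norm, ENNReal.ofReal_rpow_of_pos hv0, ← ENNReal.ofReal_mul (Real.exp_pos _).le]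
  refine ENNReal.ofReal_le_ofReal ?_
  rw [Real.rpow_def_of_pos hv0, ← Real.exp_add]
  refine Real.exp_le_exp.2 (hx.trans ?_)
  rw [Real.log_div hb.ne' hv0.ne'] at h
  nlinarith [mul_le_mul_of_nonneg_left h ha]

end Liouville
end

/-! ### Second moment estimates: finiteness, boundary layer and interior -/

noncomputable section

namespace Liouville

variable {D : Set ℂ}

lemma sq_lt_two {γ : ℝ} (hγ0 : 0 ≤ γ) (hγ : γ < √2) : γ ^ 2 < 2 := by
  have := (Real.lt_sqrt hγ0).1 hγ
  exact this

/-- The points of `D` at distance more than `δ` from the complement. -/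
def innerPart (D : Set ℂ) (δ : ℝ) : Set ℂ := {z | ENNReal.ofReal δ < Metric.infEDist z Dᶜ}

lemma measurableSet_innerPart (D : Set ℂ) (δ : ℝ) : MeasurableSet (innerPart D δ) :=
  (isOpen_lt continuous_const Metric.continuous_infEDist).measurableSet

lemma closedBall_subset_of_mem_innerPart {δ : ℝ} {z : ℂ} (hz : z ∈ innerPart D δ) :
    Metric.closedBall z δ ⊆ D := by
  intro x hx
  by_contra hxD
  have h1 : Metric.infEDist z Dᶜ ≤ edist z x := Metric.infEDist_le_edist_of_mem hxD
  have h2 : edist z x ≤ ENNReal.ofReal δ := by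
    rw [edist_comm, edist_dist]
    exact ENNReal.ofReal_le_ofReal hx
  exact absurd hz (not_lt.2 (h1.trans h2))

/-- Points of an open set have positive distance to the complement, so the sets removed shrink to
the empty set and continuity from above applies. -/
lemma tendsto_volume_diff_innerPart (hDo : IsOpen D) (hDb : Bornology.IsBounded D) :
    Tendsto (fun δ => volume (D \ innerPart D δ)) (𝓝[>] 0) (𝓝 0) := by
  have hfin : volume D ≠ ⊤ := hDb.measure_lt_top.ne
  have hmeas : ∀ δ, MeasurableSet (D \ innerPart D δ) := fun δ =>
    hDo.measurableSet.diff (measurableSet_innerPart D δ)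
  have h := tendsto_measure_biInter_gt (μ := volume) (s := fun δ => D \ innerPart D δ) (a := (0 : ℝ))
    (fun δ _ => (hmeas δ).nullMeasurableSet)
    (fun i j _ hij => Set.sdiff_subset_sdiff_right fun z (hz : _ < _) =>
      (ENNReal.ofReal_le_ofReal hij).trans_lt hz)
    ⟨1, one_pos, (measure_mono Set.sdiff_subset).trans_lt hDb.measure_lt_top |>.ne⟩
  have hempty : (⋂ r : ℝ, ⋂ (_ : r > 0), D \ innerPart D r) = ∅ := by
    refine Set.eq_empty_of_forall_notMem fun z hz => ?_
    simp only [Set.mem_iInter] at hz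
    have hzD : z ∈ D := (hz 1 one_pos).1
    have h1 : 0 < Metric.infEDist z Dᶜ := by
      rw [pos_iff_ne_zero, ne_eq, ← Metric.mem_closure_iff_infEDist_zero,
        hDo.isClosed_compl.closure_eq]
      exact fun h => h hzD
    obtain ⟨r, hr0, hr⟩ := ENNReal.lt_iff_exists_real_btwn.1 h1
    exact (hz r (by simpa using hr.1)).2 hr.2
  rwa [hempty, measure_empty] at h

/-- From second moments to the `L²` distance. -/
lemma eLpNorm_toReal_sub_sq_le {Ω : Type*} [MeasurableSpace Ω] {P : Measure Ω} {A B : Ω → ℝ≥0∞}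
    (hA : Measurable A) (hB : Measurable B) (hA2 : ∫⁻ ω, A ω ^ 2 ∂P ≠ ⊤)
    (hB2 : ∫⁻ ω, B ω ^ 2 ∂P ≠ ⊤) {X : ℝ≥0∞}
    (h : ∫⁻ ω, A ω ^ 2 ∂P + ∫⁻ ω, B ω ^ 2 ∂P ≤ 2 * ∫⁻ ω, A ω * B ω ∂P + X) :
    eLpNorm (fun ω => (A ω).toReal - (B ω).toReal) 2 P ^ 2 ≤ X := by
  have hAf : ∀ᵐ ω ∂P, A ω ^ 2 < ⊤ := ae_lt_top (hA.pow_const 2) hA2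
  have hBf : ∀ᵐ ω ∂P, B ω ^ 2 < ⊤ := ae_lt_top (hB.pow_const 2) hB2
  -- The expansion of the square, with the mixed term kept on the left to avoid truncated
  -- subtraction.
  have key : ∫⁻ ω, ‖(A ω).toReal - (B ω).toReal‖ₑ ^ 2 ∂P + 2 * ∫⁻ ω, A ω * B ω ∂P =
      ∫⁻ ω, A ω ^ 2 ∂P + ∫⁻ ω, B ω ^ 2 ∂P := by
    have hAB : Measurable fun ω => A ω * B ω := hA.mul hB
    rw [← lintegral_const_mul _ hAB, ← lintegral_add_right _ (hAB.const_mul 2),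
      ← lintegral_add_right _ (hB.pow_const 2)]
    refine lintegral_congr_ae ?_
    filter_upwards [hAf, hBf] with ω h1 h2
    have h1' : A ω ≠ ⊤ := fun hc => by simp [hc] at h1
    have h2' : B ω ≠ ⊤ := fun hc => by simp [hc] at h2
    lift A ω to NNReal using h1' with x
    lift B ω to NNReal using h2' with y
    simp only [ENNReal.coe_toReal]
    rw [← ofReal_norm, Real.norm_eq_abs, ← ENNReal.ofReal_pow (abs_nonneg _), sq_abs]
    rw [← ENNReal.ofReal_coe_nnreal (p := x), ← ENNReal.ofReal_coe_nnreal (p := y),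
      ← ENNReal.ofReal_mul x.coe_nonneg, ← ENNReal.ofReal_pow x.coe_nonneg,
      ← ENNReal.ofReal_pow y.coe_nonneg,
      ← ENNReal.ofReal_ofNat 2, ← ENNReal.ofReal_mul (by norm_num),
      ← ENNReal.ofReal_add (sq_nonneg _) (by positivity),
      ← ENNReal.ofReal_add (sq_nonneg _) (sq_nonneg _)]
    congr 1
    ring
  have hfin : 2 * ∫⁻ ω, A ω * B ω ∂P ≠ ⊤ := by
    have : 2 * ∫⁻ ω, A ω * B ω ∂P ≤ ∫⁻ ω, A ω ^ 2 ∂P + ∫⁻ ω, B ω ^ 2 ∂P := by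
      rw [← key]; exact le_add_self
    exact ne_top_of_le_ne_top (ENNReal.add_ne_top.2 ⟨hA2, hB2⟩) this
  rw [eLpNorm_two_sq]
  rw [← key, add_comm] at h
  exact (ENNReal.add_le_add_iff_left hfin).1 h

namespace GFF

variable {Ω : Type*} [MeasurableSpace Ω] {P : Measure Ω}

/-- At fixed ε the kernel is bounded on D × D, so this qualitative finiteness holds for every γ. It
legitimises the subtractions in the uniform estimates. -/
lemma lintegral_mass_sq_ne_top (h : GFF D P) (hDo : IsOpen D) (hD : Bornology.IsBounded D) (γ : ℝ)
    {ε : ℝ} (hε : 0 < ε) {φ : ℂ → ℝ≥0∞} (hφ : Measurable φ) {c : ℝ≥0∞} (hc : c ≠ ⊤)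
    (hφc : ∀ z ∈ D, φ z ≤ c) : ∫⁻ ω, h.mass γ ε φ ω ^ 2 ∂P ≠ ⊤ := by
  obtain ⟨R, hεR, -, hR⟩ := exists_uniform_radius hD ε
  simp_rw [sq, h.lintegral_mass_mul_mass hD γ hε hε hφ hφ]
  have h1 : ∀ᵐ p ∂((volume.restrict D).prod (volume.restrict D)),
      φ p.1 * φ p.2 * momentKernel D γ ε ε p.1 p.2 ≤
        c * c * ENNReal.ofReal (Real.exp (γ ^ 2 * (Real.log R + Real.log (R / ε)))) := by
    rw [Measure.prod_restrict]
    filter_upwards [ae_restrict_mem (hDo.measurableSet.prod hDo.measurableSet)] with p hp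
    have h2 : kernelExponent D ε ε p.1 p.2 ≤ Real.log R + Real.log (R / ε) := by
      have e1 := norm_sq_greenReg_add_log_le hε hεR (hR _ hp.1)
      have e2 := norm_sq_greenReg_add_log_le hε hεR (hR _ hp.2)
      have e3 := inner_greenReg_le_log hε hεR (hR _ hp.1) (hR _ hp.2)
      rw [kernelExponent]; linarith
    rw [momentKernel]
    have := hφc _ hp.1
    have := hφc _ hp.2
    gcongr
  refine ne_top_of_le_ne_top ?_ (lintegral_mono_ae h1)
  have : volume D ≠ ⊤ := hD.measure_lt_top.ne
  rw [lintegral_const]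
  refine ENNReal.mul_ne_top (ENNReal.mul_ne_top (ENNReal.mul_ne_top hc hc) (by simp)) ?_
  rw [Measure.prod_restrict, Measure.restrict_apply_univ, Measure.prod_prod]
  exact ENNReal.mul_ne_top this this

lemma ae_mass_ne_top (h : GFF D P) (hDo : IsOpen D) (hD : Bornology.IsBounded D) (γ : ℝ)
    {ε : ℝ} (hε : 0 < ε) {φ : ℂ → ℝ≥0∞} (hφ : Measurable φ) {c : ℝ≥0∞} (hc : c ≠ ⊤)
    (hφc : ∀ z ∈ D, φ z ≤ c) : ∀ᵐ ω ∂P, h.mass γ ε φ ω ≠ ⊤ := by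
  filter_upwards [ae_lt_top ((h.measurable_mass hD γ hε hφ).pow_const 2)
    (h.lintegral_mass_sq_ne_top hDo hD γ hε hφ hc hφc)] with ω hω hc
  simp [hc] at hω

lemma setLIntegral_density (h : GFF D P) (γ ε : ℝ) {A : Set ℂ} (hA : MeasurableSet A) (ω : Ω) :
    h.mass γ ε (A.indicator 1) ω = ∫⁻ z in A ∩ D, h.density γ ε ω z := by
  rw [mass, ← Measure.restrict_restrict hA, ← lintegral_indicator hA]
  refine lintegral_congr fun z => ?_
  by_cases hz : z ∈ A <;> simp [hz]

/-- The pathwise comparison with the explicit kernel. -/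
lemma sq_mass_le (h : GFF D P) (hDo : IsOpen D) (hD : Bornology.IsBounded D) (γ : ℝ) {ε R : ℝ}
    (hε : 0 < ε) (hεR : ε ≤ R) (hR : ∀ z ∈ D, ∀ x ∈ D, ‖x - z‖ < R) {A : Set ℂ}
    (hA : MeasurableSet A) {ω : Ω} (hω : h.mass γ ε (A.indicator 1) ω ≠ ⊤) :
    h.mass γ ε (A.indicator 1) ω ^ 2 ≤ ∫⁻ y in A ∩ D, ∫⁻ x in A ∩ D,
      ENNReal.ofReal (Real.exp (γ ^ 2 * (2 + Real.log (3 * R)))) * ‖x - y‖ₑ ^ (-γ ^ 2) *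
        (ENNReal.ofReal (Real.exp (-(γ ^ 2 * inner ℝ (greenReg D x ε) (greenReg D y ε)))) *
          (h.density γ ε ω x * h.density γ ε ω y)) := by
  have hAD : MeasurableSet (A ∩ D) := hA.inter hDo.measurableSet
  set b : ℂ → ℝ := fun z => expWeight γ ε (h.circleAvg ε z ω) with hb
  have hb0 : ∀ z, 0 ≤ b z := fun z => expWeight_nonneg hε _ _
  have hbm : Measurable b := by
    have := (measurable_expWeight γ ε).comp
      ((h.measurable_circleAvg hD hε).comp (measurable_prodMk_left (x := ω)))
    simpa only [Function.comp_def] using this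
  rw [setLIntegral_density h γ ε hA] at hω ⊢
  have hbi : Integrable b (volume.restrict (A ∩ D)) := by
    refine ⟨hbm.aestronglyMeasurable, ?_⟩
    rw [hasFiniteIntegral_iff_ofReal (Eventually.of_forall hb0)]
    exact hω.lt_top
  have hq : ∀ z, ‖γ • fieldDefect D ε R z‖ ≤ |γ| * √(Real.log (R / ε)) := fun z => by
    rw [norm_smul, Real.norm_eq_abs]
    have := norm_fieldDefect_le (D := D) hε hεR z
    gcongr
  have hqm : ∀ v, Measurable fun z => inner ℝ (γ • fieldDefect D ε R z) v := fun v => by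
    simp_rw [real_inner_smul_left]
    exact (measurable_inner_fieldDefect hε R v).const_mul _
  -- Positive definiteness is applied for the fixed path ω, with γ times the defect of the annulus
  -- field as feature vector; `e1` splits the exponent into γ² (annulus kernel) - γ² (Green kernel).
  refine (sq_lintegral_le_lintegral_exp_inner hbi hb0 hq hqm).trans ?_
  refine setLIntegral_mono' hAD fun y hy => setLIntegral_mono' hAD fun x hx => ?_
  have hγ2 : 0 ≤ γ ^ 2 := sq_nonneg γ
  have hR0 : 0 < R := hε.trans_le hεR
  have e1 : inner ℝ (γ • fieldDefect D ε R x) (γ • fieldDefect D ε R y) =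
      γ ^ 2 * inner ℝ (annulusField x ε R) (annulusField y ε R) +
        -(γ ^ 2 * inner ℝ (greenReg D x ε) (greenReg D y ε)) := by
    rw [real_inner_smul_left, real_inner_smul_right, inner_fieldDefect,
      greenReg_eq hε hεR (hR x hx.2), greenReg_eq hε hεR (hR y hy.2)]
    ring
  rw [e1, Real.exp_add, ENNReal.ofReal_mul (mul_nonneg (hb0 x) (hb0 y)),
    ENNReal.ofReal_mul (hb0 x), ENNReal.ofReal_mul (Real.exp_pos _).le, mul_comm, mul_assoc]
  gcongr ?_ * ?_
  · refine ofReal_exp_le_enorm_rpow (by positivity) hγ2 (fun hxy => ?_) le_rfl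
    have := inner_annulusField_le_log hε hεR (sub_ne_zero.1 hxy)
      (by linarith [hR y hy.2 x hx.2])
    linarith
  · rfl

/-- Second moments are bounded by the area, uniformly in `ε`. -/
lemma exists_lintegral_mass_indicator_sq_le (h : GFF D P) (hDo : IsOpen D)
    (hD : Bornology.IsBounded D) {γ : ℝ} (hγ : γ ^ 2 < 2) :
    ∃ C : ℝ≥0∞, C ≠ ⊤ ∧ ∀ ε, 0 < ε → ε ≤ 1 → ∀ A : Set ℂ, MeasurableSet A →
      ∫⁻ ω, h.mass γ ε (A.indicator 1) ω ^ 2 ∂P ≤ C * volume (A ∩ D) := by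
  have hP : IsProbabilityMeasure P := h.indep_coeff.isProbabilityMeasure
  obtain ⟨R, -, hR1, hR⟩ := exists_uniform_radius hD 1
  set C₁ := ENNReal.ofReal (Real.exp (γ ^ 2 * (2 + Real.log (3 * R)))) with hC₁
  set C₂ := ENNReal.ofReal (Real.exp (γ ^ 2 * Real.log R)) with hC₂
  refine ⟨C₁ * C₂ * diskKernelIntegral (γ ^ 2) R, ENNReal.mul_ne_top (by simp [hC₁, hC₂, ENNReal.mul_ne_top])
    (diskKernelIntegral_lt_top hγ R).ne, fun ε hε hε1 A hA => ?_⟩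
  have hεR := hε1.trans hR1
  have hAD : MeasurableSet (A ∩ D) := hA.inter hDo.measurableSet
  have hfin := h.ae_mass_ne_top hDo hD γ hε (φ := A.indicator 1)
    (measurable_one.indicator hA) ENNReal.one_ne_top
    (fun z _ => Set.indicator_le_self' (fun _ _ => zero_le_one) z)
  have hle := lintegral_mono_ae (hfin.mono fun ω hω => h.sq_mass_le hDo hD γ hε hεR hR hA hω)
  refine hle.trans ?_
  set F : ℂ × ℂ → ℝ≥0∞ := fun p => C₁ * ‖p.2 - p.1‖ₑ ^ (-γ ^ 2) with hF
  set E : ℂ × ℂ → ℝ≥0∞ := fun p =>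
    ENNReal.ofReal (Real.exp (-(γ ^ 2 * inner ℝ (greenReg D p.2 ε) (greenReg D p.1 ε)))) with hE
  have hFm : Measurable F := by rw [hF]; fun_prop
  have hEm : Measurable E := by
    have := (measurable_inner_greenReg_greenReg hD h.basis hε hε).comp measurable_swap
    simp only [Function.comp_def, Prod.fst_swap, Prod.snd_swap] at this
    rw [hE]; fun_prop
  have m1 := (h.measurable_density hD γ hε).comp
    (f := fun x : Ω × ℂ × ℂ => (x.1, x.2.2)) (by fun_prop)
  have m2 := (h.measurable_density hD γ hε).comp
    (f := fun x : Ω × ℂ × ℂ => (x.1, x.2.1)) (by fun_prop)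
  have m3 := (hFm.comp measurable_snd).mul ((hEm.comp (measurable_snd (α := Ω))).mul (m1.mul m2))
  simp only [Function.comp_def] at m3
  have e1 : ∀ ω, (∫⁻ y in A ∩ D, ∫⁻ x in A ∩ D, F (y, x) * (E (y, x) *
      (h.density γ ε ω x * h.density γ ε ω y))) =
      ∫⁻ p, F p * (E p * (h.density γ ε ω p.2 * h.density γ ε ω p.1))
        ∂((volume.restrict (A ∩ D)).prod (volume.restrict (A ∩ D))) := by
    intro ω
    rw [lintegral_prod]
    have := m3.comp (measurable_prodMk_left (x := ω))
    simp only [Function.comp_def] at this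
    exact this.aemeasurable
  rw [lintegral_congr e1, lintegral_lintegral_swap (by exact m3.aemeasurable)]
  -- The expected product of densities contains exp(γ² G), cancelled by the factor `E`; what remains
  -- are the two variances plus logarithms, each at most log R. No estimate on G itself is used.
  have e2 : ∀ᵐ p ∂((volume.restrict (A ∩ D)).prod (volume.restrict (A ∩ D))),
      ∫⁻ ω, F p * (E p * (h.density γ ε ω p.2 * h.density γ ε ω p.1)) ∂P ≤ C₂ * F p := by
    rw [Measure.prod_restrict]
    filter_upwards [ae_restrict_mem (hAD.prod hAD)] with p hp
    have m5 := ((h.measurable_density hD γ hε).comp (measurable_prodMk_right (y := p.2))).mul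
      ((h.measurable_density hD γ hε).comp (measurable_prodMk_right (y := p.1)))
    simp only [Function.comp_def] at m5
    rw [lintegral_const_mul _ (by exact m5.const_mul _), lintegral_const_mul _ (by exact m5),
      h.lintegral_density_mul_density γ hε hε, mul_comm]
    gcongr
    simp only [hE]
    rw [momentKernel, ← ENNReal.ofReal_mul (Real.exp_pos _).le, ← Real.exp_add, hC₂]
    refine ENNReal.ofReal_le_ofReal (Real.exp_le_exp.2 ?_)
    have n1 := norm_sq_greenReg_add_log_le hε hεR (hR _ hp.1.2)
    have n2 := norm_sq_greenReg_add_log_le hε hεR (hR _ hp.2.2)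
    have n3 : 0 ≤ γ ^ 2 := sq_nonneg γ
    rw [kernelExponent]
    nlinarith [mul_le_mul_of_nonneg_left n1 n3, mul_le_mul_of_nonneg_left n2 n3]
  refine (lintegral_mono_ae e2).trans ?_
  rw [lintegral_prod _ (hFm.const_mul C₂).aemeasurable]
  have e3 : ∀ y ∈ A ∩ D, ∫⁻ x in A ∩ D, C₂ * F (y, x) ≤
      C₁ * C₂ * diskKernelIntegral (γ ^ 2) R := by
    intro y hy
    have : ∀ x, C₂ * F (y, x) = C₁ * C₂ * ‖x - y‖ₑ ^ (-γ ^ 2) := fun x => by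
      simp only [hF]; ring
    simp_rw [this]
    rw [lintegral_const_mul _ (by fun_prop), ← setLIntegral_ball_kernel _ _ y]
    gcongr
    intro x hx
    rw [mem_ball_iff_norm]
    exact hR y hy.2 x hx.2
  refine (setLIntegral_mono' hAD e3).trans ?_
  rw [setLIntegral_const]

/-- The second moments of the approximations in the interior. -/
lemma exists_lintegral_mass_sq_add_le (h : GFF D P) (hDo : IsOpen D)
    (hD : Bornology.IsBounded D) (γ δ : ℝ) {c : ℝ≥0∞} (hc : c ≠ ⊤) :
    ∃ C : ℝ≥0∞, C ≠ ⊤ ∧ ∀ φ : ℂ → ℝ≥0∞, Measurable φ → (∀ z, φ z ≤ c) →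
      (∀ z, z ∉ innerPart D δ → φ z = 0) → ∀ ε η, 0 < ε → ε ≤ η → η ≤ δ →
      ∫⁻ ω, h.mass γ ε φ ω ^ 2 ∂P + ∫⁻ ω, h.mass γ η φ ω ^ 2 ∂P ≤
        2 * ∫⁻ ω, h.mass γ ε φ ω * h.mass γ η φ ω ∂P +
          C * diskKernelIntegral (γ ^ 2) (2 * η) := by
  obtain ⟨R, -, hR1, hR⟩ := exists_uniform_radius hD 1
  have hR0 : 0 < R := one_pos.trans_le hR1
  set C₁ := ENNReal.ofReal (Real.exp (γ ^ 2 *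
    (Real.log R + Real.log (R / δ) + Real.log (2 * R)))) with hC₁
  have hvol : volume D ≠ ⊤ := hD.measure_lt_top.ne
  refine ⟨2 * (c * c * C₁) * volume D, ENNReal.mul_ne_top (ENNReal.mul_ne_top (by simp)
    (ENNReal.mul_ne_top (ENNReal.mul_ne_top hc hc) (by simp [hC₁]))) hvol,
    fun φ hφ hφc hφ0 ε η hε hεη hηδ => ?_⟩
  have hη := hε.trans_le hεη
  set ν := (volume.restrict D).prod (volume.restrict D) with hν
  -- The error lives on pairs closer than 2η; the factor 2 accounts for the two second moments.
  set G : ℂ × ℂ → ℝ≥0∞ := fun p => 2 * (c * c * C₁) *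
    (Metric.ball (0 : ℂ) (2 * η)).indicator (fun v => ‖v‖ₑ ^ (-γ ^ 2)) (p.2 - p.1) with hG
  have hGm : Measurable G := by
    have : Measurable ((Metric.ball (0 : ℂ) (2 * η)).indicator fun v => ‖v‖ₑ ^ (-γ ^ 2)) :=
      Measurable.indicator (by fun_prop) Metric.isOpen_ball.measurableSet
    exact (this.comp (measurable_snd.sub measurable_fst)).const_mul _
  simp_rw [fun ε ω => sq (h.mass γ ε φ ω), h.lintegral_mass_mul_mass hD γ hε hε hφ hφ,
    h.lintegral_mass_mul_mass hD γ hη hη hφ hφ, h.lintegral_mass_mul_mass hD γ hε hη hφ hφ]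
  have hm : ∀ {ε η : ℝ}, 0 < ε → 0 < η → Measurable fun p : ℂ × ℂ =>
      φ p.1 * φ p.2 * momentKernel D γ ε η p.1 p.2 := fun hε hη =>
    ((hφ.comp measurable_fst).mul (hφ.comp measurable_snd)).mul
      (measurable_momentKernel hD h.basis hε hη)
  rw [← lintegral_add_left (hm hε hε), ← lintegral_const_mul _ (hm hε hη)]
  have hGint : ∫⁻ p, G p ∂ν ≤ 2 * (c * c * C₁) * volume D *
      diskKernelIntegral (γ ^ 2) (2 * η) := by
    rw [hν, lintegral_prod _ hGm.aemeasurable]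
    have e3 : ∀ y ∈ D, ∫⁻ x in D, G (y, x) ≤
        2 * (c * c * C₁) * diskKernelIntegral (γ ^ 2) (2 * η) := by
      intro y _
      simp only [hG]
      have m : Measurable fun x : ℂ =>
          (Metric.ball (0 : ℂ) (2 * η)).indicator (fun v => ‖v‖ₑ ^ (-γ ^ 2)) (x - y) :=
        (Measurable.indicator (by fun_prop) Metric.isOpen_ball.measurableSet).comp
          (measurable_id.sub_const y)
      rw [lintegral_const_mul _ m]
      gcongr
      refine (setLIntegral_le_lintegral _ _).trans ?_
      rw [lintegral_sub_right_eq_self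
        (fun x => (Metric.ball (0 : ℂ) (2 * η)).indicator (fun v => ‖v‖ₑ ^ (-γ ^ 2)) x) y,
        lintegral_indicator Metric.isOpen_ball.measurableSet]
      rfl
    refine (setLIntegral_mono' hDo.measurableSet e3).trans_eq ?_
    rw [setLIntegral_const]
    ring
  refine le_trans ?_ (add_le_add_right hGint _)
  rw [← lintegral_add_left ((hm hε hη).const_mul 2)]
  refine lintegral_mono fun p => ?_
  by_cases hp : p.1 ∈ innerPart D δ ∧ p.2 ∈ innerPart D δ
  swap
  · have : φ p.1 * φ p.2 = 0 := by
      rw [not_and_or] at hp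
      rcases hp with hp | hp <;> simp [hφ0 _ hp]
    simp [this]
  have b1 := closedBall_subset_of_mem_innerPart hp.1
  have b2 := closedBall_subset_of_mem_innerPart hp.2
  -- For distant points the three kernels are equal, so the first term on the right already matches
  -- the left side. For close points the mixed moment is dropped and both kernels are bounded by
  -- `kernelExponent_le_log`.
  rcases le_or_gt (2 * η) ‖p.1 - p.2‖ with hfar | hnear
  · have c1 := (Metric.closedBall_subset_closedBall hηδ).trans b1
    have c2 := (Metric.closedBall_subset_closedBall hηδ).trans b2
    rw [momentKernel, momentKernel, momentKernel, kernelExponent_eq hD hε hεη hε hεη c1 c2 hfar,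
      kernelExponent_eq hD hε hεη hη le_rfl c1 c2 hfar, ← two_mul]
    exact le_self_add
  · refine le_trans ?_ le_add_self
    have hmem : p.2 - p.1 ∈ Metric.ball (0 : ℂ) (2 * η) := by
      rw [mem_ball_zero_iff, norm_sub_rev]; exact hnear
    have hk : ∀ r, 0 < r → r ≤ δ → momentKernel D γ r r p.1 p.2 ≤
        C₁ * ‖p.2 - p.1‖ₑ ^ (-γ ^ 2) := fun r hr hrδ => by
      refine ofReal_exp_le_enorm_rpow (by positivity) (sq_nonneg γ) (fun hne => ?_) le_rfl
      rw [norm_sub_rev]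
      exact kernelExponent_le_log hD hr hrδ hR b1 b2 (sub_ne_zero.1 hne).symm
    have k1 := hk ε hε (hεη.trans hηδ)
    have k2 := hk η hη hηδ
    have f1 := hφc p.1
    have f2 := hφc p.2
    simp only [hG, Set.indicator_of_mem hmem]
    calc _ ≤ c * c * (C₁ * ‖p.2 - p.1‖ₑ ^ (-γ ^ 2)) + c * c * (C₁ * ‖p.2 - p.1‖ₑ ^ (-γ ^ 2)) := by
          gcongr
      _ = _ := by ring

end GFF

end Liouville
end

/-! ### The masses are Cauchy in L² -/

noncomputable section

namespace Liouville

variable {D : Set ℂ}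

lemma diskKernelIntegral_mono (a : ℝ) : Monotone (diskKernelIntegral a) := fun _ _ h =>
  lintegral_mono_set (Metric.ball_subset_ball h)

lemma enorm_toReal_le (x : ℝ≥0∞) : ‖x.toReal‖ₑ ≤ x := by
  rw [Real.enorm_of_nonneg ENNReal.toReal_nonneg]
  exact ENNReal.ofReal_toReal_le

lemma eLpNorm_toReal_sq_le {Ω : Type*} [MeasurableSpace Ω] {P : Measure Ω} (A : Ω → ℝ≥0∞) :
    eLpNorm (fun ω => (A ω).toReal) 2 P ^ 2 ≤ ∫⁻ ω, A ω ^ 2 ∂P := by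
  rw [eLpNorm_two_sq]
  exact lintegral_mono fun ω => by gcongr; exact enorm_toReal_le _

namespace GFF

variable {Ω : Type*} [MeasurableSpace Ω] {P : Measure Ω}

lemma mass_add (h : GFF D P) (hD : Bornology.IsBounded D) (γ : ℝ) {ε : ℝ} (hε : 0 < ε)
    {φ ψ : ℂ → ℝ≥0∞} (hφ : Measurable φ) (ω : Ω) :
    h.mass γ ε (fun z => φ z + ψ z) ω = h.mass γ ε φ ω + h.mass γ ε ψ ω := by
  have : Measurable fun z => φ z * h.density γ ε ω z :=
    hφ.mul (h.measurable_density_right hD γ hε ω)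
  simp_rw [mass, add_mul]
  rw [lintegral_add_left this]

/-- The boundary layer is negligible in `L²`. -/
lemma exists_eLpNorm_boundary_le (h : GFF D P) (hDo : IsOpen D) (hD : Bornology.IsBounded D) {γ : ℝ}
    (hγ : γ ^ 2 < 2) {c : ℝ≥0∞} (hc : c ≠ ⊤) {τ : ℝ≥0∞} (hτ : τ ≠ 0) :
    ∃ δ : ℝ, 0 < δ ∧ ∀ φ : ℂ → ℝ≥0∞, (∀ z, φ z ≤ c) → ∀ ε, 0 < ε → ε ≤ 1 →
      eLpNorm (fun ω => (h.mass γ ε ((innerPart D δ)ᶜ.indicator φ) ω).toReal) 2 P ≤ τ := by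
  obtain ⟨C, hC, hCle⟩ := h.exists_lintegral_mass_indicator_sq_le hDo hD hγ
  have h1 : Tendsto (fun δ => c ^ 2 * (C * volume (D \ innerPart D δ))) (𝓝[>] 0) (𝓝 0) := by
    have := ENNReal.Tendsto.const_mul (ENNReal.Tendsto.const_mul
      (tendsto_volume_diff_innerPart hDo hD) (Or.inr hC)) (Or.inr (ENNReal.pow_ne_top hc (n := 2)))
    simpa using this
  have hτ2 : 0 < τ ^ 2 := pos_iff_ne_zero.2 (pow_ne_zero 2 hτ)
  obtain ⟨δ, hδ, hδ0⟩ := ((h1.eventually_le_const hτ2).and self_mem_nhdsWithin).exists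
  refine ⟨δ, hδ0, fun φ hφ ε hε hε1 => ?_⟩
  rw [← ENNReal.pow_le_pow_left_iff (n := 2) two_ne_zero]
  refine (eLpNorm_toReal_sq_le _).trans (le_trans ?_ hδ)
  have hKc := (measurableSet_innerPart D δ).compl
  have h2 : ∀ ω, h.mass γ ε ((innerPart D δ)ᶜ.indicator φ) ω ^ 2 ≤
      c ^ 2 * h.mass γ ε ((innerPart D δ)ᶜ.indicator 1) ω ^ 2 := fun ω => by
    rw [← mul_pow]
    gcongr
    have hm : Measurable fun z => (innerPart D δ)ᶜ.indicator 1 z * h.density γ ε ω z :=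
      (measurable_one.indicator hKc).mul (h.measurable_density_right hD γ hε ω)
    rw [mass, mass, ← lintegral_const_mul _ hm]
    refine lintegral_mono fun z => ?_
    rw [← mul_assoc]
    gcongr
    by_cases hz : z ∈ (innerPart D δ)ᶜ
    · simpa [hz] using hφ z
    · simp [hz]
  have h3 := lintegral_mono (μ := P) h2
  rw [lintegral_const_mul _ ((h.measurable_mass hD γ hε (measurable_one.indicator hKc)).pow_const 2)]
    at h3
  refine h3.trans ?_
  gcongr
  refine (hCle ε hε hε1 _ hKc).trans_eq ?_
  rw [Set.inter_comm, ← Set.sdiff_eq]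

/-- The squared distance is at most a constant times the integral of |v|^{-γ²} over the disc of
radius 2η, where η is the larger radius; that integral tends to 0. -/
lemma exists_eLpNorm_interior_le (h : GFF D P) (hDo : IsOpen D) (hD : Bornology.IsBounded D) {γ : ℝ}
    (hγ : γ ^ 2 < 2) {c : ℝ≥0∞} (hc : c ≠ ⊤) {τ : ℝ≥0∞} (hτ : τ ≠ 0) {δ : ℝ} (hδ : 0 < δ) :
    ∃ ε₀ : ℝ, 0 < ε₀ ∧ ∀ φ : ℂ → ℝ≥0∞, Measurable φ → (∀ z, φ z ≤ c) →
      (∀ z, z ∉ innerPart D δ → φ z = 0) → ∀ ε η, 0 < ε → ε < ε₀ → 0 < η → η < ε₀ →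
      eLpNorm (fun ω => (h.mass γ ε φ ω).toReal - (h.mass γ η φ ω).toReal) 2 P ≤ τ := by
  obtain ⟨C, hC, hCle⟩ := h.exists_lintegral_mass_sq_add_le hDo hD γ δ hc
  have h1 : Tendsto (fun ρ => C * diskKernelIntegral (γ ^ 2) ρ) (𝓝[>] 0) (𝓝 0) := by
    have := ENNReal.Tendsto.const_mul (tendsto_diskKernelIntegral hγ) (Or.inr hC)
    simpa using this
  have hτ2 : 0 < τ ^ 2 := pos_iff_ne_zero.2 (pow_ne_zero 2 hτ)
  obtain ⟨ρ, hρ, hρ0⟩ := ((h1.eventually_le_const hτ2).and self_mem_nhdsWithin).exists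
  have hρ0 : 0 < ρ := hρ0
  have key : ∀ φ : ℂ → ℝ≥0∞, Measurable φ → (∀ z, φ z ≤ c) →
      (∀ z, z ∉ innerPart D δ → φ z = 0) → ∀ ε η, 0 < ε → ε ≤ η → η < min δ (ρ / 2) →
      eLpNorm (fun ω => (h.mass γ ε φ ω).toReal - (h.mass γ η φ ω).toReal) 2 P ≤ τ := by
    intro φ hφ hφc hφ0 ε η hε hεη hη
    have hη0 := hε.trans_le hεη
    rw [← ENNReal.pow_le_pow_left_iff (n := 2) two_ne_zero]
    refine (eLpNorm_toReal_sub_sq_le (h.measurable_mass hD γ hε hφ) (h.measurable_mass hD γ hη0 hφ)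
      (h.lintegral_mass_sq_ne_top hDo hD γ hε hφ hc fun z _ => hφc z)
      (h.lintegral_mass_sq_ne_top hDo hD γ hη0 hφ hc fun z _ => hφc z)
      (hCle φ hφ hφc hφ0 ε η hε hεη (hη.le.trans (min_le_left _ _)))).trans (le_trans ?_ hρ)
    gcongr
    apply diskKernelIntegral_mono
    linarith [hη.trans_le (min_le_right _ _)]
  refine ⟨min δ (ρ / 2), lt_min hδ (half_pos hρ0), fun φ hφ hφc hφ0 ε η hε hε0 hη hη0 => ?_⟩
  rcases le_total ε η with hle | hle
  · exact key φ hφ hφc hφ0 ε η hε hle hη0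
  · have := key φ hφ hφc hφ0 η ε hη hle hε0
    rwa [← eLpNorm_neg, show (-fun ω => (h.mass γ η φ ω).toReal - (h.mass γ ε φ ω).toReal) =
      fun ω => (h.mass γ ε φ ω).toReal - (h.mass γ η φ ω).toReal by ext ω; simp] at this

/-- The masses of a bounded nonnegative function are Cauchy in `L²`. -/
lemma exists_eLpNorm_mass_sub_le (h : GFF D P) (hDo : IsOpen D) (hD : Bornology.IsBounded D) {γ : ℝ}
    (hγ : γ ^ 2 < 2) {c : ℝ≥0∞} (hc : c ≠ ⊤) {τ : ℝ≥0∞} (hτ : τ ≠ 0) :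
    ∃ ε₀ : ℝ, 0 < ε₀ ∧ ∀ φ : ℂ → ℝ≥0∞, Measurable φ → (∀ z, φ z ≤ c) →
      ∀ ε η, 0 < ε → ε < ε₀ → 0 < η → η < ε₀ →
      eLpNorm (fun ω => (h.mass γ ε φ ω).toReal - (h.mass γ η φ ω).toReal) 2 P ≤ τ := by
  -- One third for the interior difference, and one for the boundary mass at each of the two radii.
  -- The layer width `δ` is fixed before the radii.
  have hτ3 : τ / 3 ≠ 0 := (ENNReal.div_pos hτ (by simp)).ne'
  obtain ⟨δ, hδ, hbd⟩ := h.exists_eLpNorm_boundary_le hDo hD hγ hc hτ3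
  obtain ⟨ε₀, hε₀, hint⟩ := h.exists_eLpNorm_interior_le hDo hD hγ hc hτ3 hδ
  refine ⟨min ε₀ 1, lt_min hε₀ one_pos, fun φ hφ hφc ε η hε hεlt hη hηlt => ?_⟩
  set K := innerPart D δ with hK
  have hKm : MeasurableSet K := measurableSet_innerPart D δ
  have hle : ∀ S : Set ℂ, ∀ z, S.indicator φ z ≤ c := fun S z =>
    (Set.indicator_le_self S φ z).trans (hφc z)
  have hsplit : ∀ {ε : ℝ}, 0 < ε → ∀ᵐ ω ∂P, (h.mass γ ε φ ω).toReal =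
      (h.mass γ ε (K.indicator φ) ω).toReal + (h.mass γ ε (Kᶜ.indicator φ) ω).toReal := by
    intro ε hε
    filter_upwards [h.ae_mass_ne_top hDo hD γ hε (hφ.indicator hKm) hc fun z _ => hle K z,
      h.ae_mass_ne_top hDo hD γ hε (hφ.indicator hKm.compl) hc fun z _ => hle Kᶜ z] with ω h1 h2
    rw [← ENNReal.toReal_add h1 h2, ← h.mass_add hD γ hε (hφ.indicator hKm)]
    congr 2
    ext z
    exact (Set.indicator_self_add_compl_apply K φ z).symm
  have hmeas : ∀ {ε : ℝ}, 0 < ε → ∀ {S : Set ℂ}, MeasurableSet S →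
      AEStronglyMeasurable (fun ω => (h.mass γ ε (S.indicator φ) ω).toReal) P := fun hε _ hS =>
    (h.measurable_mass hD γ hε (hφ.indicator hS)).ennreal_toReal.aestronglyMeasurable
  have heq : (fun ω => (h.mass γ ε φ ω).toReal - (h.mass γ η φ ω).toReal) =ᵐ[P]
      (fun ω => (h.mass γ ε (K.indicator φ) ω).toReal - (h.mass γ η (K.indicator φ) ω).toReal) +
      ((fun ω => (h.mass γ ε (Kᶜ.indicator φ) ω).toReal) -
        fun ω => (h.mass γ η (Kᶜ.indicator φ) ω).toReal) := by
    filter_upwards [hsplit hε, hsplit hη] with ω h1 h2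
    simp only [Pi.add_apply, Pi.sub_apply]
    rw [h1, h2]; ring
  rw [eLpNorm_congr_ae heq]
  refine (eLpNorm_add_le ((hmeas hε hKm).sub (hmeas hη hKm))
    ((hmeas hε hKm.compl).sub (hmeas hη hKm.compl)) (by norm_num)).trans ?_
  have b1 := hint _ (hφ.indicator hKm) (hle K) (fun z hz => Set.indicator_of_notMem hz φ) ε η hε
    (hεlt.trans_le (min_le_left _ _)) hη (hηlt.trans_le (min_le_left _ _))
  have b2 := hbd φ hφc ε hε (hεlt.le.trans (min_le_right _ _))
  have b3 := hbd φ hφc η hη (hηlt.le.trans (min_le_right _ _))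
  have b4 := (eLpNorm_sub_le (hmeas hε hKm.compl) (hmeas hη hKm.compl)
    (by norm_num : (1 : ℝ≥0∞) ≤ 2)).trans (add_le_add b2 b3)
  refine (add_le_add b1 b4).trans_eq ?_
  rw [← add_assoc, ENNReal.add_thirds]

lemma isFiniteMeasure_approxMeasure_iff (h : GFF D P) (γ ε : ℝ) (ω : Ω) :
    IsFiniteMeasure (h.approxMeasure γ ε ω) ↔ h.mass γ ε 1 ω ≠ ⊤ := by
  rw [isFiniteMeasure_iff, approxMeasure_eq, withDensity_apply _ MeasurableSet.univ, mass,
    lt_top_iff_ne_top]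
  simp

lemma ae_isFiniteMeasure (h : GFF D P) (hDo : IsOpen D) (hD : Bornology.IsBounded D) (γ : ℝ)
    {ε : ℝ} (hε : 0 < ε) : ∀ᵐ ω ∂P, IsFiniteMeasure (h.approxMeasure γ ε ω) := by
  filter_upwards [h.ae_mass_ne_top hDo hD γ hε measurable_one ENNReal.one_ne_top
    fun _ _ => le_rfl] with ω hω
  exact (h.isFiniteMeasure_approxMeasure_iff γ ε ω).2 hω

lemma lintegral_approxMeasure (h : GFF D P) (hD : Bornology.IsBounded D) (γ : ℝ) {ε : ℝ}
    (hε : 0 < ε) {φ : ℂ → ℝ≥0∞} (hφ : Measurable φ) (ω : Ω) :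
    ∫⁻ z, φ z ∂(h.approxMeasure γ ε ω) = h.mass γ ε φ ω := by
  rw [approxMeasure_eq, lintegral_withDensity_eq_lintegral_mul _
    (h.measurable_density_right hD γ hε ω) hφ, mass]
  exact lintegral_congr fun z => mul_comm _ _

/-- The integral of a bounded function in terms of masses. -/
lemma integral_approxMeasure (h : GFF D P) (hD : Bornology.IsBounded D) (γ : ℝ) {ε : ℝ}
    (hε : 0 < ε) {φ : ℂ → ℝ} (hφ : Measurable φ) {c : ℝ} (hc : ∀ z, |φ z| ≤ c) {ω : Ω}
    (hω : IsFiniteMeasure (h.approxMeasure γ ε ω)) :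
    ∫ z, φ z ∂(h.approxMeasure γ ε ω) =
      (h.mass γ ε (fun z => ENNReal.ofReal (φ z)) ω).toReal -
        (h.mass γ ε (fun z => ENNReal.ofReal (-φ z)) ω).toReal := by
  have hi : Integrable φ (h.approxMeasure γ ε ω) :=
    Integrable.of_bound hφ.aestronglyMeasurable c (Eventually.of_forall hc)
  rw [integral_eq_lintegral_pos_part_sub_lintegral_neg_part hi,
    h.lintegral_approxMeasure hD γ hε hφ.ennreal_ofReal,
    h.lintegral_approxMeasure hD γ hε (φ := fun z => ENNReal.ofReal (-φ z)) hφ.neg.ennreal_ofReal]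

lemma memLp_integral_approxMeasure (h : GFF D P) (hDo : IsOpen D) (hD : Bornology.IsBounded D)
    (γ : ℝ) {ε : ℝ} (hε : 0 < ε) {φ : ℂ → ℝ} (hφ : Measurable φ) {c : ℝ} (hc : ∀ z, |φ z| ≤ c) :
    MemLp (fun ω => ∫ z, φ z ∂(h.approxMeasure γ ε ω)) 2 P := by
  have key : ∀ ψ : ℂ → ℝ, Measurable ψ → (∀ z, |ψ z| ≤ c) →
      MemLp (fun ω => (h.mass γ ε (fun z => ENNReal.ofReal (ψ z)) ω).toReal) 2 P := by
    intro ψ hψ hψc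
    refine ⟨(h.measurable_mass hD γ hε hψ.ennreal_ofReal).ennreal_toReal.aestronglyMeasurable, ?_⟩
    have h1 := eLpNorm_toReal_sq_le (P := P)
      fun ω => h.mass γ ε (fun z => ENNReal.ofReal (ψ z)) ω
    have h2 := h.lintegral_mass_sq_ne_top hDo hD γ hε hψ.ennreal_ofReal (c := ENNReal.ofReal c)
      (by simp) fun z _ => ENNReal.ofReal_le_ofReal ((le_abs_self _).trans (hψc z))
    by_contra hcon
    rw [not_lt, top_le_iff] at hcon
    rw [hcon] at h1
    exact h2 (top_le_iff.1 (by simpa using h1))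
  refine ((key φ hφ hc).sub (key (fun z => -φ z) hφ.neg fun z => by rw [abs_neg]; exact hc z)).ae_eq ?_
  filter_upwards [h.ae_isFiniteMeasure hDo hD γ hε] with ω hω
  rw [h.integral_approxMeasure hD γ hε hφ hc hω]
  rfl

lemma exists_eLpNorm_integral_sub_le (h : GFF D P) (hDo : IsOpen D) (hD : Bornology.IsBounded D)
    {γ : ℝ} (hγ : γ ^ 2 < 2) {φ : ℂ → ℝ} (hφ : Measurable φ) {c : ℝ} (hc : ∀ z, |φ z| ≤ c)
    {τ : ℝ≥0∞} (hτ : τ ≠ 0) :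
    ∃ ε₀ : ℝ, 0 < ε₀ ∧ ∀ ε η, 0 < ε → ε < ε₀ → 0 < η → η < ε₀ →
      eLpNorm (fun ω => (∫ z, φ z ∂(h.approxMeasure γ ε ω)) -
        ∫ z, φ z ∂(h.approxMeasure γ η ω)) 2 P ≤ τ := by
  obtain ⟨ε₀, hε₀, hle⟩ := h.exists_eLpNorm_mass_sub_le hDo hD hγ (c := ENNReal.ofReal c) (by simp)
    (ENNReal.half_pos hτ).ne'
  refine ⟨ε₀, hε₀, fun ε η hε hεlt hη hηlt => ?_⟩
  set A := fun (ψ : ℂ → ℝ) (ε : ℝ) ω => (h.mass γ ε (fun z => ENNReal.ofReal (ψ z)) ω).toReal with hA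
  have hmeas : ∀ {ψ : ℂ → ℝ}, Measurable ψ → ∀ {ε : ℝ}, 0 < ε → Measurable (A ψ ε) :=
    fun hψ _ hε => (h.measurable_mass hD γ hε hψ.ennreal_ofReal).ennreal_toReal
  have heq : (fun ω => (∫ z, φ z ∂(h.approxMeasure γ ε ω)) -
      ∫ z, φ z ∂(h.approxMeasure γ η ω)) =ᵐ[P]
      (fun ω => A φ ε ω - A φ η ω) - fun ω => A (fun z => -φ z) ε ω - A (fun z => -φ z) η ω := by
    filter_upwards [h.ae_isFiniteMeasure hDo hD γ hε, h.ae_isFiniteMeasure hDo hD γ hη] with ω h1 h2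
    rw [h.integral_approxMeasure hD γ hε hφ hc h1, h.integral_approxMeasure hD γ hη hφ hc h2]
    simp only [Pi.sub_apply, hA]
    ring
  rw [eLpNorm_congr_ae heq]
  refine (eLpNorm_sub_le ((hmeas hφ hε).sub (hmeas hφ hη)).aestronglyMeasurable
    ((hmeas hφ.neg hε).sub (hmeas hφ.neg hη)).aestronglyMeasurable (by norm_num)).trans ?_
  rw [← ENNReal.add_halves τ]
  exact add_le_add
    (hle _ hφ.ennreal_ofReal (fun z => ENNReal.ofReal_le_ofReal ((le_abs_self _).trans (hc z)))
      ε η hε hεlt hη hηlt)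
    (hle _ hφ.neg.ennreal_ofReal (fun z => ENNReal.ofReal_le_ofReal
      ((neg_le_abs _).trans (hc z))) ε η hε hεlt hη hηlt)

end GFF

/-- Nothing is known about `φ` off the closure of `D`, where it need not even be measurable. The
approximating measures are carried by `D`, so cutting off there changes no integral. -/
lemma exists_measurable_bounded_eqOn (hDo : IsOpen D) (hD : Bornology.IsBounded D) {φ : ℂ → ℝ}
    (hφ : ContinuousOn φ (closure D)) :
    ∃ c : ℝ, Measurable (D.indicator φ) ∧ ∀ z, |D.indicator φ z| ≤ c := by
  obtain ⟨c, hc⟩ := hD.isCompact_closure.exists_bound_of_continuousOn hφ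
  refine ⟨max c 0, ?_, fun z => ?_⟩
  · classical
    rw [← Set.piecewise_eq_indicator]
    exact (hφ.mono subset_closure).measurable_piecewise continuousOn_const hDo.measurableSet
  · by_cases hz : z ∈ D
    · rw [Set.indicator_of_mem hz]
      exact (hc z (subset_closure hz)).trans (le_max_left _ _)
    · simp [Set.indicator_of_notMem hz]

lemma GFF.integral_indicator_approxMeasure {Ω : Type*} [MeasurableSpace Ω] {P : Measure Ω}
    (h : GFF D P) (hDo : IsOpen D) (γ ε : ℝ) (φ : ℂ → ℝ) (ω : Ω) :
    ∫ z, D.indicator φ z ∂(h.approxMeasure γ ε ω) = ∫ z, φ z ∂(h.approxMeasure γ ε ω) := by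
  refine integral_congr_ae ?_
  have h1 : ∀ᵐ z ∂(h.approxMeasure γ ε ω), z ∈ D := by
    rw [h.approxMeasure_eq]
    exact (withDensity_absolutelyContinuous _ _).ae_le (ae_restrict_mem hDo.measurableSet)
  exact h1.mono fun z hz => Set.indicator_of_mem hz φ

end Liouville
end

/-! ### Weak limits of measures and their measurable choice -/

noncomputable section

namespace Liouville

section WeakLimits

variable {X : Type*} [MetricSpace X] [CompactSpace X] [MeasurableSpace X] [BorelSpace X]

lemma integrable_continuousMap (m : Measure X) [IsFiniteMeasure m] (f : C(X, ℝ)) :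
    Integrable f m :=
  Integrable.of_bound f.continuous.aestronglyMeasurable ‖f‖
    (Eventually.of_forall fun x => f.norm_coe_le_norm x)

lemma abs_integral_sub_le (m : Measure X) [IsFiniteMeasure m] (f g : C(X, ℝ)) :
    |∫ x, f x ∂m - ∫ x, g x ∂m| ≤ ‖f - g‖ * m.real Set.univ := by
  rw [← integral_sub (integrable_continuousMap m f) (integrable_continuousMap m g)]
  exact norm_integral_le_of_norm_le_const
    (Eventually.of_forall fun x => (f - g).norm_coe_le_norm x)

/-- The dense set contains some `g` within 1/2 of the constant 1. The integral of `g` is then at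
least half the total mass, and a convergent sequence is bounded. -/
lemma exists_bound_measureReal_univ (m : ℕ → Measure X) [∀ k, IsFiniteMeasure (m k)]
    {S : Set C(X, ℝ)} (hS : Dense S)
    (h : ∀ f ∈ S, ∃ c, Tendsto (fun k => ∫ x, f x ∂(m k)) atTop (𝓝 c)) :
    ∃ M, 0 < M ∧ ∀ k, (m k).real Set.univ ≤ M := by
  obtain ⟨g, hg, hgS⟩ := Metric.dense_iff.1 hS 1 (1 / 2) (by norm_num)
  rw [Metric.mem_ball, dist_eq_norm] at hg
  obtain ⟨c, hc⟩ := h g hgS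
  obtain ⟨M, hM⟩ := hc.bddAbove_range
  refine ⟨max (2 * M) 1, by positivity, fun k => le_max_of_le_left ?_⟩
  have h1 := abs_integral_sub_le (m k) g 1
  have h2 := hM ⟨k, rfl⟩
  have h3 : ∫ x, (1 : C(X, ℝ)) x ∂(m k) = (m k).real Set.univ := by simp
  rw [h3] at h1
  have h4 := (abs_le.1 h1).1
  have h5 : ‖g - 1‖ * (m k).real Set.univ ≤ 1 / 2 * (m k).real Set.univ := by gcongr
  simp only at h2
  linarith

/-- Finite measures on a compact space whose integrals converge on a dense set of continuous
functions converge weakly. -/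
lemma exists_weak_limit (m : ℕ → Measure X) [∀ k, IsFiniteMeasure (m k)]
    {S : Set C(X, ℝ)} (hS : Dense S)
    (h : ∀ f ∈ S, ∃ c, Tendsto (fun k => ∫ x, f x ∂(m k)) atTop (𝓝 c)) :
    ∃ μ : Measure X, IsFiniteMeasure μ ∧
      ∀ f : C(X, ℝ), Tendsto (fun k => ∫ x, f x ∂(m k)) atTop (𝓝 (∫ x, f x ∂μ)) := by
  obtain ⟨M, hM0, hM⟩ := exists_bound_measureReal_univ m hS h
  have hlim : ∀ f : C(X, ℝ), ∃ c, Tendsto (fun k => ∫ x, f x ∂(m k)) atTop (𝓝 c) := by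
    intro f
    apply cauchySeq_tendsto_of_complete
    rw [Metric.cauchySeq_iff']
    intro τ hτ
    obtain ⟨g, hg, hgS⟩ := Metric.dense_iff.1 hS f (τ / (3 * M)) (by positivity)
    rw [Metric.mem_ball, dist_eq_norm] at hg
    obtain ⟨c, hc⟩ := h g hgS
    obtain ⟨N, hN⟩ := Metric.cauchySeq_iff'.1 hc.cauchySeq (τ / 3) (by positivity)
    refine ⟨N, fun n hn => ?_⟩
    have h1 : ∀ k, |∫ x, g x ∂(m k) - ∫ x, f x ∂(m k)| ≤ τ / 3 := fun k => by
      refine (abs_integral_sub_le (m k) g f).trans ?_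
      calc _ ≤ τ / (3 * M) * M := by gcongr; exact hM k
        _ = τ / 3 := by field_simp
    have h2 := hN n hn
    rw [Real.dist_eq] at h2 ⊢
    have ha := abs_le.1 (h1 n)
    have hb := abs_le.1 (h1 N)
    have hc := abs_lt.1 h2
    rw [abs_lt]
    constructor <;> linarith [ha.1, ha.2, hb.1, hb.2, hc.1, hc.2]
  choose L hL using hlim
  -- The limits define a positive linear functional; on a compact space every continuous function
  -- has compact support, so Riesz–Markov–Kakutani represents it.
  let Λ : CompactlySupportedContinuousMap X ℝ →ₚ[ℝ] ℝ :=
  { toFun g := L g.toContinuousMap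
    map_add' g g' := by
      refine tendsto_nhds_unique (hL _) (((hL g.toContinuousMap).add
        (hL g'.toContinuousMap)).congr fun k => ?_)
      exact (integral_add (integrable_continuousMap _ g.toContinuousMap)
        (integrable_continuousMap _ g'.toContinuousMap)).symm
    map_smul' c g := by
      refine tendsto_nhds_unique (hL _) (((hL g.toContinuousMap).const_mul c).congr fun k => ?_)
      exact (integral_const_mul c _).symm
    monotone' g g' hgg' :=
      le_of_tendsto_of_tendsto' (hL g.toContinuousMap) (hL g'.toContinuousMap) fun k =>
        integral_mono (integrable_continuousMap _ g.toContinuousMap)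
          (integrable_continuousMap _ g'.toContinuousMap) hgg' }
  refine ⟨RealRMK.rieszMeasure Λ, inferInstance, fun f => ?_⟩
  let g : CompactlySupportedContinuousMap X ℝ :=
  { toFun := f
    hasCompactSupport' := HasCompactSupport.of_compactSpace _ }
  have := RealRMK.integral_rieszMeasure Λ g
  change ∫ x, f x ∂_ = L f at this
  rw [this]
  exact hL f

variable {Y : Type*} [MeasurableSpace Y]

lemma measurable_integral_continuousMap {m : Y → Measure X} (hm : Measurable m)
    [∀ y, IsFiniteMeasure (m y)] (f : C(X, ℝ)) : Measurable fun y => ∫ x, f x ∂(m y) := by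
  have h1 : ∀ y, ∫ x, f x ∂(m y) = (∫⁻ x, ENNReal.ofReal (f x) ∂(m y)).toReal -
      (∫⁻ x, ENNReal.ofReal (-f x) ∂(m y)).toReal := fun y =>
    integral_eq_lintegral_pos_part_sub_lintegral_neg_part (integrable_continuousMap _ f)
  simp_rw [h1]
  have hf := f.continuous.measurable
  exact ((Measure.measurable_lintegral hf.ennreal_ofReal).comp hm).ennreal_toReal.sub
    ((Measure.measurable_lintegral hf.neg.ennreal_ofReal).comp hm).ennreal_toReal

/-- Closed sets form a generating π-system, and the measure of a closed set is the limit of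
integrals of its thickened indicators. -/
lemma measurable_of_measurable_integral {μ : Y → Measure X} [∀ y, IsFiniteMeasure (μ y)]
    (h : ∀ f : C(X, ℝ), Measurable fun y => ∫ x, f x ∂(μ y)) : Measurable μ := by
  have hcl : ∀ F : Set X, IsClosed F → Measurable fun y => μ y F := by
    intro F hF
    have hδ : ∀ n : ℕ, (0 : ℝ) < 1 / ((n : ℝ) + 1) := fun n => by positivity
    have h1 : ∀ y, Tendsto (fun n : ℕ => ∫⁻ x, thickenedIndicator (hδ n) F x ∂(μ y)) atTop
        (𝓝 (μ y F)) := fun y =>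
      tendsto_lintegral_thickenedIndicator_of_isClosed (μ y) hF hδ
        tendsto_one_div_add_atTop_nhds_zero_nat
    refine measurable_of_tendsto_metrizable (fun n => ?_) (tendsto_pi_nhds.2 h1)
    let f : C(X, ℝ) := ⟨fun x => (thickenedIndicator (hδ n) F x : ℝ),
      NNReal.continuous_coe.comp (thickenedIndicator (hδ n) F).continuous⟩
    have h2 : ∀ y, ∫⁻ x, thickenedIndicator (hδ n) F x ∂(μ y) =
        ENNReal.ofReal (∫ x, f x ∂(μ y)) := fun y => by
      rw [ofReal_integral_eq_lintegral_ofReal (integrable_continuousMap _ f)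
        (Eventually.of_forall fun x => NNReal.coe_nonneg _)]
      exact lintegral_congr fun x => (ENNReal.ofReal_coe_nnreal).symm
    simp_rw [h2]
    exact (h f).ennreal_ofReal
  refine Measurable.measure_of_isPiSystem (S := {F | IsClosed F}) ?_ isPiSystem_isClosed hcl
    (hcl _ isClosed_univ)
  rw [← borel_eq_generateFrom_isClosed]
  exact BorelSpace.measurable_eq

/-- A measurable choice of weak limits. -/
lemma exists_measurable_weak_limit {m : ℕ → Y → Measure X} (hm : ∀ k, Measurable (m k))
    [∀ k y, IsFiniteMeasure (m k y)] {S : Set C(X, ℝ)} (hS : Dense S) (hSc : S.Countable) :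
    ∃ μ : Y → Measure X, Measurable μ ∧ (∀ y, IsFiniteMeasure (μ y)) ∧ ∀ y,
      (∀ f ∈ S, ∃ c, Tendsto (fun k => ∫ x, f x ∂(m k y)) atTop (𝓝 c)) →
      ∀ f : C(X, ℝ), Tendsto (fun k => ∫ x, f x ∂(m k y)) atTop (𝓝 (∫ x, f x ∂(μ y))) := by
  classical
  set G : Set Y := {y | ∀ f ∈ S, ∃ c, Tendsto (fun k => ∫ x, f x ∂(m k y)) atTop (𝓝 c)} with hG
  have hGm : MeasurableSet G := by
    have : G = ⋂ f ∈ S, {y | ∃ c, Tendsto (fun k => ∫ x, f x ∂(m k y)) atTop (𝓝 c)} := by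
      ext; simp [hG]
    rw [this]
    exact MeasurableSet.biInter hSc fun f _ => measurableSet_exists_tendsto fun k =>
      measurable_integral_continuousMap (hm k) f
  -- The value 0 off the measurable set `G` makes every integral against the chosen limit a
  -- pointwise limit of measurable functions.
  have hex : ∀ y, ∃ ν : Measure X, IsFiniteMeasure ν ∧ (y ∉ G → ν = 0) ∧ (y ∈ G →
      ∀ f : C(X, ℝ), Tendsto (fun k => ∫ x, f x ∂(m k y)) atTop (𝓝 (∫ x, f x ∂ν))) := by
    intro y
    by_cases hy : y ∈ G
    · obtain ⟨ν, h1, h2⟩ := exists_weak_limit (fun k => m k y) hS hy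
      exact ⟨ν, h1, fun h => absurd hy h, fun _ => h2⟩
    · exact ⟨0, inferInstance, fun _ => rfl, fun h => absurd h hy⟩
  choose μ hfin hμ0 hμ using hex
  refine ⟨μ, ?_, hfin, fun y hy => hμ y hy⟩
  refine measurable_of_measurable_integral fun f => ?_
  refine measurable_of_tendsto_metrizable
    (f := fun k y => G.indicator (fun y => ∫ x, f x ∂(m k y)) y)
    (fun k => (measurable_integral_continuousMap (hm k) f).indicator hGm)
    (tendsto_pi_nhds.2 fun y => ?_)
  by_cases hy : y ∈ G
  · simpa [hy] using hμ y hy f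
  · simp [hy, hμ0 y hy]

end WeakLimits

/-- A measurable choice of weak limits for measures on the plane carried by a compact set. -/
lemma exists_measurable_weak_limit_of_isCompact {K : Set ℂ} (hK : IsCompact K) :
    ∃ Φ : ℕ → ℂ → ℝ, (∀ j, ContinuousOn (Φ j) K) ∧
    ∀ (Y : Type) [MeasurableSpace Y] (m : ℕ → Y → Measure ℂ), (∀ k, Measurable (m k)) →
    (∀ k y, m k y Kᶜ = 0) →
    ∃ μ : Y → Measure ℂ, Measurable μ ∧ (∀ y, IsFiniteMeasure (μ y)) ∧ (∀ y, μ y Kᶜ = 0) ∧ ∀ y,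
      (∀ k, IsFiniteMeasure (m k y)) →
      (∀ j, ∃ c, Tendsto (fun k => ∫ x, Φ j x ∂(m k y)) atTop (𝓝 c)) →
      ∀ φ : ℂ → ℝ, ContinuousOn φ K →
        Tendsto (fun k => ∫ x, φ x ∂(m k y)) atTop (𝓝 (∫ x, φ x ∂(μ y))) := by
  classical
  have : CompactSpace K := isCompact_iff_compactSpace.mp hK
  -- The dense family depends on `K` alone and is fixed before the measures, since the sequence of
  -- radii is selected afterwards with respect to it.
  let F : ℕ → C(K, ℝ) := TopologicalSpace.denseSeq C(K, ℝ)
  have hF : Dense (Set.range F) := TopologicalSpace.denseRange_denseSeq _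
  let Φ : ℕ → ℂ → ℝ := fun j x => if hx : x ∈ K then F j ⟨x, hx⟩ else 0
  have hΦ : ∀ j (x : K), Φ j x = F j x := fun j x => by simp [Φ]
  have hint : ∀ (ν : Measure ℂ), ν Kᶜ = 0 → ∀ φ : ℂ → ℝ,
      ∫ x, φ x ∂ν = ∫ x : K, φ x ∂(ν.comap Subtype.val) := by
    intro ν hν φ
    rw [integral_subtype_comap hK.measurableSet φ, Measure.restrict_eq_self_of_ae_mem]
    exact hν
  refine ⟨Φ, fun j => ?_, fun Y _ m hm hmK => ?_⟩
  · rw [continuousOn_iff_continuous_domRestrict]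
    convert (F j).continuous using 1
    ext x
    exact hΦ j x
  set G : Set Y := {y | ∀ k, m k y Set.univ ≠ ⊤} with hG
  have hGm : MeasurableSet G := by
    have : G = ⋂ k, {y | m k y Set.univ ≠ ⊤} := by ext; simp [hG]
    rw [this]
    exact MeasurableSet.iInter fun k =>
      (Measure.measurable_coe MeasurableSet.univ |>.comp (hm k)) (measurableSet_singleton _).compl
  have hcomap : Measurable fun ν : Measure ℂ => (ν.comap Subtype.val : Measure K) := by
    refine Measure.measurable_of_measurable_coe _ fun s hs => ?_
    have : ∀ ν : Measure ℂ, (ν.comap Subtype.val : Measure K) s = ν (Subtype.val '' s) := fun ν =>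
      (MeasurableEmbedding.subtype_coe hK.measurableSet).comap_apply ν s
    simp_rw [this]
    exact Measure.measurable_coe
      ((MeasurableEmbedding.subtype_coe hK.measurableSet).measurableSet_image.2 hs)
  -- The measures are finite only for almost every coefficient sequence; parameters with an infinite
  -- one are given the zero measure.
  let m' : ℕ → Y → Measure K := fun k y => if y ∈ G then (m k y).comap Subtype.val else 0
  have hm' : ∀ k, Measurable (m' k) := fun k =>
    Measurable.ite hGm (hcomap.comp (hm k)) measurable_const
  have hfin : ∀ k y, IsFiniteMeasure (m' k y) := by
    intro k y
    by_cases hy : y ∈ G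
    · simp only [m', hy, if_true]
      refine ⟨?_⟩
      rw [(MeasurableEmbedding.subtype_coe hK.measurableSet).comap_apply]
      exact (measure_mono (Set.subset_univ _)).trans_lt (hy k).lt_top
    · simp only [m', hy, if_false]
      infer_instance
  obtain ⟨μ, hμ, hμf, hμl⟩ := exists_measurable_weak_limit hm' hF (Set.countable_range F)
  refine ⟨fun y => (μ y).map Subtype.val, (Measure.measurable_map _ measurable_subtype_coe).comp hμ,
    fun y => inferInstance, fun y => ?_, fun y hy hc φ hφ => ?_⟩
  · rw [Measure.map_apply measurable_subtype_coe hK.measurableSet.compl]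
    simp
  have hyG : y ∈ G := fun k => by have := hy k; exact measure_ne_top _ _
  have hm'y : ∀ k, m' k y = (m k y).comap Subtype.val := fun k => by simp [m', hyG]
  have h1 := hμl y (by
    rintro _ ⟨j, rfl⟩
    obtain ⟨c, hcj⟩ := hc j
    refine ⟨c, hcj.congr fun k => ?_⟩
    rw [hint _ (hmK k y), hm'y]
    simp_rw [hΦ]) ⟨K.domRestrict φ, continuousOn_iff_continuous_domRestrict.1 hφ⟩
  rw [hint ((μ y).map Subtype.val), (MeasurableEmbedding.subtype_coe hK.measurableSet).comap_map]
  · refine h1.congr fun k => ?_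
    rw [hint _ (hmK k y), hm'y]
    rfl
  · rw [Measure.map_apply measurable_subtype_coe hK.measurableSet.compl]
    simp

end Liouville
end

/-! ### Recovering the coefficients from the distribution h, and choosing the radii -/

noncomputable section

namespace Liouville

variable {D : Set ℂ}

namespace TestSpace

/-- The derivative of a test function in the direction `v`. -/
def lineDeriv (v : ℂ) (f : TestSpace D) : TestSpace D :=
  TestSpace.mk (fun x => fderiv ℝ f.fn x v)
    ((f.contDiff.fderiv_right (m := (⊤ : ℕ∞)) (by exact_mod_cast le_top)).clm_apply contDiff_const)
    ((f.2.2.1.fderiv (𝕜 := ℝ)).comp_left (g := fun L : ℂ →L[ℝ] ℝ => L v) rfl)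
    ((closure_mono fun x hx => by
      have : fderiv ℝ f.fn x ≠ 0 := fun h => hx (by simp [h])
      exact this).trans ((tsupport_fderiv_subset ℝ).trans f.2.2.2))

lemma fn_lineDeriv (v : ℂ) (f : TestSpace D) (x : ℂ) :
    (f.lineDeriv v).fn x = fderiv ℝ f.fn x v := rfl

lemma continuous_fn (f : TestSpace D) : Continuous f.fn := f.contDiff.continuous

lemma differentiable_fn (f : TestSpace D) : Differentiable ℝ f.fn :=
  f.contDiff.differentiable (by simp)

lemma integrable_mul (f g : TestSpace D) : Integrable fun x => f.fn x * g.fn x :=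
  (f.continuous_fn.mul g.continuous_fn).integrable_of_hasCompactSupport
    (HasCompactSupport.mul_right (f := f.fn) (f' := g.fn) f.2.2.1)

lemma integral_mul_lineDeriv (f g : TestSpace D) (v : ℂ) :
    ∫ x, f.fn x * (g.lineDeriv v).fn x = -∫ x, (f.lineDeriv v).fn x * g.fn x :=
  integral_mul_fderiv_eq_neg_fderiv_mul_of_integrable ((f.lineDeriv v).integrable_mul g)
    (f.integrable_mul (g.lineDeriv v)) (f.integrable_mul g)
    (fun x _ => f.differentiable_fn x) fun x _ => g.differentiable_fn x

lemma inner_gradient (f g : TestSpace D) (x : ℂ) :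
    inner ℝ (gradient f.fn x) (gradient g.fn x) =
      (f.lineDeriv 1).fn x * (g.lineDeriv 1).fn x +
        (f.lineDeriv Complex.I).fn x * (g.lineDeriv Complex.I).fn x := by
  simp only [fn_lineDeriv, ← inner_gradient_right, Complex.inner]
  simp
  ring

/-- The charge `-(2π)⁻¹ Δ u` of a test function `u`. -/
def charge (u : TestSpace D) : TestSpace D :=
  (-(2 * Real.pi)⁻¹ : ℝ) • ((u.lineDeriv 1).lineDeriv 1 +
    (u.lineDeriv Complex.I).lineDeriv Complex.I)

lemma fn_charge (u : TestSpace D) (x : ℂ) : u.charge.fn x =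
    -(2 * Real.pi)⁻¹ * (((u.lineDeriv 1).lineDeriv 1).fn x +
      ((u.lineDeriv Complex.I).lineDeriv Complex.I).fn x) := rfl

lemma inner_toH10_eq_integral_charge (u f : TestSpace D) :
    inner ℝ u.toH10 f.toH10 = ∫ x, f.fn x * u.charge.fn x := by
  rw [inner_toH10, inner_eq, dirichletForm]
  simp_rw [inner_gradient, fn_charge]
  rw [integral_add ((u.lineDeriv 1).integrable_mul (f.lineDeriv 1))
    ((u.lineDeriv Complex.I).integrable_mul (f.lineDeriv Complex.I))]
  have h1 : ∀ v : ℂ, ∫ x, (u.lineDeriv v).fn x * (f.lineDeriv v).fn x =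
      -∫ x, f.fn x * ((u.lineDeriv v).lineDeriv v).fn x := fun v => by
    rw [integral_mul_lineDeriv f (u.lineDeriv v) v, neg_neg]
    exact integral_congr_ae (Eventually.of_forall fun x => mul_comm _ _)
  rw [h1, h1]
  have h2 : ∀ x, f.fn x * (-(2 * Real.pi)⁻¹ * (((u.lineDeriv 1).lineDeriv 1).fn x +
      ((u.lineDeriv Complex.I).lineDeriv Complex.I).fn x)) = -(2 * Real.pi)⁻¹ *
      (f.fn x * ((u.lineDeriv 1).lineDeriv 1).fn x +
        f.fn x * ((u.lineDeriv Complex.I).lineDeriv Complex.I).fn x) := fun x => by ring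
  simp_rw [h2]
  rw [integral_const_mul, integral_add (f.integrable_mul _) (f.integrable_mul _)]
  ring

end TestSpace

lemma measurable_limUnder {Ω : Type*} {mΩ : MeasurableSpace Ω} {f : ℕ → Ω → ℝ}
    (hf : ∀ k, Measurable (f k)) : Measurable fun ω => limUnder atTop fun k => f k ω :=
  (StronglyMeasurable.limUnder fun k => (hf k).stronglyMeasurable).measurable

namespace GFF

variable {Ω : Type*} [MeasurableSpace Ω] {P : Measure Ω}

/-- Integration by parts shows that `u` is the potential of its own charge, so pairings with test
functions are among the variables generating `sigma`. -/
lemma test_charge (h : GFF D P) (u : TestSpace D) : h.test u.charge = h.pairing u.toH10 := by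
  ext ω
  rw [test, potential_eq u.inner_toH10_eq_integral_charge]

lemma pairing_basis (h : GFF D P) (n : ℕ) (ω : Ω) : h.pairing (h.basis n) ω = h.coeff n ω := by
  refine Tendsto.limUnder_eq (tendsto_const_nhds.congr' ?_)
  filter_upwards [eventually_gt_atTop n] with N hN
  rw [Finset.sum_eq_single n]
  · simp [h.basis.repr_self]
  · intro k _ hk
    simp [h.basis.repr_self, lp.single_apply, hk]
  · intro hn
    simp [hN] at hn

lemma memLp_pairing (h : GFF D P) (f : H10 D) : MemLp (h.pairing f) 2 P := by
  have h1 := memLp_id_gaussianReal' (μ := 0) (v := ‖f‖₊ ^ 2) 2 (by simp)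
  rw [← h.map_pairing f] at h1
  exact h1.comp_of_map (h.measurable_pairing f).aemeasurable

lemma integral_pairing_sq (h : GFF D P) (f : H10 D) : ∫ ω, h.pairing f ω ^ 2 ∂P = ‖f‖ ^ 2 := by
  have h2 : ∫ x, x ^ 2 ∂(P.map (h.pairing f)) = ‖f‖ ^ 2 := by
    rw [h.map_pairing]
    have h3 := variance_fun_id_gaussianReal (μ := 0) (v := ‖f‖₊ ^ 2)
    rw [variance_of_integral_eq_zero (by fun_prop) (by simp)] at h3
    simpa using h3
  rwa [integral_map (h.measurable_pairing f).aemeasurable (by fun_prop)] at h2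

lemma eLpNorm_pairing (h : GFF D P) (f : H10 D) : eLpNorm (h.pairing f) 2 P = ‖f‖ₑ := by
  have h3 : ∀ ω, ‖h.pairing f ω‖ₑ ^ 2 = ENNReal.ofReal (h.pairing f ω ^ 2) := fun ω => by
    rw [← sq_abs, ENNReal.ofReal_pow (abs_nonneg _), ← Real.norm_eq_abs, ofReal_norm]
  have h4 : eLpNorm (h.pairing f) 2 P ^ 2 = ‖f‖ₑ ^ 2 := by
    rw [eLpNorm_two_sq]
    simp_rw [h3]
    rw [← ofReal_integral_eq_lintegral_ofReal (h.memLp_pairing f).integrable_sq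
      (Eventually.of_forall fun ω => sq_nonneg _), h.integral_pairing_sq,
      ENNReal.ofReal_pow (norm_nonneg _), ofReal_norm]
  exact (ENNReal.pow_right_strictMono two_ne_zero).injective h4

/-- Every pairing is almost surely a limit of pairings with test functions. -/
lemma exists_ae_tendsto_pairing_toH10 (h : GFF D P) (f : H10 D) :
    ∃ u : ℕ → TestSpace D, Tendsto (fun k => (u k).toH10) atTop (𝓝 f) ∧
      ∀ᵐ ω ∂P, Tendsto (fun k => h.pairing (u k).toH10 ω) atTop (𝓝 (h.pairing f ω)) := by
  obtain ⟨x, hx, hxt⟩ := mem_closure_iff_seq_limit.1 (denseRange_toH10 (D := D) f)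
  choose u hu using hx
  obtain rfl : (fun k => (u k).toH10) = x := funext hu
  -- The pairing is an isometry into L², so approximation in H¹₀(D) gives convergence in probability
  -- and then almost surely along a subsequence.
  have h1 : TendstoInMeasure P (fun k => h.pairing (u k).toH10) atTop (h.pairing f) := by
    refine tendstoInMeasure_of_tendsto_eLpNorm (p := 2) (by norm_num)
      (fun k => (h.measurable_pairing _).aestronglyMeasurable)
      (h.measurable_pairing _).aestronglyMeasurable ?_
    have h2 : ∀ k, eLpNorm (h.pairing (u k).toH10 - h.pairing f) 2 P = ‖(u k).toH10 - f‖ₑ := by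
      intro k
      rw [← h.eLpNorm_pairing]
      refine eLpNorm_congr_ae ?_
      filter_upwards [h.ae_pairing_add ((u k).toH10 - f) f] with ω hω
      rw [sub_add_cancel] at hω
      rw [Pi.sub_apply, hω, add_sub_cancel_right]
    simp_rw [h2]
    have h3 := (hxt.sub_const f).enorm
    simpa using h3
  obtain ⟨ns, hns, hae⟩ := h1.exists_seq_tendsto_ae
  exact ⟨fun k => u (ns k), hxt.comp hns.tendsto_atTop, hae⟩

/-- The coefficients are functions of the random distribution. -/
lemma exists_measurable_sigma_coeff (h : GFF D P) :
    ∃ a : ℕ → Ω → ℝ, (∀ n, Measurable[h.sigma] (a n)) ∧ ∀ᵐ ω ∂P, ∀ n, a n ω = h.coeff n ω := by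
  choose u _ hu using fun n => h.exists_ae_tendsto_pairing_toH10 (h.basis n)
  -- The σ-algebra is not completed. Taking `limUnder` of the tests gives versions that are
  -- measurable for it everywhere and equal to the coefficients almost surely.
  refine ⟨fun n ω => limUnder atTop fun k => h.test (u n k).charge ω, fun n => ?_, ?_⟩
  · refine measurable_limUnder (mΩ := h.sigma) fun k => ?_
    exact measurable_iff_comap_le.2
      (le_iSup (fun ρ => MeasurableSpace.comap (h.test ρ) inferInstance) (u n k).charge)
  · filter_upwards [ae_all_iff.2 hu] with ω hω n
    simp_rw [test_charge]
    rw [← h.pairing_basis]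
    exact (hω n).limUnder_eq

/-- A sequence of radii along which the integrals of countably many functions converge. -/
lemma exists_seq_ae_tendsto_integral (h : GFF D P) (hDo : IsOpen D) (hD : Bornology.IsBounded D)
    {γ : ℝ} (hγ : γ ^ 2 < 2) {Φ : ℕ → ℂ → ℝ} (hΦ : ∀ j, ContinuousOn (Φ j) (closure D)) :
    ∃ ε : ℕ → ℝ, (∀ k, 0 < ε k) ∧ StrictAnti ε ∧ Tendsto ε atTop (𝓝 0) ∧
      ∀ᵐ ω ∂P, ∀ j, ∃ c, Tendsto (fun k => ∫ z, Φ j z ∂(h.approxMeasure γ (ε k) ω)) atTop (𝓝 c) := by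
  choose c hm hc using fun j => exists_measurable_bounded_eqOn hDo hD (hΦ j)
  have hτ : ∀ k : ℕ, ((1 : ℝ≥0∞) / 2) ^ (k + 1) ≠ 0 := fun k => by simp
  choose θ hθ hθle using fun j k => h.exists_eLpNorm_integral_sub_le hDo hD hγ (hm j) (hc j) (hτ k)
  simp_rw [h.integral_indicator_approxMeasure hDo] at hθle
  -- Diagonal choice: from the k-th radius on, the first k + 1 functions have L² increments at most
  -- 2^{-(k+1)}.
  obtain ⟨φ, hφ, hφθ⟩ := extraction_forall_of_eventually
    (P := fun k n => ∀ j ∈ Finset.range (k + 1), 1 / ((n : ℝ) + 1) < θ j k) fun k => by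
      rw [Filter.eventually_all_finset]
      exact fun j _ => tendsto_one_div_add_atTop_nhds_zero_nat.eventually_lt_const (hθ j k)
  have hpos : ∀ k, 0 < 1 / ((φ k : ℝ) + 1) := fun k => by positivity
  have hanti : StrictAnti fun k => 1 / ((φ k : ℝ) + 1) := fun m n hmn =>
    one_div_lt_one_div_of_lt (by positivity) (by have := hφ hmn; gcongr)
  refine ⟨fun k => 1 / ((φ k : ℝ) + 1), hpos, hanti,
    tendsto_one_div_add_atTop_nhds_zero_nat.comp hφ.tendsto_atTop, ?_⟩
  rw [ae_all_iff]
  intro j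
  set f : ℕ → Ω → ℝ := fun k ω => ∫ z, Φ j z ∂(h.approxMeasure γ (1 / ((φ k : ℝ) + 1)) ω) with hf
  have hfm : ∀ k, AEStronglyMeasurable (f k) P := fun k => by
    have := (h.memLp_integral_approxMeasure hDo hD γ (hpos k) (hm j) (hc j)).1
    simp_rw [h.integral_indicator_approxMeasure hDo] at this
    exact this
  -- The function of index `j` is controlled only from step `j` on, hence the shift. The bounds
  -- 2^{-N} are summable, which upgrades L² convergence to almost sure convergence.
  have h1 : ∀ᵐ ω ∂P, ∃ l, Tendsto (fun n => f (n + j) ω) atTop (𝓝 l) := by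
    refine Lp.ae_tendsto_of_cauchy_eLpNorm (f := fun n => f (n + j)) (p := 2) (fun n => hfm _)
      (by norm_num) (B := fun N => (1 / 2) ^ N) ?_ fun N n m hn hmm => ?_
    · rw [ENNReal.tsum_geometric]
      simp
    · have hb : ∀ n, N ≤ n → 1 / ((φ (n + j) : ℝ) + 1) < θ j (N + j) := fun n hn =>
        (hanti.antitone (by omega : N + j ≤ n + j)).trans_lt (hφθ (N + j) j (by simp))
      refine (hθle j (N + j) _ _ (hpos _) (hb n hn) (hpos _) (hb m hmm)).trans_lt ?_
      have h2 : ((1 : ℝ≥0∞) / 2) ^ (N + j + 1) ≤ (1 / 2) ^ (N + 1) :=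
        pow_le_pow_of_le_one bot_le (by simp) (by omega)
      refine h2.trans_lt ?_
      rw [pow_succ, one_div, ← div_eq_mul_inv]
      exact ENNReal.half_lt_self (by simp) (by simp)
  filter_upwards [h1] with ω ⟨l, hl⟩
  exact ⟨l, (tendsto_add_atTop_iff_nat j).1 hl⟩

end GFF

end Liouville
end

/-! ### The limit measure as a function of the coefficients -/

noncomputable section

namespace Liouville

variable {D : Set ℂ}

/-- The density of the approximating measure as a function of the coefficients. -/
def seriesDensity (b : HilbertBasis ℕ ℝ (H10 D)) (γ ε : ℝ) (a : ℕ → ℝ) (z : ℂ) : ℝ≥0∞ :=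
  ENNReal.ofReal (expWeight γ ε (seriesField b ε a z))

lemma seriesDensity_def (b : HilbertBasis ℕ ℝ (H10 D)) (γ ε : ℝ) (a : ℕ → ℝ) (z : ℂ) :
    seriesDensity b γ ε a z = ENNReal.ofReal (expWeight γ ε (seriesField b ε a z)) := rfl

lemma measurable_seriesDensity (hD : Bornology.IsBounded D) (b : HilbertBasis ℕ ℝ (H10 D)) (γ : ℝ)
    {ε : ℝ} (hε : 0 < ε) : Measurable fun p : (ℕ → ℝ) × ℂ => seriesDensity b γ ε p.1 p.2 := by
  have := ((measurable_expWeight γ ε).comp (measurable_seriesField hD b hε)).ennreal_ofReal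
  simpa only [Function.comp_def, ← seriesDensity_def] using this

/-- The approximating measure as a function of the coefficients. -/
def seriesMeasure (b : HilbertBasis ℕ ℝ (H10 D)) (γ ε : ℝ) (a : ℕ → ℝ) : Measure ℂ :=
  (volume.restrict D).withDensity (seriesDensity b γ ε a)

lemma measurable_seriesMeasure (hD : Bornology.IsBounded D) (b : HilbertBasis ℕ ℝ (H10 D)) (γ : ℝ)
    {ε : ℝ} (hε : 0 < ε) : Measurable (seriesMeasure b γ ε) := by
  refine Measure.measurable_of_measurable_coe _ fun s hs => ?_
  simp_rw [seriesMeasure, withDensity_apply _ hs]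
  exact Measurable.lintegral_prod_right' (f := fun p : (ℕ → ℝ) × ℂ => seriesDensity b γ ε p.1 p.2)
    (measurable_seriesDensity hD b γ hε)

lemma seriesMeasure_compl_closure (hDo : IsOpen D) (b : HilbertBasis ℕ ℝ (H10 D)) (γ ε : ℝ)
    (a : ℕ → ℝ) : seriesMeasure b γ ε a (closure D)ᶜ = 0 := by
  refine withDensity_absolutelyContinuous _ _ ?_
  rw [Measure.restrict_apply' hDo.measurableSet]
  refine measure_mono_null (t := ∅) (fun z hz => hz.1 (subset_closure hz.2)) measure_empty

/-- The Liouville measure as a weak limit of the approximating measures. -/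
lemma GFF.exists_limit_measure {Ω : Type*} [MeasurableSpace Ω] {P : Measure Ω} (h : GFF D P)
    (hDo : IsOpen D) (hD : Bornology.IsBounded D) {γ : ℝ} (hγ : γ ^ 2 < 2) :
    ∃ ε : ℕ → ℝ, (∀ k, 0 < ε k) ∧ StrictAnti ε ∧ Tendsto ε atTop (𝓝 0) ∧
      ∃ μ : Ω → Measure ℂ, (∀ ω, IsFiniteMeasure (μ ω)) ∧ (∀ ω, μ ω (closure D)ᶜ = 0) ∧
        Measurable[h.sigma] μ ∧
        ∀ᵐ ω ∂P, ∀ φ : ℂ → ℝ, ContinuousOn φ (closure D) →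
          Tendsto (fun k => ∫ z, φ z ∂(h.approxMeasure γ (ε k) ω)) atTop
            (𝓝 (∫ z, φ z ∂(μ ω))) := by
  obtain ⟨Φ, hΦ, hlim⟩ := exists_measurable_weak_limit_of_isCompact hD.isCompact_closure
  obtain ⟨ε, hε, hanti, hε0, hae⟩ := h.exists_seq_ae_tendsto_integral hDo hD hγ hΦ
  obtain ⟨a, ham, haeq⟩ := h.exists_measurable_sigma_coeff
  obtain ⟨μ, hμm, hμf, hμ0, hμ⟩ := hlim (ℕ → ℝ) (fun k => seriesMeasure h.basis γ (ε k))
    (fun k => measurable_seriesMeasure hD h.basis γ (hε k))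
    (fun k => seriesMeasure_compl_closure hDo h.basis γ (ε k))
  -- The limit is a Borel function of the coefficient sequence, evaluated at the version `a` that is
  -- measurable with respect to the distribution.
  refine ⟨ε, hε, hanti, hε0, fun ω => μ fun n => a n ω, fun ω => hμf _, fun ω => hμ0 _, ?_, ?_⟩
  · exact @Measurable.comp _ _ _ h.sigma _ _ _ _ hμm (@measurable_pi_lambda _ _ _ h.sigma _ _ ham)
  · filter_upwards [hae, haeq, ae_all_iff.2 fun k => h.ae_isFiniteMeasure hDo hD γ (hε k)]
      with ω h1 h2 h3
    have h4 : (fun n => a n ω) = fun n => h.coeff n ω := funext h2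
    rw [h4]
    exact hμ (fun n => h.coeff n ω) h3 h1

end Liouville
end

/-! ### Cameron–Martin shifts and the extinction event -/

noncomputable section

namespace Liouville

variable {D : Set ℂ}

/-- The pairing is a circle average, hence bounded by the supremum of `f` for all centres and radii.
General elements of H¹₀(D) have no such bound, so only shifts by test functions are used. -/
lemma exists_abs_inner_greenReg_le (hD : Bornology.IsBounded D) (f : TestSpace D) :
    ∃ C, 0 ≤ C ∧ ∀ z ε, 0 < ε → |inner ℝ (greenReg D z ε) f.toH10| ≤ C := by
  obtain ⟨C, hC⟩ := f.continuous_fn.bounded_above_of_compact_support f.2.2.1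
  refine ⟨C, (norm_nonneg _).trans (hC 0), fun z ε hε => ?_⟩
  rw [inner_greenReg_toH10 hD z hε]
  refine Real.abs_circleAverage_le_circleAverage_abs.trans ?_
  refine Real.circleAverage_mono_on_of_le_circle ?_ fun x _ => hC x
  exact f.continuous_fn.abs.continuousOn.circleIntegrable'

/-- The default limit is chosen from the predicate of being a limit, which is identically false for
both sequences. The shift inequality thereby holds for every coefficient sequence, without
exceptional sets. -/
lemma limUnder_eq_of_not_tendsto {u v : ℕ → ℝ} (hu : ¬∃ x, Tendsto u atTop (𝓝 x))
    (hv : ¬∃ x, Tendsto v atTop (𝓝 x)) : limUnder atTop u = limUnder atTop v := by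
  have h : (fun x => map u atTop ≤ 𝓝 x) = fun x => map v atTop ≤ 𝓝 x := by
    ext x
    exact ⟨fun h => absurd ⟨x, h⟩ hu, fun h => absurd ⟨x, h⟩ hv⟩
  unfold limUnder lim
  simp only [h]

/-- The effect of a Cameron–Martin shift of the coefficients. -/
lemma seriesField_add_smul_le (b : HilbertBasis ℕ ℝ (H10 D)) (ε : ℝ) (a : ℕ → ℝ) (s : ℝ)
    (F : H10 D) (z : ℂ) :
    seriesField b ε (fun n => a n + s * b.repr F n) z ≤
      seriesField b ε a z + |s| * |inner ℝ (greenReg D z ε) F| := by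
  set S : ℕ → ℝ := fun N => ∑ n ∈ Finset.range N, a n * b.repr (greenReg D z ε) n with hS
  set T : ℕ → ℝ := fun N => ∑ n ∈ Finset.range N, b.repr F n * b.repr (greenReg D z ε) n with hT
  set S' : ℕ → ℝ := fun N => ∑ n ∈ Finset.range N,
    (a n + s * b.repr F n) * b.repr (greenReg D z ε) n with hS'
  have hTlim : Tendsto T atTop (𝓝 (inner ℝ (greenReg D z ε) F)) := by
    refine ((b.hasSum_inner_mul_inner (greenReg D z ε) F).tendsto_sum_nat).congr fun N => ?_
    refine Finset.sum_congr rfl fun n _ => ?_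
    rw [b.repr_apply_apply, b.repr_apply_apply, real_inner_comm, mul_comm]
  have hsum : ∀ N, S' N = S N + s * T N := fun N => by
    simp only [hS, hT, hS', Finset.mul_sum, ← Finset.sum_add_distrib]
    exact Finset.sum_congr rfl fun n _ => by ring
  change limUnder atTop S' ≤ limUnder atTop S + _
  by_cases h : ∃ x, Tendsto S atTop (𝓝 x)
  · obtain ⟨x, hx⟩ := h
    have h1 : Tendsto S' atTop (𝓝 (x + s * inner ℝ (greenReg D z ε) F)) :=
      (hx.add (hTlim.const_mul s)).congr fun N => (hsum N).symm
    rw [h1.limUnder_eq, hx.limUnder_eq, ← abs_mul]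
    gcongr
    exact le_abs_self _
  · have h' : ¬∃ x, Tendsto S' atTop (𝓝 x) := by
      rintro ⟨x, hx⟩
      refine h ⟨x - s * inner ℝ (greenReg D z ε) F, (hx.sub (hTlim.const_mul s)).congr fun N => ?_⟩
      rw [hsum]; ring
    rw [limUnder_eq_of_not_tendsto h' h]
    have : 0 ≤ |s| * |inner ℝ (greenReg D z ε) F| := by positivity
    linarith

/-- The integral of `φ` for the approximating measure as a function of the coefficients. -/
def seriesMass (b : HilbertBasis ℕ ℝ (H10 D)) (γ ε : ℝ) (φ : ℂ → ℝ≥0∞) (a : ℕ → ℝ) : ℝ≥0∞ :=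
  ∫⁻ z in D, φ z * seriesDensity b γ ε a z

lemma measurable_seriesMass (hD : Bornology.IsBounded D) (b : HilbertBasis ℕ ℝ (H10 D)) (γ : ℝ)
    {ε : ℝ} (hε : 0 < ε) {φ : ℂ → ℝ≥0∞} (hφ : Measurable φ) : Measurable (seriesMass b γ ε φ) :=
  Measurable.lintegral_prod_right'
    (f := fun p : (ℕ → ℝ) × ℂ => φ p.2 * seriesDensity b γ ε p.1 p.2)
    ((hφ.comp measurable_snd).mul (measurable_seriesDensity hD b γ hε))

/-- A shift by `s f` moves the circle averages by at most |s| sup |f|, so the densities grow by a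
factor independent of ε, and convergence of the masses to 0 is preserved. -/
lemma exists_seriesMass_add_smul_le (hD : Bornology.IsBounded D) (b : HilbertBasis ℕ ℝ (H10 D))
    {γ : ℝ} (hγ : 0 ≤ γ) (φ : ℂ → ℝ≥0∞) (f : TestSpace D) (s : ℝ) :
    ∃ C : ℝ≥0∞, C ≠ ⊤ ∧ ∀ ε, 0 < ε → ∀ a : ℕ → ℝ,
      seriesMass b γ ε φ (fun n => a n + s * b.repr f.toH10 n) ≤ C * seriesMass b γ ε φ a := by
  obtain ⟨C, hC0, hC⟩ := exists_abs_inner_greenReg_le hD f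
  refine ⟨ENNReal.ofReal (Real.exp (γ * (|s| * C))), ENNReal.ofReal_ne_top, fun ε hε a => ?_⟩
  rw [seriesMass, seriesMass, ← lintegral_const_mul' _ _ ENNReal.ofReal_ne_top]
  refine lintegral_mono fun z => ?_
  rw [mul_left_comm]
  gcongr
  rw [seriesDensity_def, seriesDensity_def, ← ENNReal.ofReal_mul (by positivity)]
  refine ENNReal.ofReal_le_ofReal ?_
  rw [expWeight, expWeight, mul_left_comm, ← Real.exp_add]
  gcongr
  have h1 := seriesField_add_smul_le b ε a s f.toH10 z
  have h2 : |s| * |inner ℝ (greenReg D z ε) f.toH10| ≤ |s| * C := by gcongr; exact hC z ε hε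
  nlinarith

/-- The coefficients for which the approximations of `φ` tend to zero. -/
def extinctionSet (b : HilbertBasis ℕ ℝ (H10 D)) (γ : ℝ) (ε : ℕ → ℝ) (φ : ℂ → ℝ≥0∞) :
    Set (ℕ → ℝ) :=
  {a | Tendsto (fun k => seriesMass b γ (ε k) φ a) atTop (𝓝 0)}

lemma measurableSet_extinctionSet (hD : Bornology.IsBounded D) (b : HilbertBasis ℕ ℝ (H10 D))
    (γ : ℝ) {ε : ℕ → ℝ} (hε : ∀ k, 0 < ε k) {φ : ℂ → ℝ≥0∞} (hφ : Measurable φ) :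
    MeasurableSet (extinctionSet b γ ε φ) :=
  measurableSet_tendsto _ fun k => measurable_seriesMass hD b γ (hε k) hφ

lemma add_smul_mem_extinctionSet (hD : Bornology.IsBounded D) (b : HilbertBasis ℕ ℝ (H10 D))
    {γ : ℝ} (hγ : 0 ≤ γ) {ε : ℕ → ℝ} (hε : ∀ k, 0 < ε k) (φ : ℂ → ℝ≥0∞) (f : TestSpace D) (s : ℝ)
    {a : ℕ → ℝ} (ha : a ∈ extinctionSet b γ ε φ) :
    (fun n => a n + s * b.repr f.toH10 n) ∈ extinctionSet b γ ε φ := by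
  obtain ⟨C, hC, hle⟩ := exists_seriesMass_add_smul_le hD b hγ φ f s
  have h1 : Tendsto (fun k => C * seriesMass b γ (ε k) φ a) atTop (𝓝 0) := by
    simpa using ENNReal.Tendsto.const_mul ha (Or.inr hC)
  exact tendsto_of_tendsto_of_tendsto_of_le_of_le tendsto_const_nhds h1 (fun _ => bot_le)
    fun k => hle (ε k) (hε k) a

lemma add_smul_mem_extinctionSet_iff (hD : Bornology.IsBounded D) (b : HilbertBasis ℕ ℝ (H10 D))
    {γ : ℝ} (hγ : 0 ≤ γ) {ε : ℕ → ℝ} (hε : ∀ k, 0 < ε k) (φ : ℂ → ℝ≥0∞) (f : TestSpace D) (s : ℝ)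
    (a : ℕ → ℝ) : (fun n => a n + s * b.repr f.toH10 n) ∈ extinctionSet b γ ε φ ↔
      a ∈ extinctionSet b γ ε φ := by
  refine ⟨fun ha => ?_, add_smul_mem_extinctionSet hD b hγ hε φ f s⟩
  have := add_smul_mem_extinctionSet hD b hγ hε φ f (-s) ha
  convert this using 2 with n
  ring

namespace GFF

variable {Ω : Type*} [MeasurableSpace Ω] {P : Measure Ω}

lemma integral_pairing (h : GFF D P) (f : H10 D) : ∫ ω, h.pairing f ω ∂P = 0 := by
  have : ∫ x, x ∂(P.map (h.pairing f)) = 0 := by rw [h.map_pairing, integral_id_gaussianReal]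
  rwa [integral_map (h.measurable_pairing f).aemeasurable (by fun_prop)] at this

lemma covariance_pairing (h : GFF D P) (f g : H10 D) :
    cov[h.pairing f, h.pairing g; P] = inner ℝ f g := by
  have hP : IsProbabilityMeasure P := h.indep_coeff.isProbabilityMeasure
  have hi : ∀ u, Integrable (fun ω => h.pairing u ω ^ 2) P := fun u =>
    (h.memLp_pairing u).integrable_sq
  have hfg : Integrable (fun ω => h.pairing f ω * h.pairing g ω) P :=
    (h.memLp_pairing f).integrable_mul (h.memLp_pairing g)
  rw [covariance_eq_sub (h.memLp_pairing f) (h.memLp_pairing g), h.integral_pairing f, zero_mul,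
    sub_zero]
  have h1 : ∫ ω, h.pairing (f + g) ω ^ 2 ∂P =
      ‖f‖ ^ 2 + 2 * ∫ ω, h.pairing f ω * h.pairing g ω ∂P + ‖g‖ ^ 2 := by
    have h0 : Integrable (fun ω => h.pairing f ω ^ 2 + 2 * (h.pairing f ω * h.pairing g ω)) P :=
      (hi f).add (hfg.const_mul 2)
    rw [← h.integral_pairing_sq f, ← h.integral_pairing_sq g, ← integral_const_mul,
      ← integral_add (hi f) (hfg.const_mul 2), ← integral_add h0 (hi g)]
    refine integral_congr_ae ?_
    filter_upwards [h.ae_pairing_add f g] with ω hω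
    rw [hω]; ring
  rw [h.integral_pairing_sq, norm_add_sq_real] at h1
  have h2 : ∫ ω, h.pairing f ω * h.pairing g ω ∂P = inner ℝ f g := by linarith
  exact h2

/-- The component of the coefficients orthogonal to `f` is independent of the pairing with `f`. -/
lemma indepFun_pairing_of_inner_eq_zero (h : GFF D P) {g : ℕ → H10 D} {f : H10 D}
    (hg : ∀ n, inner ℝ (g n) f = 0) :
    IndepFun (fun ω n => h.pairing (g n) ω) (h.pairing f) P := by
  have h1 : IsGaussianProcess (Sum.elim (fun n => h.pairing (g n))
      fun _ : Unit => h.pairing f) P := by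
    have h0 : Sum.elim (fun n => h.pairing (g n)) (fun _ : Unit => h.pairing f) =
        h.pairing ∘ Sum.elim g fun _ : Unit => f := by
      ext x
      cases x <;> rfl
    rw [h0]
    exact h.isGaussianProcess_pairing.comp_right _
  have h2 := h1.indepFun_of_covariance_eq_zero (fun n => (h.measurable_pairing _).aemeasurable)
    (fun _ => (h.measurable_pairing _).aemeasurable) fun n _ => by
      rw [h.covariance_pairing, hg]
  exact h2.comp (φ := id) (ψ := fun x : Unit → ℝ => x ()) measurable_id (measurable_pi_apply _)

/-- An event invariant under the shift in the direction of `f` is independent of the pairing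
with `f`. -/
lemma measure_inter_pairing (h : GFF D P) {B : Set (ℕ → ℝ)} (hB : MeasurableSet B) (f : H10 D)
    (hinv : ∀ (s : ℝ) (a : ℕ → ℝ), (fun n => a n + s * h.basis.repr f n) ∈ B ↔ a ∈ B)
    {A : Set ℝ} (hA : MeasurableSet A) :
    P ({ω | (fun n => h.coeff n ω) ∈ B} ∩ h.pairing f ⁻¹' A) =
      P {ω | (fun n => h.coeff n ω) ∈ B} * P (h.pairing f ⁻¹' A) := by
  set α : ℕ → ℝ := fun n => h.basis.repr f n with hα
  -- The component of the n-th basis vector orthogonal to `f`; for f = 0 the inverse is 0 and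
  -- nothing is subtracted.
  set g : ℕ → H10 D := fun n => h.basis n + (-(‖f‖ ^ 2)⁻¹ * α n) • f with hg
  have hgf : ∀ n, inner ℝ (g n) f = 0 := fun n => by
    rw [hg, inner_add_left, real_inner_smul_left, real_inner_self_eq_norm_sq, hα]
    simp only [h.basis.repr_apply_apply]
    by_cases hf : f = 0
    · simp [hf]
    · have : ‖f‖ ≠ 0 := norm_ne_zero_iff.2 hf
      field_simp
      ring
  have hpair : ∀ᵐ ω ∂P, ∀ n, h.pairing (g n) ω =
      h.coeff n ω + (-(‖f‖ ^ 2)⁻¹ * h.pairing f ω) * α n := by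
    rw [ae_all_iff]
    intro n
    filter_upwards [h.ae_pairing_add (h.basis n) ((-(‖f‖ ^ 2)⁻¹ * α n) • f),
      h.ae_pairing_smul (-(‖f‖ ^ 2)⁻¹ * α n) f] with ω h1 h2
    rw [hg, h1, h2, h.pairing_basis]
    ring
  -- The pairings with `g` are the coefficients shifted along `f` by the random amount -⟨h, f⟩_∇ /
  -- ‖f‖². Invariance under all real shifts permits this path by path.
  have hE : {ω | (fun n => h.coeff n ω) ∈ B} =ᵐ[P] {ω | (fun n => h.pairing (g n) ω) ∈ B} := by
    filter_upwards [hpair] with ω hω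
    refine propext ?_
    change (fun n => h.coeff n ω) ∈ B ↔ (fun n => h.pairing (g n) ω) ∈ B
    rw [funext hω]
    exact (hinv _ _).symm
  have hEA : ({ω | (fun n => h.coeff n ω) ∈ B} ∩ h.pairing f ⁻¹' A : Set Ω) =ᵐ[P]
      ({ω | (fun n => h.pairing (g n) ω) ∈ B} ∩ h.pairing f ⁻¹' A : Set Ω) :=
    hE.inter (ae_eq_refl _)
  rw [measure_congr hE, measure_congr hEA]
  exact (h.indepFun_pairing_of_inner_eq_zero hgf).measure_inter_preimage_eq_mul _ _ hB hA

end GFF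

end Liouville
end

/-! ### Zero–one law and nondegeneracy -/

noncomputable section

namespace Liouville

variable {D : Set ℂ}

namespace GFF

variable {Ω : Type*} [MeasurableSpace Ω] {P : Measure Ω}

lemma setIntegral_exp_pairing_toH10 (h : GFF D P) {B : Set (ℕ → ℝ)} (hB : MeasurableSet B)
    (f : TestSpace D)
    (hinv : ∀ (s : ℝ) (a : ℕ → ℝ), (fun n => a n + s * h.basis.repr f.toH10 n) ∈ B ↔ a ∈ B) :
    ∫ ω in {ω | (fun n => h.coeff n ω) ∈ B}, Complex.exp (h.pairing f.toH10 ω * Complex.I) ∂P =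
      P.real {ω | (fun n => h.coeff n ω) ∈ B} *
        ∫ ω, Complex.exp (h.pairing f.toH10 ω * Complex.I) ∂P := by
  set E := {ω | (fun n => h.coeff n ω) ∈ B} with hE
  have hm := h.measurable_pairing f.toH10
  have h1 : (P.restrict E).map (h.pairing f.toH10) = P E • P.map (h.pairing f.toH10) := by
    ext A hA
    rw [Measure.map_apply hm hA, Measure.restrict_apply (hm hA), Measure.smul_apply,
      Measure.map_apply hm hA, Set.inter_comm, h.measure_inter_pairing hB _ hinv hA, smul_eq_mul]
  have hc : Continuous fun x : ℝ => Complex.exp (x * Complex.I) := by fun_prop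
  have h2 := integral_map (μ := P.restrict E) hm.aemeasurable
    (hc.aestronglyMeasurable (μ := (P.restrict E).map (h.pairing f.toH10)))
  have h3 := integral_map (μ := P) hm.aemeasurable
    (hc.aestronglyMeasurable (μ := P.map (h.pairing f.toH10)))
  rw [← h2, h1, integral_smul_measure, h3, Complex.real_smul, Measure.real]

lemma tendsto_integral_exp {μ : Measure Ω} [IsFiniteMeasure μ] {X : ℕ → Ω → ℝ} {Y : Ω → ℝ}
    (hX : ∀ k, Measurable (X k)) (h : ∀ᵐ ω ∂μ, Tendsto (fun k => X k ω) atTop (𝓝 (Y ω))) :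
    Tendsto (fun k => ∫ ω, Complex.exp (X k ω * Complex.I) ∂μ) atTop
      (𝓝 (∫ ω, Complex.exp (Y ω * Complex.I) ∂μ)) := by
  refine tendsto_integral_of_dominated_convergence (fun _ => 1) (fun k => ?_)
    (integrable_const _) (fun k => Eventually.of_forall fun ω => ?_) ?_
  · have := hX k
    exact Measurable.aestronglyMeasurable (by fun_prop)
  · rw [Complex.norm_exp_ofReal_mul_I]
  · filter_upwards [h] with ω hω
    have : Continuous fun x : ℝ => Complex.exp (x * Complex.I) := by fun_prop
    exact (this.tendsto _).comp hω

/-- Invariance is known only along test functions, and a basis vector need not be one. The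
factorised characteristic function, unlike the invariance, passes to limits in H¹₀(D). -/
lemma setIntegral_exp_pairing (h : GFF D P) {B : Set (ℕ → ℝ)} (hB : MeasurableSet B)
    (hinv : ∀ (f : TestSpace D) (s : ℝ) (a : ℕ → ℝ),
      (fun n => a n + s * h.basis.repr f.toH10 n) ∈ B ↔ a ∈ B) (F : H10 D) :
    ∫ ω in {ω | (fun n => h.coeff n ω) ∈ B}, Complex.exp (h.pairing F ω * Complex.I) ∂P =
      P.real {ω | (fun n => h.coeff n ω) ∈ B} *
        ∫ ω, Complex.exp (h.pairing F ω * Complex.I) ∂P := by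
  have hP : IsProbabilityMeasure P := h.indep_coeff.isProbabilityMeasure
  obtain ⟨u, -, hu⟩ := h.exists_ae_tendsto_pairing_toH10 F
  have hm := fun k => h.measurable_pairing (u k).toH10
  refine tendsto_nhds_unique (tendsto_integral_exp hm (ae_restrict_of_ae hu))
    (((tendsto_integral_exp hm hu).const_mul _).congr fun k => ?_)
  exact (h.setIntegral_exp_pairing_toH10 hB (u k) (hinv (u k))).symm

/-- A linear functional of finitely many coefficients is one pairing, so finite-dimensional laws
reduce to the one-dimensional identity of `setIntegral_exp_pairing`. -/
lemma charFunDual_map_coeff (h : GFF D P) (μ : Measure Ω) (hμ : μ ≪ P) (I : Finset ℕ)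
    (L : StrongDual ℝ (I → ℝ)) :
    charFunDual ((μ.map fun ω n => h.coeff n ω).map I.restrict) L =
      ∫ ω, Complex.exp (h.pairing (∑ i : I, L (Pi.single i 1) • h.basis i) ω * Complex.I) ∂μ := by
  have hm : Measurable fun ω n => h.coeff n ω := measurable_pi_lambda _ h.measurable_coeff
  have hr : Measurable (I.restrict (π := fun _ => ℝ)) := Finset.measurable_restrict I
  rw [charFunDual_apply, Measure.map_map hr hm,
    integral_map (hr.comp hm).aemeasurable (by fun_prop)]
  refine integral_congr_ae ?_
  filter_upwards [hμ.ae_le (h.ae_pairing_sum Finset.univ (fun i : I => L (Pi.single i 1))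
    fun i => h.basis i)] with ω hω
  rw [hω, Function.comp_apply, ← L.sum_comp_single]
  congr 3
  refine Finset.sum_congr rfl fun i _ => ?_
  have : (Pi.single i (h.coeff i ω) : I → ℝ) = h.coeff i ω • Pi.single i 1 := by
    rw [← Pi.single_smul, smul_eq_mul, mul_one]
  rw [ContinuousLinearMap.comp_apply, ContinuousLinearMap.single_apply,
    show I.restrict (fun n => h.coeff n ω) i = h.coeff i ω from rfl, this, map_smul,
    smul_eq_mul, mul_comm, h.pairing_basis]

/-- An event invariant under Cameron–Martin shifts by test functions has probability zero or
one. -/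
lemma measure_eq_zero_or_one_of_shift_invariant (h : GFF D P) {B : Set (ℕ → ℝ)}
    (hB : MeasurableSet B)
    (hinv : ∀ (f : TestSpace D) (s : ℝ) (a : ℕ → ℝ),
      (fun n => a n + s * h.basis.repr f.toH10 n) ∈ B ↔ a ∈ B) :
    P {ω | (fun n => h.coeff n ω) ∈ B} = 0 ∨ P {ω | (fun n => h.coeff n ω) ∈ B} = 1 := by
  have hP : IsProbabilityMeasure P := h.indep_coeff.isProbabilityMeasure
  set E := {ω | (fun n => h.coeff n ω) ∈ B} with hE
  have hm : Measurable fun ω n => h.coeff n ω := measurable_pi_lambda _ h.measurable_coeff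
  have hEm : MeasurableSet E := hm hB
  set ν₁ := (P.restrict E).map fun ω n => h.coeff n ω with hν₁
  set ν₂ := (P E • P).map fun ω n => h.coeff n ω with hν₂
  have hf : IsFiniteMeasure (P E • P) := Measure.smul_finite P (measure_ne_top P E)
  -- Equality of all finite-dimensional laws says that `E` is independent of the whole coefficient
  -- sequence, hence of itself: P(E) = P(E)².
  have heq : ν₁ = ν₂ := by
    refine IsProjectiveLimit.unique (P := fun I : Finset ℕ => ν₂.map I.restrict)
      (fun I => Measure.ext_of_charFunDual (funext fun L => ?_)) fun I => rfl
    rw [hν₁, hν₂, h.charFunDual_map_coeff _ Measure.absolutelyContinuous_restrict,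
      h.charFunDual_map_coeff _ (Measure.smul_absolutelyContinuous),
      h.setIntegral_exp_pairing hB hinv, integral_smul_measure, Complex.real_smul, Measure.real]
  have h1 : ν₁ B = P E := by
    rw [hν₁, Measure.map_apply hm hB, Measure.restrict_apply (hm hB)]
    exact congrArg P (Set.inter_self E)
  have h2 : ν₂ B = P E * P E := by
    rw [hν₂, Measure.map_apply hm hB, Measure.smul_apply, smul_eq_mul]
    rfl
  rw [heq, h2] at h1
  by_cases h0 : P E = 0
  · exact Or.inl h0
  · exact Or.inr ((ENNReal.mul_eq_left h0 (measure_ne_top P E)).1 h1)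

/-- The expected density. -/
lemma lintegral_density (h : GFF D P) (γ : ℝ) {ε : ℝ} (hε : 0 < ε) (z : ℂ) :
    ∫⁻ ω, h.density γ ε ω z ∂P =
      ENNReal.ofReal (Real.exp (γ ^ 2 / 2 * (‖greenReg D z ε‖ ^ 2 + Real.log ε))) := by
  have h1 : ∀ᵐ ω ∂P, h.density γ ε ω z = ENNReal.ofReal
      (ε ^ (γ ^ 2 / 2) * Real.exp (h.pairing (γ • greenReg D z ε) ω)) := by
    filter_upwards [h.ae_pairing_smul γ (greenReg D z ε)] with ω hω
    rw [hω, density_def, expWeight, circleAvg]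
  rw [lintegral_congr_ae h1]
  obtain ⟨h2, h3⟩ := h.integral_exp_pairing (γ • greenReg D z ε)
  rw [← ofReal_integral_eq_lintegral_ofReal (h2.const_mul _)
    (Eventually.of_forall fun ω => by positivity), integral_const_mul, h3,
    Real.rpow_def_of_pos hε, ← Real.exp_add, norm_smul, mul_pow, Real.norm_eq_abs, sq_abs]
  congr 2
  ring

lemma lintegral_mass (h : GFF D P) (hD : Bornology.IsBounded D) (γ : ℝ) {ε : ℝ} (hε : 0 < ε)
    {φ : ℂ → ℝ≥0∞} (hφ : Measurable φ) :
    ∫⁻ ω, h.mass γ ε φ ω ∂P = ∫⁻ z in D, φ z *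
      ENNReal.ofReal (Real.exp (γ ^ 2 / 2 * (‖greenReg D z ε‖ ^ 2 + Real.log ε))) := by
  have hP : IsProbabilityMeasure P := h.indep_coeff.isProbabilityMeasure
  unfold mass
  have hm : Measurable fun p : Ω × ℂ => φ p.2 * h.density γ ε p.1 p.2 :=
    (hφ.comp measurable_snd).mul (h.measurable_density hD γ hε)
  rw [lintegral_lintegral_swap (by exact hm.aemeasurable)]
  refine lintegral_congr fun z => ?_
  have hz : Measurable fun ω => h.density γ ε ω z := by
    have := (h.measurable_density hD γ hε).comp (measurable_prodMk_right (y := z))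
    simpa only [Function.comp_def] using this
  rw [lintegral_const_mul _ hz, h.lintegral_density γ hε]

/-- The expected mass near a point stays bounded below. -/
lemma le_lintegral_mass (h : GFF D P) (hD : Bornology.IsBounded D) (γ : ℝ) {ε r : ℝ} (hε : 0 < ε)
    (hεr : ε < r) {φ : ℂ → ℝ≥0∞} (hφ : Measurable φ)
    (hr : ∀ z, φ z ≠ 0 → Metric.closedBall z r ⊆ D) :
    ENNReal.ofReal (Real.exp (γ ^ 2 / 2 * Real.log r)) * ∫⁻ z in D, φ z ≤
      ∫⁻ ω, h.mass γ ε φ ω ∂P := by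
  rw [h.lintegral_mass hD γ hε hφ, ← lintegral_const_mul _ hφ]
  refine lintegral_mono fun z => ?_
  rw [mul_comm]
  by_cases hz : φ z = 0
  · simp [hz]
  gcongr
  rw [norm_sq_greenReg_eq hD hε hεr (hr z hz), Real.log_div (hε.trans hεr).ne' hε.ne']
  nlinarith [sq_nonneg ‖greenReg D z r‖]

/-- The approximations do not tend to zero almost surely. -/
lemma not_ae_tendsto_mass_zero (h : GFF D P) (hDo : IsOpen D) (hD : Bornology.IsBounded D)
    {γ : ℝ} (hγ : γ ^ 2 < 2) {ε : ℕ → ℝ} (hε : ∀ k, 0 < ε k) (hε0 : Tendsto ε atTop (𝓝 0))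
    {r : ℝ} (hr0 : 0 < r) {φ : ℂ → ℝ≥0∞} (hφ : Measurable φ) (hφ1 : ∀ z, φ z ≤ 1)
    (hr : ∀ z, φ z ≠ 0 → Metric.closedBall z r ⊆ D) (hφ0 : ∫⁻ z in D, φ z ≠ 0) :
    ¬∀ᵐ ω ∂P, Tendsto (fun k => h.mass γ (ε k) φ ω) atTop (𝓝 0) := by
  have hP : IsProbabilityMeasure P := h.indep_coeff.isProbabilityMeasure
  intro hlim
  set c := ENNReal.ofReal (Real.exp (γ ^ 2 / 2 * Real.log r)) * ∫⁻ z in D, φ z with hc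
  have hc0 : c ≠ 0 := mul_ne_zero (by simp [Real.exp_pos]) hφ0
  have hctop : c ≠ ⊤ := by
    refine ENNReal.mul_ne_top ENNReal.ofReal_ne_top (ne_top_of_le_ne_top
      (hD.measure_lt_top (μ := volume)).ne ?_)
    exact (lintegral_mono hφ1).trans (by simp)
  -- Here `c` is the lower bound for expected masses at small radii. If the masses tended to 0
  -- almost surely, Fatou would turn the Cauchy bound c/2 into an L² bound on one mass,
  -- contradicting its mean being at least c.
  obtain ⟨ε₀, hε₀, hle⟩ := h.exists_eLpNorm_mass_sub_le hDo hD hγ ENNReal.one_ne_top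
    (ENNReal.half_pos hc0).ne'
  have hev := (hε0.eventually_lt_const hε₀).and (hε0.eventually_lt_const hr0)
  obtain ⟨k, hk, hkr⟩ := hev.exists
  have hmm : ∀ k, Measurable fun ω => (h.mass γ (ε k) φ ω).toReal := fun k =>
    (h.measurable_mass hD γ (hε k) hφ).ennreal_toReal
  have h1 : eLpNorm (fun ω => (h.mass γ (ε k) φ ω).toReal) 2 P ≤ c / 2 := by
    refine Lp.eLpNorm_le_of_ae_tendsto (u := atTop)
      (f := fun m ω => (h.mass γ (ε k) φ ω).toReal - (h.mass γ (ε m) φ ω).toReal)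
      ?_ (fun m => ((hmm k).sub (hmm m)).aestronglyMeasurable) ?_
    · filter_upwards [hev] with m hm
      exact hle φ hφ hφ1 _ _ (hε k) hk (hε m) hm.1
    · filter_upwards [hlim] with ω hω
      have := (ENNReal.tendsto_toReal ENNReal.zero_ne_top).comp hω
      simpa using this.const_sub (h.mass γ (ε k) φ ω).toReal
  have h2 : ∫⁻ ω, h.mass γ (ε k) φ ω ∂P ≤ c / 2 := by
    refine le_trans ?_ ((eLpNorm_le_eLpNorm_of_exponent_le (by norm_num : (1 : ℝ≥0∞) ≤ 2)
      (hmm k).aestronglyMeasurable).trans h1)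
    rw [eLpNorm_one_eq_lintegral_enorm]
    refine le_of_eq (lintegral_congr_ae ?_)
    filter_upwards [h.ae_mass_ne_top hDo hD γ (hε k) hφ ENNReal.one_ne_top fun z _ => hφ1 z]
      with ω hω
    rw [Real.enorm_of_nonneg ENNReal.toReal_nonneg, ENNReal.ofReal_toReal hω]
  have h3 := (h.le_lintegral_mass hD γ (hε k) hkr hφ hr).trans h2
  exact absurd h3 (not_le.2 (ENNReal.half_lt_self hc0 hctop))

/-- Almost surely, the approximations do not tend to zero. -/
lemma ae_not_tendsto_mass_zero (h : GFF D P) (hDo : IsOpen D) (hD : Bornology.IsBounded D)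
    {γ : ℝ} (hγ0 : 0 ≤ γ) (hγ : γ ^ 2 < 2) {ε : ℕ → ℝ} (hε : ∀ k, 0 < ε k)
    (hε0 : Tendsto ε atTop (𝓝 0)) {r : ℝ} (hr0 : 0 < r) {φ : ℂ → ℝ≥0∞} (hφ : Measurable φ)
    (hφ1 : ∀ z, φ z ≤ 1) (hr : ∀ z, φ z ≠ 0 → Metric.closedBall z r ⊆ D)
    (hφ0 : ∫⁻ z in D, φ z ≠ 0) :
    ∀ᵐ ω ∂P, ¬Tendsto (fun k => h.mass γ (ε k) φ ω) atTop (𝓝 0) := by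
  have hP : IsProbabilityMeasure P := h.indep_coeff.isProbabilityMeasure
  have hB := measurableSet_extinctionSet hD h.basis γ hε hφ
  have hE : {ω | (fun n => h.coeff n ω) ∈ extinctionSet h.basis γ ε φ} =
      {ω | Tendsto (fun k => h.mass γ (ε k) φ ω) atTop (𝓝 0)} := rfl
  have hEm : MeasurableSet {ω | Tendsto (fun k => h.mass γ (ε k) φ ω) atTop (𝓝 0)} :=
    measurableSet_tendsto _ fun k => h.measurable_mass hD γ (hε k) hφ
  rcases h.measure_eq_zero_or_one_of_shift_invariant hB
    (add_smul_mem_extinctionSet_iff hD h.basis hγ0 hε φ) with h0 | h1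
  · rw [hE] at h0
    exact measure_eq_zero_iff_ae_notMem.1 h0
  · rw [hE] at h1
    exact absurd ((mem_ae_iff_prob_eq_one hEm).2 h1)
      (h.not_ae_tendsto_mass_zero hDo hD hγ hε hε0 hr0 hφ hφ1 hr hφ0)

end GFF

lemma exists_bump (hDo : IsOpen D) (hne : D.Nonempty) :
    ∃ (φ : ℂ → ℝ) (r : ℝ), 0 < r ∧ Continuous φ ∧ (∀ z, 0 ≤ φ z) ∧ (∀ z, φ z ≤ 1) ∧
      (∀ z, φ z ≠ 0 → Metric.closedBall z r ⊆ D) ∧ ∫⁻ z in D, ENNReal.ofReal (φ z) ≠ 0 := by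
  obtain ⟨x, hx⟩ := hne
  obtain ⟨s, hs, hsD⟩ := Metric.isOpen_iff.1 hDo x hx
  -- The bump lives in the ball of radius `r`, so closed `r`-balls around its points stay within 2r
  -- < s of `x`.
  set r := s / 3 with hr
  have hr0 : 0 < r := by positivity
  have hcont : Continuous fun z : ℂ => max 0 (1 - dist z x / r) := by fun_prop
  refine ⟨fun z => max 0 (1 - dist z x / r), r, hr0, hcont, fun z => le_max_left _ _, fun z => ?_,
    fun z hz y hy => hsD ?_, ?_⟩
  · have : 0 ≤ dist z x / r := by positivity
    exact max_le zero_le_one (by linarith)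
  · have h1 : dist z x < r := by
      by_contra hcon
      refine hz (max_eq_left ?_)
      have : 1 ≤ dist z x / r := (one_le_div hr0).2 (not_lt.1 hcon)
      linarith
    have h2 := dist_triangle y z x
    rw [Metric.mem_closedBall] at hy
    rw [Metric.mem_ball]
    linarith
  · have h1 := hcont.measurable.ennreal_ofReal
    intro h0
    have h2 := (lintegral_eq_zero_iff h1).1 h0
    have h3 : Metric.ball x r ⊆ D := (Metric.ball_subset_ball (by linarith)).trans hsD
    have h4 := ae_restrict_of_ae_restrict_of_subset h3 h2
    rw [ae_restrict_iff' measurableSet_ball] at h4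
    refine (Metric.measure_ball_pos volume x hr0).ne'
      (measure_eq_zero_iff_ae_notMem.2 (h4.mono fun z hcon hz => ?_))
    have h5 := hcon hz
    rw [Metric.mem_ball] at hz
    simp only [Pi.zero_apply, ENNReal.ofReal_eq_zero] at h5
    have h6 := (le_max_right 0 (1 - dist z x / r)).trans h5
    have h7 : dist z x / r < 1 := (div_lt_one hr0).2 hz
    linarith

end Liouville
end

/-! ### Positivity of the limit on D and the theorem -/

noncomputable section

namespace Liouville

variable {D : Set ℂ}

/-- Since the bump vanishes off `D`, a limit with no mass in `D` integrates it to 0, so its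
approximate masses tend to 0, which almost surely fails. A bump inside `D`, rather than the constant
1, rules out mass carried only by the boundary. -/
lemma GFF.ae_limit_measure_pos {Ω : Type*} [MeasurableSpace Ω] {P : Measure Ω} (h : GFF D P)
    (hDo : IsOpen D) (hD : Bornology.IsBounded D) (hne : D.Nonempty) {γ : ℝ} (hγ0 : 0 ≤ γ)
    (hγ : γ ^ 2 < 2) {ε : ℕ → ℝ} (hε : ∀ k, 0 < ε k) (hε0 : Tendsto ε atTop (𝓝 0))
    {μ : Ω → Measure ℂ}
    (hlim : ∀ᵐ ω ∂P, ∀ φ : ℂ → ℝ, ContinuousOn φ (closure D) →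
      Tendsto (fun k => ∫ z, φ z ∂(h.approxMeasure γ (ε k) ω)) atTop (𝓝 (∫ z, φ z ∂(μ ω)))) :
    ∀ᵐ ω ∂P, 0 < μ ω D := by
  obtain ⟨φ, r, hr0, hφ, hφ0, hφ1, hr, hint⟩ := exists_bump hDo hne
  have hφ1' : ∀ z, ENNReal.ofReal (φ z) ≤ 1 := fun z => ENNReal.ofReal_le_one.2 (hφ1 z)
  have hφm := hφ.measurable.ennreal_ofReal
  have h1 := h.ae_not_tendsto_mass_zero hDo hD hγ0 hγ hε hε0 hr0 hφm hφ1'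
    (fun z hz => hr z fun h0 => hz (by rw [h0, ENNReal.ofReal_zero])) hint
  filter_upwards [h1, hlim, ae_all_iff.2 fun k => h.ae_isFiniteMeasure hDo hD γ (hε k)]
    with ω hω1 hω2 hω3
  rw [pos_iff_ne_zero]
  intro hzero
  refine hω1 ?_
  have h2 : ∫ z, φ z ∂(μ ω) = 0 := by
    refine integral_eq_zero_of_ae ?_
    have h3 : ∀ᵐ z ∂(μ ω), z ∉ D := measure_eq_zero_iff_ae_notMem.1 hzero
    filter_upwards [h3] with z hz
    by_contra hne
    exact hz (hr z hne (Metric.mem_closedBall_self hr0.le))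
  have h3 := hω2 φ hφ.continuousOn
  rw [h2] at h3
  have h4 : ∀ k, h.mass γ (ε k) (fun z => ENNReal.ofReal (φ z)) ω =
      ENNReal.ofReal (∫ z, φ z ∂(h.approxMeasure γ (ε k) ω)) := fun k => by
    have := hω3 k
    have hi : Integrable φ (h.approxMeasure γ (ε k) ω) :=
      Integrable.of_bound hφ.aestronglyMeasurable 1 (Eventually.of_forall fun z => by
        rw [Real.norm_of_nonneg (hφ0 z)]; exact hφ1 z)
    rw [ofReal_integral_eq_lintegral_ofReal hi (Eventually.of_forall hφ0),
      h.lintegral_approxMeasure hD γ (hε k) hφm]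
  simp_rw [h4]
  simpa using ENNReal.tendsto_ofReal h3

end Liouville
end

theorem mainTheorem1 {D : Set ℂ} (hDopen : IsOpen D) (hDconn : IsConnected D)
    (hDbdd : Bornology.IsBounded D)
    {Ω : Type*} [MeasurableSpace Ω] (P : Measure Ω) [IsProbabilityMeasure P]
    (h : Liouville.GFF D P) (γ : ℝ) (hγ0 : 0 ≤ γ) (hγ : γ < Real.sqrt 2) :
    -- for every `ε > 0`, the measure `μ_ε` is almost surely finite
    (∀ ε : ℝ, 0 < ε → ∀ᵐ ω ∂P, IsFiniteMeasure (h.approxMeasure γ ε ω)) ∧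
    -- for every continuous `φ` on the closure of `D`, the family `μ_ε(φ)` is Cauchy in `L²`
    (∀ φ : ℂ → ℝ, ContinuousOn φ (closure D) →
      (∀ ε : ℝ, 0 < ε → MemLp (fun ω => ∫ z, φ z ∂(h.approxMeasure γ ε ω)) 2 P) ∧
      ∀ δ : ℝ, 0 < δ → ∃ ε₀ : ℝ, 0 < ε₀ ∧ ∀ ε η : ℝ, 0 < ε → ε < ε₀ → 0 < η → η < ε₀ →
        eLpNorm (fun ω => (∫ z, φ z ∂(h.approxMeasure γ ε ω)) -
          ∫ z, φ z ∂(h.approxMeasure γ η ω)) 2 P ≤ ENNReal.ofReal δ) ∧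
    -- along a deterministic sequence, `μ_ε` converges almost surely weakly on the closure of `D`
    -- to a random finite measure that is measurable with respect to `h` and nondegenerate
    (∃ ε : ℕ → ℝ, (∀ k, 0 < ε k) ∧ StrictAnti ε ∧ Tendsto ε atTop (𝓝 0) ∧
      ∃ μ : Ω → Measure ℂ,
        (∀ ω, IsFiniteMeasure (μ ω)) ∧ (∀ ω, μ ω (closure D)ᶜ = 0) ∧
        Measurable[h.sigma] μ ∧
        (∀ᵐ ω ∂P, ∀ φ : ℂ → ℝ, ContinuousOn φ (closure D) →
          Tendsto (fun k => ∫ z, φ z ∂(h.approxMeasure γ (ε k) ω)) atTop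
            (𝓝 (∫ z, φ z ∂(μ ω)))) ∧
        ∀ᵐ ω ∂P, 0 < μ ω D) := by
  have hγ2 := Liouville.sq_lt_two hγ0 hγ
  refine ⟨fun ε hε => h.ae_isFiniteMeasure hDopen hDbdd γ hε, fun φ hφ => ?_, ?_⟩
  · obtain ⟨c, hm, hc⟩ := Liouville.exists_measurable_bounded_eqOn hDopen hDbdd hφ
    have h1 := fun (ε : ℝ) (hε : 0 < ε) =>
      h.memLp_integral_approxMeasure hDopen hDbdd γ hε hm hc
    have h2 := fun (δ : ℝ) (hδ : 0 < δ) => h.exists_eLpNorm_integral_sub_le hDopen hDbdd hγ2 hm hc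
      (τ := ENNReal.ofReal δ) (by simpa using hδ)
    simp_rw [h.integral_indicator_approxMeasure hDopen] at h1 h2
    exact ⟨h1, h2⟩
  · obtain ⟨ε, hε, hanti, hε0, μ, hfin, hcl, hmeas, hlim⟩ :=
      h.exists_limit_measure hDopen hDbdd hγ2
    refine ⟨ε, hε, hanti, hε0, μ, hfin, hcl, hmeas, hlim, ?_⟩
    exact h.ae_limit_measure_pos hDopen hDbdd hDconn.nonempty hγ0 hγ2 hε hε0 hlim
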